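/- Let $n>1$ be an integer and let $\varphi\colon \mathcal{O}_{\mathbb{P}^3}^{\oplus n+1}\to\mathcal{O}_{\mathbb{P}^3}(1)^{\oplus n}$ be a general morphism of vector bundles on $\mathbb{P}^3=\mathbb{P}^3_{\mathbb{C}}$, that is, a general $n\times(n+1)$ matrix of linear forms in four variables (general: the coefficients of the forms lie in a suitable nonempty Zariski open subset, depending only on $n$, of the affine space $\mathbb{C}^{4n(n+1)}$ of all coefficients). Let $S_n=D_{n-1}(\varphi)\subset\mathbb{P}^3$ be its first degeneracy locus, i.e. the closed subscheme defined by the $n\times n$ minors of the matrix. Then $S_n$ is a smooth connected curve over $\mathbb{C}$. Its genus $g(S_n)=\dim_{\mathbb{C}}H^1(S_n,\mathcal{O}_{S_n})$ and its degree in $\mathbb{P}^3$ are $$g(S_n)=n\binom{n}{3}-(n+1)\binom{n-1}{3},\qquad \deg(S_n)=\binom{n+1}{2}.$$ -/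

import Mathlib

open CategoryTheory AlgebraicGeometry

noncomputable section

namespace DegeneracyCurve

/-! ### The quotient of a graded algebra by a homogeneous ideal -/

section QuotientGrading

variable {k A : Type} [Field k] [CommRing A] [Algebra k A]
  (𝒜 : ℕ → Submodule k A)

/-- The degree `d` part of `A ⧸ I`: the image of the degree `d` part of `A`. -/
def quotientGrading (I : Ideal A) (d : ℕ) : Submodule k (A ⧸ I) :=
  (𝒜 d).map (Ideal.Quotient.mkₐ k I).toLinearMap

/-- The quotient map in degree `d`. -/
def toQuotientGrading (I : Ideal A) (d : ℕ) : 𝒜 d →ₗ[k] quotientGrading 𝒜 I d :=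
  (Ideal.Quotient.mkₐ k I).toLinearMap.restrict
    (fun _ hx => Submodule.mem_map_of_mem (p := 𝒜 d) hx)

lemma coe_toQuotientGrading (I : Ideal A) (d : ℕ) (x : 𝒜 d) :
    (toQuotientGrading 𝒜 I d x : A ⧸ I) = Ideal.Quotient.mk I x := rfl

lemma quotientGrading_gradedMonoid [SetLike.GradedMonoid 𝒜] (I : Ideal A) :
    SetLike.GradedMonoid (quotientGrading 𝒜 I) where
  one_mem := ⟨1, SetLike.GradedOne.one_mem, map_one (Ideal.Quotient.mkₐ k I)⟩
  mul_mem := by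
    rintro i j _ _ ⟨a, ha, rfl⟩ ⟨b, hb, rfl⟩
    exact ⟨a * b, SetLike.GradedMul.mul_mem ha hb, map_mul (Ideal.Quotient.mkₐ k I) a b⟩

variable [GradedAlgebra 𝒜]

/-- Decompose an element of `A` and reduce each homogeneous component modulo `I`. -/
def decomposeMod (I : Ideal A) : A →ₗ[k] DirectSum ℕ fun d => quotientGrading 𝒜 I d :=
  (DirectSum.lmap (toQuotientGrading 𝒜 I)).comp
    (DirectSum.decomposeLinearEquiv 𝒜).toLinearMap

lemma decomposeMod_coe (I : Ideal A) (d : ℕ) (x : 𝒜 d) :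
    decomposeMod 𝒜 I (x : A) =
      DirectSum.of (fun d => quotientGrading 𝒜 I d) d (toQuotientGrading 𝒜 I d x) := by
  simp [decomposeMod, DirectSum.decomposeLinearEquiv_apply]

lemma decomposeMod_eq_zero (I : Ideal A) (hI : I.IsHomogeneous 𝒜) (x : A) (hx : x ∈ I) :
    decomposeMod 𝒜 I x = 0 := by
  ext d
  simp only [decomposeMod, LinearMap.comp_apply, LinearEquiv.coe_coe,
    DirectSum.decomposeLinearEquiv_apply, DirectSum.lmap_apply, coe_toQuotientGrading]
  simpa using Ideal.Quotient.eq_zero_iff_mem.mpr (hI d hx)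

/-- The decomposition of `A ⧸ I` induced by that of `A`. -/
def quotientDecompose (I : Ideal A) (hI : I.IsHomogeneous 𝒜) :
    (A ⧸ I) →ₗ[k] DirectSum ℕ fun d => quotientGrading 𝒜 I d where
  toFun := QuotientAddGroup.lift I.toAddSubgroup (decomposeMod 𝒜 I).toAddMonoidHom
    (fun x hx => decomposeMod_eq_zero 𝒜 I hI x hx)
  map_add' x y := map_add _ x y
  map_smul' c y := by
    obtain ⟨x, rfl⟩ := Ideal.Quotient.mk_surjective y
    exact (decomposeMod 𝒜 I).map_smul c x

lemma quotientDecompose_mk (I : Ideal A) (hI : I.IsHomogeneous 𝒜) (x : A) :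
    quotientDecompose 𝒜 I hI (Ideal.Quotient.mk I x) = decomposeMod 𝒜 I x := rfl

/-- The grading on `A ⧸ I` induced by the grading of `A`, for a homogeneous ideal `I`. -/
@[reducible]
def quotientGradedAlgebra (I : Ideal A) (hI : I.IsHomogeneous 𝒜) :
    GradedAlgebra (quotientGrading 𝒜 I) :=
  { quotientGrading_gradedMonoid 𝒜 I with
    toDecomposition :=
      DirectSum.Decomposition.ofLinearMap (quotientGrading 𝒜 I) (quotientDecompose 𝒜 I hI)
        (by
          refine LinearMap.ext fun y => ?_
          obtain ⟨x, rfl⟩ := Ideal.Quotient.mk_surjective y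
          simp only [LinearMap.comp_apply, quotientDecompose_mk, LinearMap.id_apply]
          induction x using DirectSum.Decomposition.inductionOn 𝒜 with
          | zero => simp
          | homogeneous x =>
            rw [decomposeMod_coe]
            simp [coe_toQuotientGrading]
          | add x y hx hy => simp only [map_add, hx, hy])
        (by
          ext d ⟨_, x, hx, rfl⟩ : 2
          simp only [LinearMap.comp_apply, LinearMap.id_apply]
          rw [DirectSum.coeLinearMap_lof]
          exact (quotientDecompose_mk 𝒜 I hI x).trans (decomposeMod_coe 𝒜 I d ⟨x, hx⟩)) }

end QuotientGrading

/-! ### The degeneracy curve -/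

attribute [local instance] MvPolynomial.gradedAlgebra

/-- The homogeneous coordinate ring of projective three-space over `ℂ`. -/
abbrev CoordRing : Type := MvPolynomial (Fin 4) ℂ

/-- The `n × (n + 1)` matrix of linear forms in four variables with coefficients `a`; this is the
map of sheaves `φ : 𝒪^{n+1} → 𝒪(1)^n` on projective three-space. -/
def formMatrix {n : ℕ} (a : Fin n × Fin (n + 1) × Fin 4 → ℂ) :
    Matrix (Fin n) (Fin (n + 1)) CoordRing :=
  Matrix.of fun i j => ∑ l : Fin 4, MvPolynomial.C (a (i, j, l)) * MvPolynomial.X l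

/-- The maximal minor obtained by deleting column `j`. -/
def maximalMinor {n : ℕ} (a : Fin n × Fin (n + 1) × Fin 4 → ℂ) (j : Fin (n + 1)) : CoordRing :=
  ((formMatrix a).submatrix id j.succAbove).det

/-- The homogeneous ideal generated by the maximal minors. -/
def minorIdeal {n : ℕ} (a : Fin n × Fin (n + 1) × Fin 4 → ℂ) : Ideal CoordRing :=
  Ideal.span (Set.range (maximalMinor a))

lemma maximalMinor_isHomogeneous {n : ℕ} (a : Fin n × Fin (n + 1) × Fin 4 → ℂ)
    (j : Fin (n + 1)) : (maximalMinor a j).IsHomogeneous n := by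
  rw [maximalMinor, Matrix.det_apply]
  refine MvPolynomial.IsHomogeneous.sum _ _ _ fun σ _ => ?_
  have h : (∏ i, (formMatrix a).submatrix id j.succAbove (σ i) i).IsHomogeneous
      (∑ _i : Fin n, 1) := by
    refine MvPolynomial.IsHomogeneous.prod _ _ _ fun i _ => ?_
    change (∑ l : Fin 4, MvPolynomial.C (a (σ i, j.succAbove i, l)) *
      MvPolynomial.X l : CoordRing).IsHomogeneous 1
    refine MvPolynomial.IsHomogeneous.sum _ _ _ fun l _ => ?_
    exact MvPolynomial.isHomogeneous_C_mul_X (a (σ i, j.succAbove i, l)) l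
  simp only [Finset.sum_const, Finset.card_univ, Fintype.card_fin, smul_eq_mul, mul_one] at h
  rcases Int.units_eq_one_or (Equiv.Perm.sign σ) with hs | hs
  · simpa [hs] using h
  · simpa [hs] using h.neg

lemma minorIdeal_isHomogeneous {n : ℕ} (a : Fin n × Fin (n + 1) × Fin 4 → ℂ) :
    (minorIdeal a).IsHomogeneous (MvPolynomial.homogeneousSubmodule (Fin 4) ℂ) := by
  refine Ideal.homogeneous_span _ _ ?_
  rintro _ ⟨j, rfl⟩
  exact ⟨n, maximalMinor_isHomogeneous a j⟩

/-- The homogeneous coordinate ring of the degeneracy locus. -/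
abbrev DegeneracyRing {n : ℕ} (a : Fin n × Fin (n + 1) × Fin 4 → ℂ) : Type :=
  CoordRing ⧸ minorIdeal a

/-- Its grading by degree. -/
def degeneracyGrading {n : ℕ} (a : Fin n × Fin (n + 1) × Fin 4 → ℂ) :
    ℕ → Submodule ℂ (DegeneracyRing a) :=
  quotientGrading (MvPolynomial.homogeneousSubmodule (Fin 4) ℂ) (minorIdeal a)

instance {n : ℕ} (a : Fin n × Fin (n + 1) × Fin 4 → ℂ) :
    GradedAlgebra (degeneracyGrading a) :=
  quotientGradedAlgebra _ (minorIdeal a) (minorIdeal_isHomogeneous a)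

/-- The closed subscheme of projective three-space defined by the maximal minors. -/
def degeneracyLocus {n : ℕ} (a : Fin n × Fin (n + 1) × Fin 4 → ℂ) : Scheme :=
  Proj (degeneracyGrading a)

/-- The structure morphism to `Spec ℂ`. -/
def degeneracyStructureMap {n : ℕ} (a : Fin n × Fin (n + 1) × Fin 4 → ℂ) :
    degeneracyLocus a ⟶ Spec (CommRingCat.of ℂ) :=
  Proj.toSpecZero (degeneracyGrading a) ≫
    Spec.map (CommRingCat.ofHom (algebraMap ℂ (degeneracyGrading a 0)))

/-- The affine open cover of the degeneracy locus by the loci where a coordinate is nonzero. -/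
def standardCover {n : ℕ} (a : Fin n × Fin (n + 1) × Fin 4 → ℂ) (l : Fin 4) :
    (degeneracyLocus a).Opens :=
  Proj.basicOpen (degeneracyGrading a) (Ideal.Quotient.mk (minorIdeal a) (MvPolynomial.X l))

/-! ### First cohomology of the structure sheaf, by the Čech complex of a cover -/

section Cech

variable {k : Type} [Field k] {X : Scheme.{0}} (f : X ⟶ Spec (CommRingCat.of k))

/-- Sections of the structure sheaf of a `k`-scheme over an open set. -/
def Sections (_f : X ⟶ Spec (CommRingCat.of k)) (W : X.Opens) : Type := Γ(X, W)

instance (W : X.Opens) : CommRing (Sections f W) := inferInstanceAs (CommRing Γ(X, W))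

/-- The `k`-algebra structure of the sections over `W`, given by the structure morphism. -/
instance (W : X.Opens) : Algebra k (Sections f W) :=
  RingHom.toAlgebra ((Scheme.ΓSpecIso (CommRingCat.of k)).inv ≫ f.appTop ≫
    X.presheaf.map (homOfLE (le_top : W ≤ ⊤)).op).hom

lemma algebraMap_sections (W : X.Opens) :
    algebraMap k (Sections f W) = ((Scheme.ΓSpecIso (CommRingCat.of k)).inv ≫ f.appTop ≫
      X.presheaf.map (homOfLE (le_top : W ≤ ⊤)).op).hom := rfl

/-- Restriction of sections, as a `k`-linear map. -/
def res {V W : X.Opens} (h : V ≤ W) : Sections f W →ₗ[k] Sections f V :=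
  AlgHom.toLinearMap
    { (X.presheaf.map (homOfLE h).op).hom with
      commutes' := fun c => by
        rw [algebraMap_sections, algebraMap_sections]
        change (((Scheme.ΓSpecIso (CommRingCat.of k)).inv ≫ f.appTop ≫
          X.presheaf.map (homOfLE (le_top : W ≤ ⊤)).op) ≫ X.presheaf.map (homOfLE h).op).hom c = _
        simp only [Category.assoc, ← Functor.map_comp]
        rfl }

variable {ι : Type} (U : ι → X.Opens)

/-- The differential `(s i) ↦ (s j - s i)` from 0-cochains to 1-cochains. -/
def cechD0 : (∀ i, Sections f (U i)) →ₗ[k] (∀ p : ι × ι, Sections f (U p.1 ⊓ U p.2)) :=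
  LinearMap.pi fun p =>
    res f inf_le_right ∘ₗ LinearMap.proj p.2 - res f inf_le_left ∘ₗ LinearMap.proj p.1

/-- The differential `(s i j) ↦ (s j l - s i l + s i j)` from 1-cochains to 2-cochains. -/
def cechD1 : (∀ p : ι × ι, Sections f (U p.1 ⊓ U p.2)) →ₗ[k]
    (∀ q : ι × ι × ι, Sections f (U q.1 ⊓ U q.2.1 ⊓ U q.2.2)) :=
  LinearMap.pi fun q =>
    res f (le_inf (inf_le_left.trans inf_le_right) inf_le_right) ∘ₗ
        LinearMap.proj (q.2.1, q.2.2)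
      - res f (le_inf (inf_le_left.trans inf_le_left) inf_le_right) ∘ₗ
        LinearMap.proj (q.1, q.2.2)
      + res f inf_le_left ∘ₗ LinearMap.proj (q.1, q.2.1)

/-- The first cohomology of the structure sheaf, computed by the Čech complex of the cover `U`. -/
abbrev CechH1 : Type :=
  LinearMap.ker (cechD1 f U) ⧸ (LinearMap.range (cechD0 f U)).submoduleOf
    (LinearMap.ker (cechD1 f U))

end Cech

/-! ### Genus, degree, and general matrices -/

/-- `H¹(S, 𝒪_S)` for the degeneracy locus `S`. -/
abbrev H1 {n : ℕ} (a : Fin n × Fin (n + 1) × Fin 4 → ℂ) : Type :=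
  CechH1 (degeneracyStructureMap a) (standardCover a)

/-- The genus `dim H¹(S, 𝒪_S)`. It is meaningful when `H¹(S, 𝒪_S)` is finite-dimensional. -/
def genus {n : ℕ} (a : Fin n × Fin (n + 1) × Fin 4 → ℂ) : ℕ := Module.finrank ℂ (H1 a)

/-- `P` is the Hilbert polynomial of the degeneracy locus in projective three-space. -/
def IsHilbertPolynomial {n : ℕ} (a : Fin n × Fin (n + 1) × Fin 4 → ℂ) (P : Polynomial ℚ) : Prop :=
  ∀ᶠ t : ℕ in Filter.atTop, (Module.finrank ℂ (degeneracyGrading a t) : ℚ) = P.eval (t : ℚ)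

/-- The degree of the degeneracy locus in projective three-space is `d`: if `P` is the Hilbert
polynomial and `r` is its degree, then `d` is `r!` times the leading coefficient of `P`. -/
def HasDegree {n : ℕ} (a : Fin n × Fin (n + 1) × Fin 4 → ℂ) (d : ℕ) : Prop :=
  ∃ P : Polynomial ℚ, IsHilbertPolynomial a P ∧
    (d : ℚ) = (P.natDegree.factorial : ℚ) * P.leadingCoeff

/-- `Q` holds for a general point of the affine space `ℂ^σ`: it holds on a nonempty Zariski open
subset, equivalently off the zero set of some nonzero polynomial. -/
def HoldsForGeneral {σ : Type} (Q : (σ → ℂ) → Prop) : Prop :=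
  ∃ F : MvPolynomial σ ℂ, F ≠ 0 ∧ ∀ a : σ → ℂ, MvPolynomial.eval a F ≠ 0 → Q a

end DegeneracyCurve

end

/-! A matrix of linear forms is a trilinear form `a` on ℂ^n × ℂ^(n+1) × ℂ^4. Generality enters
through two nonempty open conditions on `a`.

Smoothness needs that `a` has no singular point (`holdsForGeneral_not_isSingularPoint`). In bases
adapted to a singular point, the coefficients whose index meets a fixed triple in at least two
places vanish. Their number exceeds by one the dimension of the product of projective spaces, so
singular forms satisfy a polynomial equation. Without singular points the matrix has corank at most
one at every p ≠ 0 (`not_linearIndependent_of_vecMul_eq_zero`). Near a point of the locus two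
bordered minors cut it out, and a relation between their gradients would produce null vectors u, q
with (u, q, p) singular (`borderedMinor_gradients_independent`). The Jacobian criterion
(`isStandardSmooth_away`) applies on each chart.

The rest needs `(lastCoeffs a).det ≠ 0`: restricted to the line x₀ = x₁ = 0, the n + 1 minors form a
basis of the binary forms of degree n. Then monomials of degree less than n in x₂, x₃ span the
coordinate ring. The rows of the matrix give relations among the minors, which bound the ideal from
above in each large degree, and comparing dimensions shows that these monomials form a basis
(`isCompl_freeExps`). So the coordinate ring is graded free over ℂ[x₀, x₁], with d + 1 generators of
degree d for each d < n. Geometrically, projection from the line is finite and flat, and 𝒪_S pushes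
forward to the sum over d < n of d + 1 copies of 𝒪(-d) on the projective line. The degree is the
rank ∑ (d + 1). Only d = 0 contributes to H⁰, which is ℂ, whence connectedness. The dimension of H¹
is ∑ (d + 1)(d - 1) over 1 ≤ d < n.

The genus is defined by four charts, but the first two already cover the locus, and
`nonempty_cechH1_equiv` reduces the Čech complex to them. -/

noncomputable section
set_option linter.unusedSectionVars false
namespace DegeneracyCurve

/-! ### Singular points of trilinear forms: a dimension count. -/

section Trilinear

variable {I J L : Type} [Fintype I] [Fintype J] [Fintype L]

/-- A point of the product of three projective spaces at which the trilinear form with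
coefficients `a` is singular. -/
structure IsSingularPoint (a : I × J × L → ℂ) (u : I → ℂ) (q : J → ℂ) (v : L → ℂ) : Prop where
  left_ne : u ≠ 0
  mid_ne : q ≠ 0
  right_ne : v ≠ 0
  left_right : ∀ j, ∑ i, ∑ l, a (i, j, l) * u i * v l = 0
  mid_right : ∀ i, ∑ j, ∑ l, a (i, j, l) * q j * v l = 0
  left_mid : ∀ l, ∑ i, ∑ j, a (i, j, l) * u i * q j = 0

/-- Finitely many polynomials in fewer variables satisfy a common polynomial relation. -/
lemma exists_ne_zero_eval_eq_zero {σ τ : Type} [Fintype σ] [Fintype τ]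
    (h : Fintype.card τ < Fintype.card σ) (Φ : σ → MvPolynomial τ ℂ) :
    ∃ F : MvPolynomial σ ℂ, F ≠ 0 ∧
      ∀ c : τ → ℂ, MvPolynomial.eval (fun s => MvPolynomial.eval c (Φ s)) F = 0 := by
  have hdep : ¬ AlgebraicIndependent ℂ Φ := by
    intro hind
    have := hind.cardinalMk_le_trdeg
    rw [MvPolynomial.trdeg_of_isDomain] at this
    simp only [Cardinal.mk_fintype, Cardinal.lift_natCast, Nat.cast_le] at this
    omega
  rw [algebraicIndependent_iff] at hdep
  push Not at hdep
  obtain ⟨F, hF, hF0⟩ := hdep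
  refine ⟨F, hF0, fun c => ?_⟩
  have := congrArg (MvPolynomial.eval c) hF
  rw [map_zero, MvPolynomial.aeval_def, MvPolynomial.algebraMap_eq] at this
  rw [← this, MvPolynomial.eval₂_comp_left]
  have hC : (MvPolynomial.eval c).comp MvPolynomial.C = RingHom.id ℂ := by ext; simp
  rw [hC]
  rfl

variable [DecidableEq I] [DecidableEq J] [DecidableEq L]

/-- The matrix expressing the standard basis in the basis obtained from it by replacing the
`i₀`-th vector with `u`, when `u i₀ = 1`. -/
def shear {R : Type} [CommRing R] (i₀ : I) (u : I → R) : Matrix I I R :=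
  fun i i' => if i = i₀ then (if i' = i₀ then 1 else - u i') else if i' = i then 1 else 0

/-- The basis obtained from the standard one by replacing the `i₀`-th vector with `u`. -/
def replaceVec {R : Type} [CommRing R] (i₀ : I) (u : I → R) : Matrix I I R :=
  fun i' i => if i' = i₀ then u i else if i = i' then 1 else 0

lemma shear_mul_replaceVec {R : Type} [CommRing R] (i₀ : I) (u : I → R) (hu : u i₀ = 1) :
    shear i₀ u * replaceVec i₀ u = 1 := by
  ext i k
  rw [Matrix.mul_apply, ← Finset.add_sum_erase _ _ (Finset.mem_univ i₀)]
  have h : ∀ i' ∈ Finset.univ.erase i₀, shear i₀ u i i' * replaceVec i₀ u i' k =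
      if i' = k then shear i₀ u i i' else 0 := by
    intro i' hi'
    have : i' ≠ i₀ := by simpa using hi'
    simp [replaceVec, this, eq_comm]
  rw [Finset.sum_congr rfl h, Finset.sum_ite_eq']
  by_cases hi : i = i₀
  · subst hi
    by_cases hk : k = i
    · subst hk; simp [shear, replaceVec, hu]
    · simp [shear, replaceVec, hk, Ne.symm hk]
  · by_cases hk : k = i₀
    · subst hk; simp [shear, replaceVec, hi, Ne.symm hi]
    · simp [shear, replaceVec, hi, hk, Ne.symm hi, Matrix.one_apply, eq_comm]

/-- The coefficients of a trilinear form in new bases. -/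
def changeBasis {R : Type} [CommRing R] (S : Matrix I I R) (T : Matrix J J R) (U : Matrix L L R)
    (b : I × J × L → R) : I × J × L → R :=
  fun x => ∑ i, ∑ j, ∑ l, S x.1 i * T x.2.1 j * U x.2.2 l * b (i, j, l)

lemma changeBasis_changeBasis {R : Type} [CommRing R] (S S' : Matrix I I R) (T T' : Matrix J J R)
    (U U' : Matrix L L R) (hS : S * S' = 1) (hT : T * T' = 1) (hU : U * U' = 1)
    (b : I × J × L → R) :
    changeBasis S T U (changeBasis S' T' U' b) = b := by
  have key : changeBasis S T U (changeBasis S' T' U' b) =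
      changeBasis (S * S') (T * T') (U * U') b := by
    ext ⟨i, j, l⟩
    simp only [changeBasis, Matrix.mul_apply, Finset.sum_mul, Finset.mul_sum]
    have h1 : ∀ f : I → J → L → I → J → L → R,
        ∑ i', ∑ j', ∑ l', ∑ i'', ∑ j'', ∑ l'', f i' j' l' i'' j'' l'' =
        ∑ i'', ∑ j'', ∑ l'', ∑ l', ∑ j', ∑ i', f i' j' l' i'' j'' l'' := by
      intro f
      have e : ∀ g : (I × J × L) → (I × J × L) → R, ∑ x, ∑ y, g x y = ∑ y, ∑ x, g x y :=
        fun g => Finset.sum_comm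
      have := e (fun x y => f x.1 x.2.1 x.2.2 y.1 y.2.1 y.2.2)
      simp only [Fintype.sum_prod_type] at this
      rw [this]
      refine Finset.sum_congr rfl fun i'' _ => Finset.sum_congr rfl fun j'' _ =>
        Finset.sum_congr rfl fun l'' _ => ?_
      rw [Finset.sum_comm' (t' := Finset.univ) (s' := fun _ => Finset.univ) (by simp)]
      rw [Finset.sum_congr rfl fun j' _ => Finset.sum_comm]
      rw [Finset.sum_comm]
    rw [h1]
    refine Finset.sum_congr rfl fun i'' _ => Finset.sum_congr rfl fun j'' _ =>
      Finset.sum_congr rfl fun l'' _ => Finset.sum_congr rfl fun l' _ =>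
      Finset.sum_congr rfl fun j' _ => Finset.sum_congr rfl fun i' _ => ?_
    ring
  rw [key, hS, hT, hU]
  ext ⟨i, j, l⟩
  simp only [changeBasis, Matrix.one_apply, ite_mul, one_mul, zero_mul]
  simp

lemma map_changeBasis {R R' : Type} [CommRing R] [CommRing R'] (φ : R →+* R')
    (S : Matrix I I R) (T : Matrix J J R) (U : Matrix L L R) (b : I × J × L → R)
    (x : I × J × L) :
    φ (changeBasis S T U b x) =
      changeBasis (S.map φ) (T.map φ) (U.map φ) (fun y => φ (b y)) x := by
  simp [changeBasis, map_sum]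

lemma map_shear {R R' : Type} [CommRing R] [CommRing R'] (φ : R →+* R') (i₀ : I) (u : I → R) :
    (shear i₀ u).map φ = shear i₀ (fun i => φ (u i)) := by
  ext i i'
  simp only [shear, Matrix.map_apply]
  split_ifs <;> simp

/-- In bases containing `u`, `q`, `v`, the singularity equations say that the coefficients with
`small` index vanish. The form is recovered polynomially from the point and the other coefficients,
which together make one parameter fewer than there are coefficients. -/
lemma exists_eval_eq_zero_of_normalized_singularPoint (i₀ : I) (j₀ : J) (l₀ : L) :
    ∃ F : MvPolynomial (I × J × L) ℂ, F ≠ 0 ∧ ∀ a u q v, IsSingularPoint a u q v →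
      u i₀ = 1 → q j₀ = 1 → v l₀ = 1 → MvPolynomial.eval a F = 0 := by
  let t₀ : I × J × L := (i₀, j₀, l₀)
  -- One index set serves all parameters: the slots (i, j₀, l₀), (i₀, j, l₀), (i₀, j₀, l), freed by
  -- the vanishing of the small coefficients, store the coordinates of `u`, `q`, `v`. The value 0 at
  -- `t₀` is a dummy: `shear` ignores the normalized entry, and `t₀` is small.
  let Y : I × J × L → MvPolynomial {x : I × J × L // x ≠ t₀} ℂ :=
    fun x => if h : x ≠ t₀ then MvPolynomial.X ⟨x, h⟩ else 0
  let small : I × J × L → Prop := fun x =>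
    (x.1 = i₀ ∧ x.2.1 = j₀) ∨ (x.1 = i₀ ∧ x.2.2 = l₀) ∨ (x.2.1 = j₀ ∧ x.2.2 = l₀)
  classical
  let Φ : I × J × L → MvPolynomial {x : I × J × L // x ≠ t₀} ℂ :=
    changeBasis (shear i₀ fun i => Y (i, j₀, l₀)) (shear j₀ fun j => Y (i₀, j, l₀))
      (shear l₀ fun l => Y (i₀, j₀, l)) (fun x => if small x then 0 else Y x)
  have hcard : Fintype.card {x : I × J × L // x ≠ t₀} < Fintype.card (I × J × L) :=
    Fintype.card_subtype_lt (x := t₀) (by simp)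
  obtain ⟨F, hF0, hF⟩ := exists_ne_zero_eval_eq_zero hcard Φ
  refine ⟨F, hF0, fun a u q v h hu hq hv => ?_⟩
  let b := changeBasis (replaceVec i₀ u) (replaceVec j₀ q) (replaceVec l₀ v) a
  let c : {x : I × J × L // x ≠ t₀} → ℂ := fun x =>
    if x.1.2.1 = j₀ ∧ x.1.2.2 = l₀ then u x.1.1
    else if x.1.1 = i₀ ∧ x.1.2.2 = l₀ then q x.1.2.1
    else if x.1.1 = i₀ ∧ x.1.2.1 = j₀ then v x.1.2.2 else b x.1
  have hb : ∀ x, small x → b x = 0 := by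
    have e1 : ∀ (f : I → J → L → ℂ), ∑ i, ∑ j, ∑ l, f i j l = ∑ j, ∑ i, ∑ l, f i j l :=
      fun f => Finset.sum_comm
    have e2 : ∀ (f : I → J → L → ℂ), ∑ i, ∑ j, ∑ l, f i j l = ∑ l, ∑ i, ∑ j, f i j l := by
      intro f
      rw [Finset.sum_congr rfl fun i _ => Finset.sum_comm, Finset.sum_comm]
    rintro ⟨i, j, l⟩ (⟨h1, h2⟩ | ⟨h1, h2⟩ | ⟨h1, h2⟩)
    · simp only at h1 h2
      subst h1 h2
      simp only [b, changeBasis]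
      rw [e2]
      refine Finset.sum_eq_zero fun l' _ => ?_
      have := h.left_mid l'
      rw [← mul_zero (replaceVec l₀ v l l'), ← this, Finset.mul_sum]
      refine Finset.sum_congr rfl fun i' _ => ?_
      rw [Finset.mul_sum]
      refine Finset.sum_congr rfl fun j' _ => ?_
      simp only [replaceVec, if_true]
      ring
    · simp only at h1 h2
      subst h1 h2
      simp only [b, changeBasis]
      rw [e1]
      refine Finset.sum_eq_zero fun j' _ => ?_
      have := h.left_right j'
      rw [← mul_zero (replaceVec j₀ q j j'), ← this, Finset.mul_sum]
      refine Finset.sum_congr rfl fun i' _ => ?_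
      rw [Finset.mul_sum]
      refine Finset.sum_congr rfl fun l' _ => ?_
      simp only [replaceVec, if_true]
      ring
    · simp only at h1 h2
      subst h1 h2
      simp only [b, changeBasis]
      refine Finset.sum_eq_zero fun i' _ => ?_
      have := h.mid_right i'
      rw [← mul_zero (replaceVec i₀ u i i'), ← this, Finset.mul_sum]
      refine Finset.sum_congr rfl fun j' _ => ?_
      rw [Finset.mul_sum]
      refine Finset.sum_congr rfl fun l' _ => ?_
      simp only [replaceVec, if_true]
      ring
  have hY : ∀ x, x ≠ t₀ → MvPolynomial.eval c (Y x) =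
      if x.2.1 = j₀ ∧ x.2.2 = l₀ then u x.1 else if x.1 = i₀ ∧ x.2.2 = l₀ then q x.2.1
      else if x.1 = i₀ ∧ x.2.1 = j₀ then v x.2.2 else b x := by
    intro x hx
    simp only [Y, dif_pos hx, MvPolynomial.eval_X, c]
  have hΦ : ∀ x, MvPolynomial.eval c (Φ x) = a x := by
    intro x
    have key := changeBasis_changeBasis _ _ _ _ _ _ (shear_mul_replaceVec i₀ u hu)
      (shear_mul_replaceVec j₀ q hq) (shear_mul_replaceVec l₀ v hv) a
    conv_rhs => rw [← key]
    rw [map_changeBasis, map_shear, map_shear, map_shear]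
    have shear_congr : ∀ {K : Type} [Fintype K] [DecidableEq K] (k : K) (w w' : K → ℂ),
        (∀ k', k' ≠ k → w k' = w' k') → shear k w = shear k w' := by
      intro K _ _ k w w' hw
      ext k1 k2
      simp only [shear]
      split_ifs with h1 h2 <;> first | rfl | rw [hw _ h2]
    congr 1
    · refine shear_congr _ _ _ fun i hi => ?_
      rw [hY _ (by simp [t₀, hi])]
      simp
    · refine shear_congr _ _ _ fun j hj => ?_
      rw [hY _ (by simp [t₀, hj])]
      simp [hj]
    · refine shear_congr _ _ _ fun l hl => ?_
      rw [hY _ (by simp [t₀, hl])]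
      simp [hl]
    · ext y
      by_cases hy : small y
      · rw [if_pos hy, map_zero]
        exact (hb y hy).symm
      · rw [if_neg hy, hY]
        · simp only [small, not_or] at hy
          rw [if_neg hy.2.2, if_neg hy.2.1, if_neg hy.1]
        · rintro rfl
          exact hy (Or.inl ⟨rfl, rfl⟩)
  have := hF c
  simp only [hΦ] at this
  exact this

lemma exists_smul_apply_eq_one {K : Type} {u : K → ℂ} (hu : u ≠ 0) : ∃ i, ∃ c : ℂ, c ≠ 0 ∧ (c • u) i = 1 := by
  obtain ⟨i, hi⟩ := Function.ne_iff.mp hu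
  exact ⟨i, (u i)⁻¹, inv_ne_zero hi, inv_mul_cancel₀ hi⟩

/-- The general trilinear form has no singular point. -/
lemma holdsForGeneral_not_isSingularPoint :
    HoldsForGeneral fun a : I × J × L → ℂ => ∀ u q v, ¬ IsSingularPoint a u q v := by
  choose F hF0 hF using fun t : I × J × L =>
    exists_eval_eq_zero_of_normalized_singularPoint t.1 t.2.1 t.2.2
  refine ⟨∏ t, F t, Finset.prod_ne_zero_iff.mpr fun t _ => hF0 t, fun a ha u q v h => ha ?_⟩
  obtain ⟨i, c, hc, hi⟩ := exists_smul_apply_eq_one h.left_ne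
  obtain ⟨j, d, hd, hj⟩ := exists_smul_apply_eq_one h.mid_ne
  obtain ⟨l, e, he, hl⟩ := exists_smul_apply_eq_one h.right_ne
  rw [map_prod]
  refine Finset.prod_eq_zero (Finset.mem_univ (i, j, l)) (hF (i, j, l) a (c • u) (d • q) (e • v)
    ⟨smul_ne_zero hc h.left_ne, smul_ne_zero hd h.mid_ne, smul_ne_zero he h.right_ne, ?_, ?_, ?_⟩
    hi hj hl)
  · intro j
    rw [← mul_zero (c * e), ← h.left_right j]
    simp only [Finset.mul_sum, Pi.smul_apply, smul_eq_mul]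
    exact Finset.sum_congr rfl fun _ _ => Finset.sum_congr rfl fun _ _ => by ring
  · intro i
    rw [← mul_zero (d * e), ← h.mid_right i]
    simp only [Finset.mul_sum, Pi.smul_apply, smul_eq_mul]
    exact Finset.sum_congr rfl fun _ _ => Finset.sum_congr rfl fun _ _ => by ring
  · intro l
    rw [← mul_zero (c * d), ← h.left_mid l]
    simp only [Finset.mul_sum, Pi.smul_apply, smul_eq_mul]
    exact Finset.sum_congr rfl fun _ _ => Finset.sum_congr rfl fun _ _ => by ring

end Trilinear


/-! ### Linear algebra: minors, cofactors, null vectors and pencils. -/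

section Matrices

/-- An injective choice of columns misses exactly one, so it permutes a maximal minor; otherwise a
column repeats. Bordered minors need both cases. -/
lemma det_submatrix_mem {R : Type} [CommRing R] {n : ℕ} (M : Matrix (Fin n) (Fin (n + 1)) R)
    (σ : Fin n → Fin (n + 1)) :
    (M.submatrix id σ).det ∈
      Ideal.span (Set.range fun j : Fin (n + 1) => (M.submatrix id j.succAbove).det) := by
  by_cases hσ : Function.Injective σ
  · obtain ⟨j, hj⟩ : ∃ j, ∀ k, σ k ≠ j := by
      by_contra! h
      have := Fintype.card_le_of_surjective σ h
      simp at this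
    choose τ hτ using fun k => Fin.exists_succAbove_eq (hj k)
    have hτi : Function.Injective τ := fun x y hxy => hσ (by rw [← hτ, ← hτ, hxy])
    let e : Equiv.Perm (Fin n) := Equiv.ofBijective τ (Finite.injective_iff_bijective.mp hτi)
    have : M.submatrix id σ = (M.submatrix id j.succAbove).submatrix id e := by
      ext i k
      simp [e, hτ]
    rw [this, Matrix.det_permute']
    exact Ideal.mul_mem_left _ _ (Ideal.subset_span ⟨j, rfl⟩)
  · simp only [Function.Injective, not_forall] at hσ
    obtain ⟨x, y, hxy, hne⟩ := hσ
    rw [Matrix.det_zero_of_column_eq hne (fun i => by simp [hxy])]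
    exact zero_mem _

/-- The signed cofactors of a column adjoined to the columns `c`. -/
def cofactor {R : Type} [CommRing R] {m : ℕ} {κ : Type} (M : Matrix (Fin (m + 1)) κ R)
    (c : Fin m → κ) (i : Fin (m + 1)) : R :=
  (-1) ^ (i : ℕ) * (M.submatrix i.succAbove c).det

lemma sum_cofactor_mul {R : Type} [CommRing R] {m : ℕ} {κ : Type}
    (M : Matrix (Fin (m + 1)) κ R) (c : Fin m → κ) (j : κ) :
    ∑ i, cofactor M c i * M i j =
      (M.submatrix id (Fin.cons j c : Fin (m + 1) → κ)).det := by
  rw [Matrix.det_succ_column_zero]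
  refine Finset.sum_congr rfl fun i _ => ?_
  simp only [cofactor, Matrix.submatrix_apply, Matrix.submatrix_submatrix, id, Fin.cons_zero]
  have : (Fin.cons j c : Fin (m + 1) → κ) ∘ Fin.succ = c := by ext; simp
  rw [this]
  simp only [Function.id_comp]
  ring

lemma sum_cofactor_mul_eq_zero {R : Type} [CommRing R] {m : ℕ} {κ : Type}
    (M : Matrix (Fin (m + 1)) κ R) (c : Fin m → κ) (k : Fin m) :
    ∑ i, cofactor M c i * M i (c k) = 0 := by
  rw [sum_cofactor_mul]
  exact Matrix.det_zero_of_column_eq (Fin.succ_ne_zero k).symm (fun i => by simp)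

/-- Multiply by the adjugate. No domain is assumed, so this also applies modulo an ideal. -/
lemma mul_det_eq_zero_of_vecMul_eq_zero {R : Type} [CommRing R] {n : ℕ}
    (N : Matrix (Fin n) (Fin n) R) (u : Fin n → R) (h : ∀ j, ∑ i, u i * N i j = 0) (i : Fin n) :
    u i * N.det = 0 := by
  have h1 : Matrix.vecMul u N = 0 := by
    ext j
    simpa [Matrix.vecMul, dotProduct] using h j
  have h2 : Matrix.vecMul (Matrix.vecMul u N) N.adjugate = N.det • u := by
    rw [Matrix.vecMul_vecMul, Matrix.mul_adjugate, Matrix.vecMul_smul, Matrix.vecMul_one]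
  rw [h1, Matrix.zero_vecMul] at h2
  have := congrFun h2 i
  simp only [Pi.zero_apply, Pi.smul_apply, smul_eq_mul] at this
  rw [mul_comm, ← this]

variable {k : Type} [Field k]

/-- A proper range lies in the kernel of a nonzero functional, whose coefficients form a left null
vector. -/
lemma mulVec_surjective_of_vecMul {ι κ : Type} [Fintype ι] [Fintype κ] (N : Matrix ι κ k)
    (h : ∀ w, Matrix.vecMul w N = 0 → w = 0) : Function.Surjective N.mulVec := by
  classical
  have : Function.Surjective N.mulVecLin := by
    rw [← LinearMap.range_eq_top]
    by_contra hne
    obtain ⟨f, hf0, hf⟩ := Submodule.exists_le_ker_of_lt_top _ (lt_top_iff_ne_top.mpr hne)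
    apply hf0
    have hw := h (fun i => f (Pi.single i 1)) (by
      ext j
      have : f (N.mulVec (Pi.single j 1)) = 0 := hf ⟨Pi.single j 1, rfl⟩
      rw [Matrix.mulVec_single_one] at this
      rw [LinearMap.pi_apply_eq_sum_univ f] at this
      simp only [Matrix.vecMul, dotProduct, Pi.zero_apply]
      rw [← this]
      refine Finset.sum_congr rfl fun i _ => ?_
      simp only [smul_eq_mul, Matrix.col_apply]
      rw [mul_comm]
      congr 2
      ext x
      simp [Pi.single_apply, eq_comm])
    refine LinearMap.pi_ext' fun i => LinearMap.ext_ring ?_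
    simpa using congrFun hw i
  exact this

/-- A column with nonzero entry in some kernel vector is redundant: subtracting a multiple of that
vector clears the corresponding coordinate of any preimage. -/
lemma exists_mulVec_submatrix_surjective {ι : Type} [Fintype ι] {r : ℕ}
    (N : Matrix ι (Fin (r + 1)) k) (hr : Fintype.card ι ≤ r) (h : Function.Surjective N.mulVec) :
    ∃ j : Fin (r + 1), Function.Surjective (N.submatrix id j.succAbove).mulVec := by
  have hker : LinearMap.ker N.mulVecLin ≠ ⊥ := by
    apply LinearMap.ker_ne_bot_of_finrank_lt
    simp
    omega
  obtain ⟨w, hw, hw0⟩ := Submodule.exists_mem_ne_zero_of_ne_bot hker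
  obtain ⟨j, hj⟩ := Function.ne_iff.mp hw0
  refine ⟨j, fun y => ?_⟩
  obtain ⟨x, rfl⟩ := h y
  have hw' : N.mulVec w = 0 := hw
  let x' := x - (x j / w j) • w
  have hx'j : x' j = 0 := by
    have : w j ≠ 0 := hj
    simp [x', this]
  have hx' : N.mulVec x' = N.mulVec x := by
    simp [x', Matrix.mulVec_sub, Matrix.mulVec_smul, hw']
  refine ⟨fun t => x' (j.succAbove t), ?_⟩
  rw [← hx']
  ext i
  simp only [Matrix.mulVec, dotProduct, Matrix.submatrix_apply, id]
  rw [Fin.sum_univ_succAbove _ j, hx'j, mul_zero, zero_add]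

lemma det_ne_zero_of_mulVec_surjective {r : ℕ} (N : Matrix (Fin r) (Fin r) k)
    (h : Function.Surjective N.mulVec) : N.det ≠ 0 := by
  have := Matrix.mulVec_surjective_iff_isUnit.mp h
  exact ((Matrix.isUnit_iff_isUnit_det _).mp this).ne_zero

lemma exists_det_submatrix_ne_zero {r : ℕ} (N : Matrix (Fin r) (Fin (r + 1)) k)
    (h : ∀ w, Matrix.vecMul w N = 0 → w = 0) :
    ∃ j : Fin (r + 1), (N.submatrix id j.succAbove).det ≠ 0 := by
  obtain ⟨j, hj⟩ := exists_mulVec_submatrix_surjective N (by simp) (mulVec_surjective_of_vecMul N h)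
  exact ⟨j, det_ne_zero_of_mulVec_surjective _ hj⟩

lemma exists_det_submatrix_submatrix_ne_zero {r : ℕ} (N : Matrix (Fin r) (Fin (r + 2)) k)
    (h : ∀ w, Matrix.vecMul w N = 0 → w = 0) :
    ∃ (j : Fin (r + 2)) (j' : Fin (r + 1)),
      (N.submatrix id (j.succAbove ∘ j'.succAbove)).det ≠ 0 := by
  obtain ⟨j, hj⟩ := exists_mulVec_submatrix_surjective N (by simp) (mulVec_surjective_of_vecMul N h)
  obtain ⟨j', hj'⟩ := exists_mulVec_submatrix_surjective _ (by simp) hj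
  exact ⟨j, j', det_ne_zero_of_mulVec_surjective _ hj'⟩

/-- A pencil of linear maps into a space of dimension at most that of the source has a singular
member. -/
lemma exists_pencil_singular [IsAlgClosed k] {V W : Type} [AddCommGroup V] [Module k V]
    [AddCommGroup W] [Module k W] [FiniteDimensional k V] [FiniteDimensional k W] [Nontrivial W]
    (h : Module.finrank k W ≤ Module.finrank k V) (A B : V →ₗ[k] W) :
    ∃ s t : k, (s ≠ 0 ∨ t ≠ 0) ∧ ∃ q : V, q ≠ 0 ∧ s • A q + t • B q = 0 := by
  -- If `B` is invertible, an eigenvector of `B⁻¹ A` with eigenvalue `μ` is killed by `A - μ B`;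
  -- otherwise `B` itself is singular.
  by_cases hB : Function.Injective B
  · have he := le_antisymm h (LinearMap.finrank_le_finrank_of_injective hB)
    let e := LinearEquiv.ofInjectiveOfFinrankEq B hB he.symm
    have : Nontrivial V := e.toEquiv.nontrivial
    obtain ⟨μ, hμ⟩ := Module.End.exists_eigenvalue (e.symm.toLinearMap ∘ₗ A)
    obtain ⟨q, hq⟩ := hμ.exists_hasEigenvector
    refine ⟨1, -μ, Or.inl one_ne_zero, q, hq.2, ?_⟩
    have h1 : e.symm (A q) = μ • q := hq.apply_eq_smul
    have h2 : A q = μ • B q := by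
      have := congrArg e h1
      rw [LinearEquiv.apply_symm_apply, map_smul] at this
      exact this
    rw [h2]
    simp
  · have : LinearMap.ker B ≠ ⊥ := fun h => hB (LinearMap.ker_eq_bot.mp h)
    obtain ⟨q, hq, hq0⟩ := Submodule.exists_mem_ne_zero_of_ne_bot this
    refine ⟨0, 1, Or.inr one_ne_zero, q, hq0, ?_⟩
    have : B q = 0 := hq
    simp [this]

end Matrices

/-! ### The rank of the matrix at a point. -/

section Points

variable {m : ℕ}

/-- The value of the matrix of linear forms at a point. -/
def valueMatrix {n : ℕ} (a : Fin n × Fin (n + 1) × Fin 4 → ℂ) (p : Fin 4 → ℂ) :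
    Matrix (Fin n) (Fin (n + 1)) ℂ :=
  Matrix.of fun i j => ∑ l, a (i, j, l) * p l

lemma eval_formMatrix {n : ℕ} (a : Fin n × Fin (n + 1) × Fin 4 → ℂ) (p : Fin 4 → ℂ)
    (i : Fin n) (j : Fin (n + 1)) :
    MvPolynomial.eval p (formMatrix a i j) = valueMatrix a p i j := by
  simp [formMatrix, valueMatrix, map_sum]

lemma map_formMatrix {n : ℕ} (a : Fin n × Fin (n + 1) × Fin 4 → ℂ) (p : Fin 4 → ℂ) :
    (formMatrix a).map (MvPolynomial.eval p) = valueMatrix a p := by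
  ext i j
  exact eval_formMatrix a p i j

/-- One of the equations `left_mid` is redundant: contracted with `p` they give uᵀ N(p) q, which is
already zero, so the equation at `l` follows from the others because `p l ≠ 0`. -/
lemma isSingularPoint_of_exists_ne {n : ℕ} {a : Fin n × Fin (n + 1) × Fin 4 → ℂ} {p : Fin 4 → ℂ}
    {l : Fin 4} (hl : p l ≠ 0) {u : Fin n → ℂ} {q : Fin (n + 1) → ℂ} (hu0 : u ≠ 0) (hq0 : q ≠ 0)
    (hu : Matrix.vecMul u (valueMatrix a p) = 0) (hq : Matrix.mulVec (valueMatrix a p) q = 0)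
    (h : ∀ t, t ≠ l → ∑ i, ∑ j, a (i, j, t) * u i * q j = 0) : IsSingularPoint a u q p := by
  have h1 : ∀ j, ∑ i, ∑ l, a (i, j, l) * u i * p l = 0 := by
    intro j
    refine Eq.trans ?_ (congrFun hu j)
    simp only [Matrix.vecMul, dotProduct, valueMatrix, Matrix.of_apply, Finset.mul_sum]
    exact Finset.sum_congr rfl fun _ _ => Finset.sum_congr rfl fun _ _ => by ring
  have h2 : ∀ i, ∑ j, ∑ l, a (i, j, l) * q j * p l = 0 := by
    intro i
    refine Eq.trans ?_ (congrFun hq i)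
    simp only [Matrix.mulVec, dotProduct, valueMatrix, Matrix.of_apply, Finset.sum_mul]
    exact Finset.sum_congr rfl fun _ _ => Finset.sum_congr rfl fun _ _ => by ring
  refine ⟨hu0, hq0, fun h => hl (by simp [h]), h1, h2, fun t => ?_⟩
  by_cases ht : t = l
  · subst ht
    have h3 : ∑ s, p s * ∑ i, ∑ j, a (i, j, s) * u i * q j = 0 := by
      have : ∑ s, p s * ∑ i, ∑ j, a (i, j, s) * u i * q j =
          ∑ i, u i * ∑ j, ∑ s, a (i, j, s) * q j * p s := by
        simp only [Finset.mul_sum]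
        rw [Finset.sum_comm]
        refine Finset.sum_congr rfl fun i _ => ?_
        rw [Finset.sum_comm]
        exact Finset.sum_congr rfl fun _ _ => Finset.sum_congr rfl fun _ _ => by ring
      rw [this]
      simp [h2]
    rw [Finset.sum_eq_single t (fun s _ hs => by rw [h s hs, mul_zero]) (by simp)] at h3
    exact (mul_eq_zero.mp h3).resolve_left hl
  · exact h t ht

/-- Two independent left null vectors force a right kernel of dimension at least 3, the matrix
having one more column than rows. Only three equations `left_mid` remain to be solved, so the pencil
of left null vectors gives a pencil of maps from the kernel to ℂ³; a singular member yields a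
singular point. -/
lemma not_linearIndependent_of_vecMul_eq_zero {a : Fin (m + 1) × Fin (m + 2) × Fin 4 → ℂ}
    (ha : ∀ u q v, ¬ IsSingularPoint a u q v) {p : Fin 4 → ℂ} (hp : p ≠ 0)
    (u : Fin 2 → Fin (m + 1) → ℂ) (hu : ∀ s, Matrix.vecMul (u s) (valueMatrix a p) = 0) :
    ¬ LinearIndependent ℂ u := by
  intro hind
  obtain ⟨l, hl⟩ := Function.ne_iff.mp hp
  let N := valueMatrix a p
  have hK : 3 ≤ Module.finrank ℂ (LinearMap.ker N.mulVecLin) := by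
    have h1 := LinearMap.finrank_range_add_finrank_ker N.mulVecLin
    have h2 := LinearMap.finrank_range_add_finrank_ker N.transpose.mulVecLin
    have h3 : Module.finrank ℂ (LinearMap.range N.transpose.mulVecLin) =
        Module.finrank ℂ (LinearMap.range N.mulVecLin) := Matrix.rank_transpose N
    have h4 : 2 ≤ Module.finrank ℂ (LinearMap.ker N.transpose.mulVecLin) := by
      let w : Fin 2 → LinearMap.ker N.transpose.mulVecLin := fun s => ⟨u s, by
        rw [LinearMap.mem_ker, Matrix.mulVecLin_apply, Matrix.mulVec_transpose]
        exact hu s⟩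
      have hw : LinearIndependent ℂ w :=
        LinearIndependent.of_comp (LinearMap.ker N.transpose.mulVecLin).subtype hind
      simpa using hw.fintype_card_le_finrank
    simp only [Module.finrank_fintype_fun_eq_card, Fintype.card_fin] at h1 h2
    omega
  let A : Fin 2 → LinearMap.ker N.mulVecLin →ₗ[ℂ] (Fin 3 → ℂ) := fun s =>
    (LinearMap.pi fun t : Fin 3 => ∑ j, (∑ i, a (i, j, l.succAbove t) * u s i) •
      LinearMap.proj j) ∘ₗ (LinearMap.ker N.mulVecLin).subtype
  obtain ⟨s, t, hst, q, hq0, hq⟩ := exists_pencil_singular (by simpa using hK) (A 0) (A 1)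
  refine ha (s • u 0 + t • u 1) q p (isSingularPoint_of_exists_ne hl ?_ (by simpa using hq0) ?_ ?_ ?_)
  · intro h0
    have := (LinearIndependent.pair_iff (R := ℂ) (x := u 0) (y := u 1)).mp (by
      have hu2 : u = ![u 0, u 1] := by ext i; fin_cases i <;> rfl
      rw [← hu2]
      exact hind) s t h0
    tauto
  · rw [Matrix.add_vecMul, Matrix.smul_vecMul, Matrix.smul_vecMul, hu, hu]
    simp
  · exact q.2
  · intro t' ht'
    obtain ⟨r, rfl⟩ := Fin.exists_succAbove_eq ht'
    have := congrFun hq r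
    simp only [A, LinearMap.comp_apply, LinearMap.pi_apply, Pi.add_apply, Pi.smul_apply,
      LinearMap.sum_apply, LinearMap.smul_apply, LinearMap.proj_apply, Submodule.subtype_apply,
      smul_eq_mul, Pi.zero_apply] at this
    rw [Finset.sum_comm, ← this, Finset.mul_sum, Finset.mul_sum, ← Finset.sum_add_distrib]
    refine Finset.sum_congr rfl fun j _ => ?_
    simp only [Pi.add_apply, Pi.smul_apply, smul_eq_mul, Finset.sum_mul, Finset.mul_sum,
      ← Finset.sum_add_distrib]
    exact Finset.sum_congr rfl fun _ _ => by ring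

/-- The corank is exactly one. Deleting a row where the left null vector `u` is nonzero leaves
independent rows, because a relation among them would extend by zero to a null vector independent of
`u`. -/
lemma exists_det_valueMatrix_ne_zero {a : Fin (m + 1) × Fin (m + 2) × Fin 4 → ℂ}
    (ha : ∀ u q v, ¬ IsSingularPoint a u q v) {p : Fin 4 → ℂ} (hp : p ≠ 0)
    (hminor : ∀ j : Fin (m + 2), ((valueMatrix a p).submatrix id j.succAbove).det = 0) :
    ∃ (i : Fin (m + 1)) (j : Fin (m + 2)) (j' : Fin (m + 1)),
      ((valueMatrix a p).submatrix i.succAbove (j.succAbove ∘ j'.succAbove)).det ≠ 0 := by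
  obtain ⟨u, hu, hu0⟩ : ∃ u, Matrix.vecMul u (valueMatrix a p) = 0 ∧ u ≠ 0 := by
    by_contra! h
    obtain ⟨j, hj⟩ := exists_det_submatrix_ne_zero _ h
    exact hj (hminor j)
  obtain ⟨i, hi⟩ := Function.ne_iff.mp hu0
  refine ⟨i, ?_⟩
  refine exists_det_submatrix_submatrix_ne_zero ((valueMatrix a p).submatrix i.succAbove id) ?_
  intro w hw
  by_contra hw0
  let w' : Fin (m + 1) → ℂ := i.insertNth 0 w
  refine not_linearIndependent_of_vecMul_eq_zero ha hp ![u, w'] ?_ ?_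
  · intro s
    fin_cases s
    · exact hu
    · ext j
      have := congrFun hw j
      simp only [Matrix.vecMul, dotProduct, Matrix.submatrix_apply, id] at this
      change ∑ x, w' x * valueMatrix a p x j = 0
      rw [Fin.sum_univ_succAbove _ i]
      simpa [w'] using this
  · rw [LinearIndependent.pair_iff]
    intro s t hst
    have h1 := congrFun hst i
    simp only [w', Pi.add_apply, Pi.smul_apply, Fin.insertNth_apply_same, smul_eq_mul, mul_zero,
      add_zero, Pi.zero_apply] at h1
    have hs : s = 0 := (mul_eq_zero.mp h1).resolve_right hi
    subst hs
    refine ⟨rfl, ?_⟩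
    obtain ⟨r, hr⟩ := Function.ne_iff.mp hw0
    have h2 := congrFun hst (i.succAbove r)
    simp only [w', Pi.add_apply, Pi.smul_apply, Fin.insertNth_apply_succAbove, smul_eq_mul,
      zero_mul, zero_add, Pi.zero_apply] at h2
    exact (mul_eq_zero.mp h2).resolve_right hr

end Points


/-! ### Bordered minors and the independence of their gradients. -/

section Jacobian

variable {m : ℕ}

/-- The minor on the column `j` together with the columns different from `j₀` and
`j₀.succAbove j₁`. -/
def borderedMinor (a : Fin (m + 1) × Fin (m + 2) × Fin 4 → ℂ) (j₀ : Fin (m + 2))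
    (j₁ : Fin (m + 1)) (j : Fin (m + 2)) : CoordRing :=
  ∑ i, cofactor (formMatrix a) (j₀.succAbove ∘ j₁.succAbove) i * formMatrix a i j

lemma borderedMinor_mem (a : Fin (m + 1) × Fin (m + 2) × Fin 4 → ℂ) (j₀ : Fin (m + 2))
    (j₁ : Fin (m + 1)) (j : Fin (m + 2)) : borderedMinor a j₀ j₁ j ∈ minorIdeal a := by
  rw [borderedMinor, sum_cofactor_mul]
  exact det_submatrix_mem _ _

lemma borderedMinor_eq_zero (a : Fin (m + 1) × Fin (m + 2) × Fin 4 → ℂ) (j₀ : Fin (m + 2))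
    (j₁ : Fin (m + 1)) (t : Fin m) :
    borderedMinor a j₀ j₁ (j₀.succAbove (j₁.succAbove t)) = 0 :=
  sum_cofactor_mul_eq_zero _ (j₀.succAbove ∘ j₁.succAbove) t

/-- The minor on the rows different from `i₀` and the columns different from `j₀` and
`j₀.succAbove j₁`. -/
def innerMinor (a : Fin (m + 1) × Fin (m + 2) × Fin 4 → ℂ) (i₀ : Fin (m + 1)) (j₀ : Fin (m + 2))
    (j₁ : Fin (m + 1)) : CoordRing :=
  cofactor (formMatrix a) (j₀.succAbove ∘ j₁.succAbove) i₀

lemma eval_cofactor (a : Fin (m + 1) × Fin (m + 2) × Fin 4 → ℂ) (p : Fin 4 → ℂ)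
    (c : Fin m → Fin (m + 2)) (i : Fin (m + 1)) :
    MvPolynomial.eval p (cofactor (formMatrix a) c i) = cofactor (valueMatrix a p) c i := by
  simp only [cofactor, map_mul, map_pow, map_neg, map_one, RingHom.map_det,
    RingHom.mapMatrix_apply]
  rw [← Matrix.submatrix_map, map_formMatrix]

/-- A left null vector of the matrix modulo a ring homomorphism, with invertible entry, kills all
minors. -/
lemma map_innerMinor_mul_eq_zero {S : Type} [CommRing S]
    (a : Fin (m + 1) × Fin (m + 2) × Fin 4 → ℂ)
    (i₀ : Fin (m + 1)) (j₀ : Fin (m + 2)) (j₁ : Fin (m + 1)) (φ : CoordRing →+* S)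
    (h0 : φ (borderedMinor a j₀ j₁ j₀) = 0)
    (h1 : φ (borderedMinor a j₀ j₁ (j₀.succAbove j₁)) = 0) (x : CoordRing)
    (hx : x ∈ minorIdeal a) : φ (innerMinor a i₀ j₀ j₁ * x) = 0 := by
  have hall : ∀ j, φ (borderedMinor a j₀ j₁ j) = 0 := by
    intro j
    by_cases hj : j = j₀
    · rw [hj, h0]
    · obtain ⟨k, rfl⟩ := Fin.exists_succAbove_eq hj
      by_cases hk : k = j₁
      · rw [hk, h1]
      · obtain ⟨t, rfl⟩ := Fin.exists_succAbove_eq hk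
        rw [borderedMinor_eq_zero, map_zero]
  have hle : minorIdeal a ≤
      Submodule.comap (LinearMap.mulLeft CoordRing (innerMinor a i₀ j₀ j₁)) (RingHom.ker φ) := by
    rw [minorIdeal, Ideal.span, Submodule.span_le]
    rintro _ ⟨j, rfl⟩
    change φ (innerMinor a i₀ j₀ j₁ * maximalMinor a j) = 0
    rw [map_mul, maximalMinor, RingHom.map_det]
    refine mul_det_eq_zero_of_vecMul_eq_zero _
      (fun i => φ (cofactor (formMatrix a) (j₀.succAbove ∘ j₁.succAbove) i)) (fun t => ?_) i₀
    have := hall (j.succAbove t)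
    simpa [borderedMinor, map_sum] using this
  exact hle hx

lemma pderiv_formMatrix (a : Fin (m + 1) × Fin (m + 2) × Fin 4 → ℂ) (i : Fin (m + 1))
    (j : Fin (m + 2)) (t : Fin 4) :
    MvPolynomial.pderiv t (formMatrix a i j) = MvPolynomial.C (a (i, j, t)) := by
  simp [formMatrix, map_sum, MvPolynomial.pderiv_X, Pi.single_apply]

/-- In the product rule, the terms that differentiate a cofactor carry a factor `∑ j, N i j * q j =
0`. What remains is the trilinear form at the cofactor vector and `q`, which links gradients to
singular points. -/
lemma sum_mul_eval_pderiv_borderedMinor (a : Fin (m + 1) × Fin (m + 2) × Fin 4 → ℂ)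
    (j₀ : Fin (m + 2)) (j₁ : Fin (m + 1)) {p : Fin 4 → ℂ} {q : Fin (m + 2) → ℂ}
    (hq : Matrix.mulVec (valueMatrix a p) q = 0) (t : Fin 4) :
    ∑ j, q j * MvPolynomial.eval p (MvPolynomial.pderiv t (borderedMinor a j₀ j₁ j)) =
      ∑ i, ∑ j, a (i, j, t) *
        cofactor (valueMatrix a p) (j₀.succAbove ∘ j₁.succAbove) i * q j := by
  have h : ∀ i, ∑ j, valueMatrix a p i j * q j = 0 := fun i => congrFun hq i
  simp only [borderedMinor, map_sum, Derivation.leibniz, smul_eq_mul, map_add, map_mul,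
    pderiv_formMatrix, eval_formMatrix, MvPolynomial.eval_C, eval_cofactor]
  simp only [Finset.mul_sum]
  rw [Finset.sum_comm]
  refine Finset.sum_congr rfl fun i _ => ?_
  simp only [mul_add, Finset.sum_add_distrib]
  have h2 : ∑ j, q j * (valueMatrix a p i j * MvPolynomial.eval p (MvPolynomial.pderiv t
      (cofactor (formMatrix a) (j₀.succAbove ∘ j₁.succAbove) i))) = 0 := by
    rw [← zero_mul (MvPolynomial.eval p (MvPolynomial.pderiv t
      (cofactor (formMatrix a) (j₀.succAbove ∘ j₁.succAbove) i))), ← h i, Finset.sum_mul]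
    exact Finset.sum_congr rfl fun _ _ => by ring
  rw [h2, add_zero]
  exact Finset.sum_congr rfl fun _ _ => by ring

/-- Inverting the inner minor solves the rows other than `i₀`; row `i₀` then follows because `u i₀ ≠
0`. This realizes the coefficients of a relation between two gradients as entries of a right null
vector. -/
lemma exists_mulVec_eq_zero {N : Matrix (Fin (m + 1)) (Fin (m + 2)) ℂ} (i₀ : Fin (m + 1))
    (j₀ : Fin (m + 2)) (j₁ : Fin (m + 1)) (u : Fin (m + 1) → ℂ) (hu : Matrix.vecMul u N = 0)
    (hi : u i₀ ≠ 0) (hdet : (N.submatrix i₀.succAbove (j₀.succAbove ∘ j₁.succAbove)).det ≠ 0)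
    (c₀ c₁ : ℂ) : ∃ q, Matrix.mulVec N q = 0 ∧ q j₀ = c₀ ∧ q (j₀.succAbove j₁) = c₁ := by
  let N' := N.submatrix i₀.succAbove (j₀.succAbove ∘ j₁.succAbove)
  let y : Fin m → ℂ := fun i =>
    - (N (i₀.succAbove i) j₀ * c₀ + N (i₀.succAbove i) (j₀.succAbove j₁) * c₁)
  let x : Fin m → ℂ := Matrix.mulVec N'⁻¹ y
  have hx : Matrix.mulVec N' x = y := by
    rw [Matrix.mulVec_mulVec, Matrix.mul_nonsing_inv _ (isUnit_iff_ne_zero.mpr hdet),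
      Matrix.one_mulVec]
  let q : Fin (m + 2) → ℂ := j₀.insertNth c₀ (j₁.insertNth c₁ x)
  have hq : ∀ i, Matrix.mulVec N q (i₀.succAbove i) = 0 := by
    intro i
    have := congrFun hx i
    simp only [Matrix.mulVec, dotProduct, N', Matrix.submatrix_apply, Function.comp_apply, y]
      at this
    simp only [Matrix.mulVec, dotProduct]
    rw [Fin.sum_univ_succAbove _ j₀, Fin.sum_univ_succAbove _ j₁]
    simp only [q, Fin.insertNth_apply_same, Fin.insertNth_apply_succAbove]
    rw [this]
    ring
  refine ⟨q, ?_, by simp [q], by simp [q]⟩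
  have h0 : Matrix.mulVec N q i₀ = 0 := by
    have h1 : dotProduct u (Matrix.mulVec N q) = 0 := by
      rw [Matrix.dotProduct_mulVec, hu, zero_dotProduct]
    rw [dotProduct, Fin.sum_univ_succAbove _ i₀] at h1
    simp only [hq, mul_zero, Finset.sum_const_zero, add_zero] at h1
    exact (mul_eq_zero.mp h1).resolve_left hi
  ext i
  by_cases h : i = i₀
  · rw [h, h0]; rfl
  · obtain ⟨k, rfl⟩ := Fin.exists_succAbove_eq h
    exact hq k

/-- The coefficient `c` belongs to the gradient of `X l - 1`. Take `q` in the kernel with entries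
`c₀`, `c₁` in the two distinguished columns. All other bordered minors vanish identically, so the
relation says that the form at `u` and `q` vanishes off the coordinate `l`, and (u, q, p) would be
singular unless `c₀ = c₁ = 0`. -/
lemma borderedMinor_gradients_independent {a : Fin (m + 1) × Fin (m + 2) × Fin 4 → ℂ}
    (ha : ∀ u q v, ¬ IsSingularPoint a u q v) {p : Fin 4 → ℂ} {l : Fin 4} (hl : p l = 1)
    (i₀ : Fin (m + 1)) (j₀ : Fin (m + 2)) (j₁ : Fin (m + 1))
    (hδ : MvPolynomial.eval p (innerMinor a i₀ j₀ j₁) ≠ 0)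
    (hp : ∀ x ∈ minorIdeal a, MvPolynomial.eval p x = 0) (c c₀ c₁ : ℂ)
    (h : ∀ t, c * (if t = l then 1 else 0) +
      c₀ * MvPolynomial.eval p (MvPolynomial.pderiv t (borderedMinor a j₀ j₁ j₀)) +
      c₁ * MvPolynomial.eval p
        (MvPolynomial.pderiv t (borderedMinor a j₀ j₁ (j₀.succAbove j₁))) = 0) :
    c = 0 ∧ c₀ = 0 ∧ c₁ = 0 := by
  let N := valueMatrix a p
  let u := cofactor N (j₀.succAbove ∘ j₁.succAbove)
  rw [innerMinor, eval_cofactor] at hδ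
  have hu : Matrix.vecMul u N = 0 := by
    ext j
    have := hp _ (borderedMinor_mem a j₀ j₁ j)
    simp only [borderedMinor, map_sum, map_mul, eval_formMatrix, eval_cofactor] at this
    exact this
  have hdet : (N.submatrix i₀.succAbove (j₀.succAbove ∘ j₁.succAbove)).det ≠ 0 :=
    fun h0 => hδ (by rw [cofactor, h0, mul_zero])
  obtain ⟨q, hq, hq0, hq1⟩ := exists_mulVec_eq_zero i₀ j₀ j₁ u hu hδ hdet c₀ c₁
  have hsum : ∀ t, c * (if t = l then 1 else 0) + ∑ i, ∑ j, a (i, j, t) * u i * q j = 0 := by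
    intro t
    rw [← sum_mul_eval_pderiv_borderedMinor a j₀ j₁ hq t, Fin.sum_univ_succAbove _ j₀,
      Fin.sum_univ_succAbove _ j₁, hq0, hq1]
    simp only [borderedMinor_eq_zero, map_zero, mul_zero, Finset.sum_const_zero, add_zero]
    rw [← add_assoc]
    exact h t
  have hu0 : u ≠ 0 := fun h0 => hδ (congrFun h0 i₀)
  have hc' : c₀ = 0 ∧ c₁ = 0 := by
    by_contra hc
    have hq' : q ≠ 0 := by
      rintro rfl
      exact hc ⟨hq0.symm, hq1.symm⟩
    refine ha u q p (isSingularPoint_of_exists_ne (l := l) (by simp [hl]) hu0 hq' hu hq ?_)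
    intro t ht
    simpa [ht] using hsum t
  obtain ⟨rfl, rfl⟩ := hc'
  exact ⟨by simpa using h l, rfl, rfl⟩

end Jacobian

/-! ### A Jacobian criterion for standard smoothness. -/

section StandardSmooth

/-- If the ideal `K` is generated by the three polynomials `v` after inverting `g`, and `g` is a
multiple of a maximal minor of the Jacobian matrix of `v`, then the locus `g ≠ 0` of the zero locus
of `K` is standard smooth of relative dimension one. -/
lemma isStandardSmooth_away {k : Type} [Field k] (K : Ideal (MvPolynomial (Fin 4) k))
    (v : Fin 3 → MvPolynomial (Fin 4) k) (hv : ∀ t, v t ∈ K) (g : MvPolynomial (Fin 4) k)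
    (hg : ∀ x ∈ K, g * x ∈ Ideal.span (Set.range v)) (s : Fin 4)
    (hs : (Matrix.of fun t r : Fin 3 => MvPolynomial.pderiv (s.succAbove t) (v r)).det ∣ g) :
    Algebra.IsStandardSmoothOfRelativeDimension 1 k
      (Localization.Away (Ideal.Quotient.mk K g)) := by
  let Q := MvPolynomial (Fin 4) k ⧸ Ideal.span (Set.range v)
  let T := Localization.Away (Ideal.Quotient.mk K g)
  have hle : Ideal.span (Set.range v) ≤ K := by
    rw [Ideal.span_le]
    rintro _ ⟨t, rfl⟩
    exact hv t
  let : Algebra Q T :=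
    ((algebraMap (MvPolynomial (Fin 4) k ⧸ K) T).comp (Ideal.Quotient.factor hle)).toAlgebra
  have hQT : ∀ x : MvPolynomial (Fin 4) k, algebraMap Q T (Ideal.Quotient.mk _ x) =
      algebraMap (MvPolynomial (Fin 4) k ⧸ K) T (Ideal.Quotient.mk K x) := fun x => rfl
  have : IsScalarTower k Q T := IsScalarTower.of_algebraMap_eq fun c => by
    change algebraMap k T c = algebraMap Q T (Ideal.Quotient.mk _ (MvPolynomial.C c))
    rw [hQT]
    exact IsScalarTower.algebraMap_apply k (MvPolynomial (Fin 4) k ⧸ K) T c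
  let gQ : Q := Ideal.Quotient.mk _ g
  -- Since `g * K` lies in the ideal of `v`, the ideals `K` and `span v` agree after inverting `g`,
  -- so `T` is also a localization of `Q`.
  have : IsLocalization.Away gQ T := by
    refine ⟨?_, ?_, ?_⟩
    · rintro ⟨_, r, rfl⟩
      rw [map_pow]
      exact (IsLocalization.map_units T (⟨Ideal.Quotient.mk K g, 1, by simp⟩ :
        Submonoid.powers (Ideal.Quotient.mk K g))).pow r
    · intro z
      obtain ⟨⟨x, ⟨_, r, rfl⟩⟩, h⟩ := IsLocalization.surj (Submonoid.powers (Ideal.Quotient.mk K g)) z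
      obtain ⟨x, rfl⟩ := Ideal.Quotient.mk_surjective x
      exact ⟨⟨Ideal.Quotient.mk _ x, ⟨gQ ^ r, r, rfl⟩⟩, h⟩
    · intro x y hxy
      obtain ⟨x, rfl⟩ := Ideal.Quotient.mk_surjective x
      obtain ⟨y, rfl⟩ := Ideal.Quotient.mk_surjective y
      rw [hQT, hQT] at hxy
      obtain ⟨⟨_, r, rfl⟩, h⟩ :=
        IsLocalization.exists_of_eq (M := Submonoid.powers (Ideal.Quotient.mk K g)) hxy
      refine ⟨⟨gQ ^ (r + 1), r + 1, rfl⟩, ?_⟩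
      simp only [← map_pow, ← map_mul, gQ] at h ⊢
      rw [Ideal.Quotient.eq, ← mul_sub] at h
      rw [Ideal.Quotient.eq, ← mul_sub, pow_succ', mul_assoc]
      exact hg _ h
  let P₁ : Algebra.PreSubmersivePresentation k Q (Fin 4) (Fin 3) :=
    Algebra.PreSubmersivePresentation.naive s.succAbove Fin.succAbove_right_injective
  let P₂ : Algebra.PreSubmersivePresentation Q T Unit Unit :=
    Algebra.PreSubmersivePresentation.localizationAway T gQ
  -- The composite presentation has 5 generators and 4 relations, counting the inverse of `g`, hence
  -- dimension one. Its Jacobian is the product of the chosen minor, which divides `g`, and of the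
  -- localization Jacobian `g`.
  let P : Algebra.SubmersivePresentation k T (Unit ⊕ Fin 4) (Unit ⊕ Fin 3) :=
    { P₂.comp P₁ with
      jacobian_isUnit := by
        have hunit : IsUnit (algebraMap Q T gQ) :=
          IsLocalization.map_units T (⟨gQ, 1, by simp⟩ : Submonoid.powers gQ)
        change IsUnit (P₂.comp P₁).jacobian
        rw [Algebra.PreSubmersivePresentation.comp_jacobian_eq_jacobian_smul_jacobian,
          Algebra.smul_def, IsUnit.mul_iff]
        refine ⟨?_, ?_⟩
        · have h1 : P₁.jacobian = Ideal.Quotient.mk _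
              (Matrix.of fun t r : Fin 3 => MvPolynomial.pderiv (s.succAbove t) (v r)).det := by
            rw [Algebra.PreSubmersivePresentation.jacobian_eq_jacobiMatrix_det]
            have h2 : P₁.jacobiMatrix =
                Matrix.of fun t r : Fin 3 => MvPolynomial.pderiv (s.succAbove t) (v r) := by
              refine Matrix.ext fun t r => ?_
              exact P₁.jacobiMatrix_apply t r
            rw [h2]
            have h3 : ∀ x, algebraMap P₁.Ring Q x = Ideal.Quotient.mk _ x := by
              intro x
              rw [Algebra.Generators.algebraMap_apply]
              have : (MvPolynomial.aeval P₁.val : MvPolynomial (Fin 4) k →ₐ[k] Q) =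
                  Ideal.Quotient.mkₐ k _ := by
                ext t
                simp [P₁]
                rfl
              exact DFunLike.congr_fun this x
            exact h3 _
          rw [h1]
          refine isUnit_of_dvd_unit (map_dvd _ (map_dvd _ hs)) hunit
        · rw [Algebra.PreSubmersivePresentation.localizationAway_jacobian]
          exact hunit }
  refine P.isStandardSmoothOfRelativeDimension ?_
  simp [Algebra.Presentation.dimension]

end StandardSmooth

/-! ### Smoothness of the affine charts, embedded in affine four-space by `X l = 1`. -/

section Chart

variable {m : ℕ}

/-- The ideal of the affine chart of the degeneracy locus on which the `l`-th coordinate is one. -/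
def chartIdeal {n : ℕ} (a : Fin n × Fin (n + 1) × Fin 4 → ℂ) (l : Fin 4) : Ideal CoordRing :=
  minorIdeal a ⊔ Ideal.span {MvPolynomial.X l - 1}

/-- Local equations of the affine chart. -/
def chartEquation (a : Fin (m + 1) × Fin (m + 2) × Fin 4 → ℂ) (l : Fin 4) (j₀ : Fin (m + 2))
    (j₁ : Fin (m + 1)) : Fin 3 → CoordRing :=
  ![MvPolynomial.X l - 1, borderedMinor a j₀ j₁ j₀, borderedMinor a j₀ j₁ (j₀.succAbove j₁)]

/-- A maximal minor of the Jacobian matrix of the local equations. -/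
def chartJacobian (a : Fin (m + 1) × Fin (m + 2) × Fin 4 → ℂ) (l : Fin 4) (j₀ : Fin (m + 2))
    (j₁ : Fin (m + 1)) (s : Fin 4) : CoordRing :=
  (Matrix.of fun t r : Fin 3 =>
    MvPolynomial.pderiv (s.succAbove t) (chartEquation a l j₀ j₁ r)).det

/-- Modulo the two bordered minors the cofactors form a left null vector of the matrix, with `i₀`-th
entry the inner minor up to sign. That entry therefore kills every maximal minor. -/
lemma innerMinor_mul_mem (a : Fin (m + 1) × Fin (m + 2) × Fin 4 → ℂ) (l : Fin 4)
    (i₀ : Fin (m + 1)) (j₀ : Fin (m + 2)) (j₁ : Fin (m + 1)) (x : CoordRing)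
    (hx : x ∈ chartIdeal a l) :
    innerMinor a i₀ j₀ j₁ * x ∈ Ideal.span (Set.range (chartEquation a l j₀ j₁)) := by
  obtain ⟨y, hy, z, hz, rfl⟩ := Submodule.mem_sup.mp hx
  obtain ⟨z, rfl⟩ := Ideal.mem_span_singleton'.mp hz
  rw [mul_add]
  refine add_mem ?_ ?_
  · rw [← Ideal.Quotient.eq_zero_iff_mem]
    refine map_innerMinor_mul_eq_zero a i₀ j₀ j₁ _ ?_ ?_ y hy
    · exact Ideal.Quotient.eq_zero_iff_mem.mpr (Ideal.subset_span ⟨1, rfl⟩)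
    · exact Ideal.Quotient.eq_zero_iff_mem.mpr (Ideal.subset_span ⟨2, rfl⟩)
  · exact Ideal.mul_mem_left _ _ (Ideal.mul_mem_left _ _ (Ideal.subset_span ⟨0, rfl⟩))

lemma chartEquation_mem (a : Fin (m + 1) × Fin (m + 2) × Fin 4 → ℂ) (l : Fin 4)
    (j₀ : Fin (m + 2)) (j₁ : Fin (m + 1)) (r : Fin 3) :
    chartEquation a l j₀ j₁ r ∈ chartIdeal a l := by
  fin_cases r
  · exact Ideal.mem_sup_right (Ideal.subset_span rfl)
  · exact Ideal.mem_sup_left (borderedMinor_mem _ _ _ _)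
  · exact Ideal.mem_sup_left (borderedMinor_mem _ _ _ _)

lemma exists_eval_chartJacobian_ne_zero {a : Fin (m + 1) × Fin (m + 2) × Fin 4 → ℂ}
    (ha : ∀ u q v, ¬ IsSingularPoint a u q v) {p : Fin 4 → ℂ} {l : Fin 4}
    (hp : ∀ x ∈ chartIdeal a l, MvPolynomial.eval p x = 0) :
    ∃ (i₀ : Fin (m + 1)) (j₀ : Fin (m + 2)) (j₁ : Fin (m + 1)) (s : Fin 4),
      MvPolynomial.eval p (innerMinor a i₀ j₀ j₁ * chartJacobian a l j₀ j₁ s) ≠ 0 := by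
  have hl : p l = 1 := by
    have := hp (MvPolynomial.X l - 1) (Ideal.mem_sup_right (Ideal.subset_span rfl))
    simpa [sub_eq_zero] using this
  have hp0 : p ≠ 0 := by rintro rfl; simp at hl
  have hI : ∀ x ∈ minorIdeal a, MvPolynomial.eval p x = 0 :=
    fun x hx => hp x (Ideal.mem_sup_left hx)
  obtain ⟨i₀, j₀, j₁, hdet⟩ := exists_det_valueMatrix_ne_zero ha hp0 (fun j => by
    have := hI (maximalMinor a j) (Ideal.subset_span ⟨j, rfl⟩)
    rwa [maximalMinor, RingHom.map_det, RingHom.mapMatrix_apply, ← Matrix.submatrix_map,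
      map_formMatrix] at this)
  have hδ : MvPolynomial.eval p (innerMinor a i₀ j₀ j₁) ≠ 0 := by
    rw [innerMinor, eval_cofactor, cofactor]
    exact mul_ne_zero (pow_ne_zero _ (by norm_num)) hdet
  let G : Matrix (Fin 3) (Fin 4) ℂ := Matrix.of fun r t =>
    MvPolynomial.eval p (MvPolynomial.pderiv t (chartEquation a l j₀ j₁ r))
  obtain ⟨s, hs⟩ := exists_det_submatrix_ne_zero G (fun w hw => by
    obtain ⟨h0, h1, h2⟩ := borderedMinor_gradients_independent ha hl i₀ j₀ j₁ hδ hI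
      (w 0) (w 1) (w 2) (fun t => by
        have e : (if t = l then 1 else 0 : ℂ) =
            MvPolynomial.eval p (MvPolynomial.pderiv t (MvPolynomial.X l - 1)) := by
          by_cases htl : t = l
          · subst htl; simp [MvPolynomial.pderiv_X]
          · simp [MvPolynomial.pderiv_X, htl, Ne.symm htl]
        have := congrFun hw t
        simp only [Matrix.vecMul, dotProduct, Fin.sum_univ_three] at this
        rw [e]
        exact this)
    ext r
    fin_cases r
    · exact h0
    · exact h1
    · exact h2)
  refine ⟨i₀, j₀, j₁, s, ?_⟩
  rw [map_mul]
  refine mul_ne_zero hδ ?_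
  rw [chartJacobian, RingHom.map_det]
  rw [← Matrix.det_transpose] at hs
  exact hs

/-- By the Nullstellensatz it suffices that the products `g x` have no common zero on the chart. In
each product the inner minor makes the three equations generate the ideal locally, and the Jacobian
minor makes them independent. -/
lemma locally_isStandardSmooth_chart {a : Fin (m + 1) × Fin (m + 2) × Fin 4 → ℂ}
    (ha : ∀ u q v, ¬ IsSingularPoint a u q v) (l : Fin 4) :
    RingHom.Locally (RingHom.IsStandardSmoothOfRelativeDimension 1)
      (algebraMap ℂ (CoordRing ⧸ chartIdeal a l)) := by
  let g : Fin (m + 1) × Fin (m + 2) × Fin (m + 1) × Fin 4 → CoordRing := fun x =>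
    innerMinor a x.1 x.2.1 x.2.2.1 * chartJacobian a l x.2.1 x.2.2.1 x.2.2.2
  refine ⟨Set.range fun x => Ideal.Quotient.mk (chartIdeal a l) (g x), ?_, ?_⟩
  · have htop : chartIdeal a l ⊔ Ideal.span (Set.range g) = ⊤ := by
      by_contra hne
      obtain ⟨𝔪, h𝔪, hle⟩ := Ideal.exists_le_maximal _ hne
      obtain ⟨p, rfl⟩ := MvPolynomial.isMaximal_iff_eq_vanishingIdeal_singleton.mp h𝔪
      have hev : ∀ x ∈ chartIdeal a l ⊔ Ideal.span (Set.range g), MvPolynomial.eval p x = 0 := by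
        intro x hx
        have := (MvPolynomial.mem_vanishingIdeal_singleton_iff p x).mp (hle hx)
        exact this
      obtain ⟨i₀, j₀, j₁, s, h⟩ := exists_eval_chartJacobian_ne_zero ha
        (fun x hx => hev x (Ideal.mem_sup_left hx))
      exact h (hev _ (Ideal.mem_sup_right (Ideal.subset_span ⟨(i₀, j₀, j₁, s), rfl⟩)))
    have := congrArg (Ideal.map (Ideal.Quotient.mk (chartIdeal a l))) htop
    rw [Ideal.map_sup, Ideal.map_quotient_self, bot_sup_eq, Ideal.map_span, Ideal.map_top,
      ← Set.range_comp] at this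
    exact this
  · rintro _ ⟨x, rfl⟩
    rw [← IsScalarTower.algebraMap_eq,
      RingHom.isStandardSmoothOfRelativeDimension_algebraMap]
    refine isStandardSmooth_away (chartIdeal a l) (chartEquation a l x.2.1 x.2.2.1)
      (chartEquation_mem a l _ _) (g x) ?_ x.2.2.2 (Dvd.intro_left _ rfl)
    intro y hy
    simp only [g]
    rw [mul_right_comm]
    exact Ideal.mul_mem_right _ _ (innerMinor_mul_mem a l _ _ _ y hy)

end Chart

/-! ### Coordinates in the homogeneous coordinate ring. -/

section HomogeneousLocalization

variable {n : ℕ} (a : Fin n × Fin (n + 1) × Fin 4 → ℂ)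

/-- The image of a coordinate in the homogeneous coordinate ring of the degeneracy locus. -/
def coord (l : Fin 4) : DegeneracyRing a := Ideal.Quotient.mk (minorIdeal a) (MvPolynomial.X l)

lemma mk_mem_degeneracyGrading {f : CoordRing} {d : ℕ} (hf : f.IsHomogeneous d) :
    Ideal.Quotient.mk (minorIdeal a) f ∈ degeneracyGrading a d :=
  ⟨f, hf, rfl⟩

lemma coord_mem (l : Fin 4) : coord a l ∈ degeneracyGrading a 1 :=
  mk_mem_degeneracyGrading a (MvPolynomial.isHomogeneous_X ℂ l)

end HomogeneousLocalization


/-! ### Charts of the Proj as affine schemes, and smoothness of the locus. -/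

section ChartIso

variable {n : ℕ} (a : Fin n × Fin (n + 1) × Fin 4 → ℂ) (l : Fin 4)

lemma mem_degeneracyGrading_iff {d : ℕ} {b : DegeneracyRing a} :
    b ∈ degeneracyGrading a d ↔
      ∃ f : CoordRing, f.IsHomogeneous d ∧ Ideal.Quotient.mk (minorIdeal a) f = b :=
  Iff.rfl

lemma maximalMinor_mem (j : Fin (n + 1)) : maximalMinor a j ∈ minorIdeal a :=
  Ideal.subset_span ⟨j, rfl⟩

lemma minorIdeal_le_chartIdeal : minorIdeal a ≤ chartIdeal a l := le_sup_left

lemma mk_chartIdeal_X : Ideal.Quotient.mk (chartIdeal a l) (MvPolynomial.X l) = 1 := by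
  rw [← map_one (Ideal.Quotient.mk (chartIdeal a l)), Ideal.Quotient.eq]
  exact Ideal.mem_sup_right (Ideal.subset_span rfl)

lemma isUnit_factor_coord :
    IsUnit (Ideal.Quotient.factor (minorIdeal_le_chartIdeal a l) (coord a l)) := by
  rw [coord, Ideal.Quotient.factor_mk, mk_chartIdeal_X]
  exact isUnit_one

/-- The inclusion of the constants in the coordinate ring of a chart. -/
def awayConst (f : DegeneracyRing a) :
    ℂ →+* HomogeneousLocalization.Away (degeneracyGrading a) f :=
  (HomogeneousLocalization.fromZeroRingHom (degeneracyGrading a) (Submonoid.powers f)).comp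
    (algebraMap ℂ (degeneracyGrading a 0))

lemma val_awayConst (f : DegeneracyRing a) (c : ℂ) :
    (awayConst a f c).val = algebraMap (DegeneracyRing a) (Localization.Away f)
      (Ideal.Quotient.mk (minorIdeal a) (MvPolynomial.C c)) := by
  rw [← Localization.mk_one_eq_algebraMap]
  rfl

/-- Dehomogenization of polynomials with respect to the `l`-th coordinate. -/
def dehomogenize :
    CoordRing →+* HomogeneousLocalization.Away (degeneracyGrading a) (coord a l) :=
  MvPolynomial.eval₂Hom (awayConst a (coord a l)) fun i =>
    HomogeneousLocalization.Away.mk (degeneracyGrading a) (coord_mem a l) 1 (coord a i)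
      (by simpa using coord_mem a i)

lemma algebraMap_coord_mul_val_dehomogenize_X (i : Fin 4) :
    algebraMap (DegeneracyRing a) (Localization.Away (coord a l)) (coord a l) *
      (dehomogenize a l (MvPolynomial.X i)).val = algebraMap _ _ (coord a i) := by
  simp only [dehomogenize, MvPolynomial.coe_eval₂Hom, MvPolynomial.eval₂_X,
    HomogeneousLocalization.Away.val_mk]
  rw [Localization.mk_eq_mk', mul_comm]
  have := IsLocalization.mk'_spec (Localization.Away (coord a l)) (coord a i)
    (⟨coord a l ^ 1, 1, rfl⟩ : Submonoid.powers (coord a l))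
  simpa only [pow_one] using this

/-- This is x_l^d f(x / x_l) = f(x), checked on monomials. Since x_l is a unit in the localization,
it determines the dehomogenization of a form. -/
lemma algebraMap_coord_pow_mul_val_dehomogenize {f : CoordRing} {d : ℕ} (hf : f.IsHomogeneous d) :
    algebraMap (DegeneracyRing a) (Localization.Away (coord a l)) (coord a l) ^ d *
      (dehomogenize a l f).val =
      algebraMap _ _ (Ideal.Quotient.mk (minorIdeal a) f) := by
  let ψ : CoordRing →+* Localization.Away (coord a l) :=
    (algebraMap (HomogeneousLocalization.Away (degeneracyGrading a) (coord a l))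
      (Localization.Away (coord a l))).comp (dehomogenize a l)
  have hψ : ∀ f, (dehomogenize a l f).val = ψ f := fun f => rfl
  rw [hψ]
  nth_rewrite 1 [f.as_sum]
  conv_rhs => rw [f.as_sum]
  simp only [map_sum, Finset.mul_sum]
  refine Finset.sum_congr rfl fun e he => ?_
  have hd : ∑ i, e i = d := by
    have := hf (MvPolynomial.mem_support_iff.mp he)
    rw [← this, Finsupp.weight_apply, Finsupp.sum_fintype _ _ (by simp)]
    simp
  rw [MvPolynomial.monomial_eq, Finsupp.prod_fintype _ _ (by simp)]
  simp only [map_mul, map_prod, map_pow]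
  rw [← hd, ← Finset.prod_pow_eq_pow_sum, mul_left_comm, ← Finset.prod_mul_distrib]
  congr 1
  · rw [← hψ]
    simp only [dehomogenize, MvPolynomial.coe_eval₂Hom, MvPolynomial.eval₂_C]
    exact val_awayConst a _ _
  · refine Finset.prod_congr rfl fun i _ => ?_
    rw [← mul_pow]
    congr 1
    exact algebraMap_coord_mul_val_dehomogenize_X a l i

lemma isUnit_algebraMap_coord :
    IsUnit (algebraMap (DegeneracyRing a) (Localization.Away (coord a l)) (coord a l)) :=
  IsLocalization.map_units _ (⟨coord a l, 1, by simp⟩ : Submonoid.powers (coord a l))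

lemma dehomogenize_surjective : Function.Surjective (dehomogenize a l) := by
  intro z
  obtain ⟨N, b, hb, rfl⟩ := HomogeneousLocalization.Away.mk_surjective (degeneracyGrading a)
    (coord_mem a l) z
  obtain ⟨f, hf, rfl⟩ := (mem_degeneracyGrading_iff a).mp hb
  refine ⟨f, ?_⟩
  apply HomogeneousLocalization.val_injective
  rw [HomogeneousLocalization.Away.val_mk]
  apply ((isUnit_algebraMap_coord a l).pow (N • 1)).mul_left_cancel
  rw [algebraMap_coord_pow_mul_val_dehomogenize a l hf]
  rw [Localization.mk_eq_mk', mul_comm, smul_eq_mul, mul_one, ← map_pow]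
  exact (IsLocalization.mk'_spec (Localization.Away (coord a l)) _
    (⟨coord a l ^ N, N, rfl⟩ : Submonoid.powers (coord a l))).symm

lemma chartIdeal_le_ker_dehomogenize : chartIdeal a l ≤ RingHom.ker (dehomogenize a l) := by
  refine sup_le (Ideal.span_le.mpr ?_) (Ideal.span_le.mpr ?_)
  · rintro _ ⟨j, rfl⟩
    apply HomogeneousLocalization.val_injective
    apply ((isUnit_algebraMap_coord a l).pow n).mul_left_cancel
    rw [algebraMap_coord_pow_mul_val_dehomogenize a l (maximalMinor_isHomogeneous a j),
      HomogeneousLocalization.val_zero, mul_zero,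
      Ideal.Quotient.eq_zero_iff_mem.mpr (maximalMinor_mem a j), map_zero]
  · rintro _ rfl
    change dehomogenize a l _ = 0
    rw [map_sub, sub_eq_zero, map_one]
    apply HomogeneousLocalization.val_injective
    apply (isUnit_algebraMap_coord a l).mul_left_cancel
    rw [algebraMap_coord_mul_val_dehomogenize_X, HomogeneousLocalization.val_one, mul_one]

/-- Setting the `l`-th coordinate to one. -/
def specialize : HomogeneousLocalization.Away (degeneracyGrading a) (coord a l) →+*
    CoordRing ⧸ chartIdeal a l :=
  (IsLocalization.Away.lift (S := Localization.Away (coord a l)) (coord a l)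
    (isUnit_factor_coord a l)).comp
    (algebraMap (HomogeneousLocalization.Away (degeneracyGrading a) (coord a l))
      (Localization.Away (coord a l)))

lemma specialize_dehomogenize (f : CoordRing) :
    specialize a l (dehomogenize a l f) = Ideal.Quotient.mk (chartIdeal a l) f := by
  suffices h : (specialize a l).comp (dehomogenize a l) = Ideal.Quotient.mk (chartIdeal a l) from
    DFunLike.congr_fun h f
  have hlift : ∀ z, specialize a l z = IsLocalization.Away.lift (coord a l)
      (isUnit_factor_coord a l) z.val := fun z => rfl
  refine MvPolynomial.ringHom_ext (fun c => ?_) fun i => ?_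
  · rw [RingHom.comp_apply, hlift, dehomogenize, MvPolynomial.coe_eval₂Hom,
      MvPolynomial.eval₂_C, val_awayConst, IsLocalization.Away.lift_eq]
    rfl
  · have h := congrArg (IsLocalization.Away.lift (coord a l) (isUnit_factor_coord a l))
      (algebraMap_coord_mul_val_dehomogenize_X a l i)
    rw [map_mul, IsLocalization.Away.lift_eq, IsLocalization.Away.lift_eq, ← hlift] at h
    have hl : Ideal.Quotient.factor (minorIdeal_le_chartIdeal a l) (coord a l) = 1 :=
      mk_chartIdeal_X a l
    rw [hl, one_mul] at h
    exact h

/-- The coordinate ring of the chart where the `l`-th coordinate is nonzero. -/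
def chartEquiv : (CoordRing ⧸ chartIdeal a l) ≃+*
    HomogeneousLocalization.Away (degeneracyGrading a) (coord a l) :=
  RingEquiv.ofBijective (Ideal.Quotient.lift (chartIdeal a l) (dehomogenize a l)
    fun _ hx => chartIdeal_le_ker_dehomogenize a l hx)
    ⟨by
      refine Function.LeftInverse.injective (g := specialize a l) fun y => ?_
      obtain ⟨f, rfl⟩ := Ideal.Quotient.mk_surjective y
      exact specialize_dehomogenize a l f,
    Ideal.Quotient.lift_surjective_of_surjective _ _ (dehomogenize_surjective a l)⟩

lemma chartEquiv_comp_algebraMap :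
    (chartEquiv a l).toRingHom.comp (algebraMap ℂ (CoordRing ⧸ chartIdeal a l)) =
      awayConst a (coord a l) := by
  refine RingHom.ext fun c => ?_
  change dehomogenize a l (MvPolynomial.C c) = _
  simp [dehomogenize]

lemma iSup_standardCover : ⨆ l, standardCover a l = ⊤ := by
  refine Proj.iSup_basicOpen_eq_top' (degeneracyGrading a) (coord a)
    (fun i => ⟨1, coord_mem a i⟩) ?_
  rw [eq_top_iff]
  rintro b -
  obtain ⟨f, rfl⟩ := Ideal.Quotient.mk_surjective b
  induction f using MvPolynomial.induction_on with
  | C c =>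
    exact Subalgebra.algebraMap_mem _ (algebraMap ℂ (degeneracyGrading a 0) c)
  | add p q hp hq =>
    rw [map_add]
    exact add_mem hp hq
  | mul_X p i hp =>
    rw [map_mul]
    exact mul_mem hp (Algebra.subset_adjoin ⟨i, rfl⟩)

lemma awayι_comp_degeneracyStructureMap {f : DegeneracyRing a} {d : ℕ}
    (hf : f ∈ degeneracyGrading a d) (hd : 0 < d) :
    Proj.awayι (degeneracyGrading a) f hf hd ≫ degeneracyStructureMap a =
      Spec.map (CommRingCat.ofHom (awayConst a f)) := by
  refine (Category.assoc _ _ _).symm.trans ((congrArg (fun g => g ≫ Spec.map (CommRingCat.ofHom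
    (algebraMap ℂ (degeneracyGrading a 0)))) (Proj.awayι_toSpecZero _ _ _ _)).trans ?_)
  exact (Spec.map_comp _ _).symm

end ChartIso

lemma smoothOfRelativeDimension_degeneracyStructureMap {m : ℕ}
    {a : Fin (m + 1) × Fin (m + 2) × Fin 4 → ℂ} (ha : ∀ u q v, ¬ IsSingularPoint a u q v) :
    SmoothOfRelativeDimension 1 (degeneracyStructureMap a) := by
  have hP : HasRingHomProperty (@SmoothOfRelativeDimension.{0} 1)
      (RingHom.Locally (RingHom.IsStandardSmoothOfRelativeDimension 1)) := inferInstance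
  have hP' : IsZariskiLocalAtSource (@SmoothOfRelativeDimension.{0} 1) :=
    HasRingHomProperty.instIsZariskiLocalAtSource
      (Q := RingHom.Locally (RingHom.IsStandardSmoothOfRelativeDimension 1))
  rw [IsZariskiLocalAtSource.iff_of_iSup_eq_top (P := @SmoothOfRelativeDimension 1)
    (standardCover a) (iSup_standardCover a)]
  intro l
  let e : (standardCover a l).toScheme ≅
      Spec (CommRingCat.of (HomogeneousLocalization.Away (degeneracyGrading a) (coord a l))) :=
    Proj.basicOpenIsoSpec (degeneracyGrading a) _ (coord_mem a l) one_pos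
  have h1 : (standardCover a l).ι ≫ degeneracyStructureMap a =
      e.hom ≫ Spec.map (CommRingCat.ofHom (awayConst a (coord a l))) :=
    (Iso.inv_comp_eq e).mp ((Category.assoc _ _ _).symm.trans
      (awayι_comp_degeneracyStructureMap a (coord_mem a l) one_pos))
  have hQ : MorphismProperty.RespectsIso (@SmoothOfRelativeDimension.{0} 1) :=
    hP'.toRespects
  rw [h1, MorphismProperty.cancel_left_of_respectsIso (@SmoothOfRelativeDimension.{0} 1),
    HasRingHomProperty.Spec_iff (P := @SmoothOfRelativeDimension.{0} 1)]
  rw [CommRingCat.hom_ofHom, ← chartEquiv_comp_algebraMap]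
  exact (RingHom.locally_respectsIso
    RingHom.isStandardSmoothOfRelativeDimension_respectsIso).left _ (chartEquiv a l)
    (locally_isStandardSmooth_chart ha l)


/-! ### Monomials of degree less than `n` in the last two variables span modulo the minors. -/

section Spanning

/-- The exponents of degree `t` whose degree in the last two variables is less than `n`. -/
def stdExps (n t : ℕ) : Set (Fin 4 →₀ ℕ) := {e | e.degree = t ∧ e 2 + e 3 < n}

/-- The exponent of the monomial of degree `n` in the last two variables with degree `k` in the
first of them. -/
def lastExp (n k : ℕ) : Fin 4 →₀ ℕ := Finsupp.single 2 k + Finsupp.single 3 (n - k)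

lemma degree_eq_sum (e : Fin 4 →₀ ℕ) : e.degree = e 0 + e 1 + e 2 + e 3 := by
  rw [Finsupp.degree_eq_sum, Fin.sum_univ_four]

lemma lastExp_two_add_three {n k : ℕ} (hk : k ≤ n) : lastExp n k 2 + lastExp n k 3 = n := by
  have h2 : lastExp n k 2 = k := by simp [lastExp]
  have h3 : lastExp n k 3 = n - k := by
    rw [lastExp, Finsupp.add_apply, Finsupp.single_eq_same]
    simp
  omega

lemma degree_lastExp {n k : ℕ} (hk : k ≤ n) : (lastExp n k).degree = n := by
  have h0 : lastExp n k 0 = 0 := by simp [lastExp]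
  have h1 : lastExp n k 1 = 0 := by simp [lastExp]
  have := lastExp_two_add_three hk
  rw [degree_eq_sum]
  omega

lemma isHomogeneous_iff_restrictSupport {f : CoordRing} {t : ℕ} :
    f.IsHomogeneous t ↔ f ∈ MvPolynomial.restrictSupport ℂ {e : Fin 4 →₀ ℕ | e.degree = t} := by
  rw [← MvPolynomial.mem_homogeneousSubmodule,
    MvPolynomial.homogeneousSubmodule_eq_finsupp_supported]
  rfl

variable {n : ℕ}

/-- The coefficients of the maximal minors at the monomials of degree `n` in the last two
variables. -/
def lastCoeffs (a : Fin n × Fin (n + 1) × Fin 4 → ℂ) : Matrix (Fin (n + 1)) (Fin (n + 1)) ℂ :=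
  Matrix.of fun j k => MvPolynomial.coeff (lastExp n k) (maximalMinor a j)

/-- The determinant is formed once for the universal matrix, whose coefficients are indeterminates,
and then specialized. -/
lemma exists_eval_eq_det_lastCoeffs :
    ∃ F : MvPolynomial (Fin n × Fin (n + 1) × Fin 4) ℂ,
      ∀ a, MvPolynomial.eval a F = (lastCoeffs a).det := by
  let U : Matrix (Fin n) (Fin (n + 1))
      (MvPolynomial (Fin 4) (MvPolynomial (Fin n × Fin (n + 1) × Fin 4) ℂ)) :=
    Matrix.of fun i j => ∑ l : Fin 4, MvPolynomial.C (MvPolynomial.X (i, j, l)) * MvPolynomial.X l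
  refine ⟨(Matrix.of fun j k : Fin (n + 1) =>
    MvPolynomial.coeff (lastExp n k) (U.submatrix id j.succAbove).det).det, fun a => ?_⟩
  rw [RingHom.map_det]
  congr 1
  ext j k
  simp only [RingHom.mapMatrix_apply, Matrix.map_apply, Matrix.of_apply, lastCoeffs]
  rw [← MvPolynomial.coeff_map, RingHom.map_det, maximalMinor]
  congr 2
  ext i t : 2
  simp [U, formMatrix, map_sum]

/-- A permutation contributing to the determinant never raises `b`. As it preserves the sum of `b`,
it preserves `b` pointwise and is the identity. -/
lemma det_eq_prod_of_triangular {R : Type} [CommRing R] (N : Matrix (Fin n) (Fin n) R)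
    (b : Fin n → ℕ) (hb : Function.Injective b) (h : ∀ i k, b k < b i → N i k = 0) :
    N.det = ∏ k, N k k := by
  rw [Matrix.det_apply, Finset.sum_eq_single 1]
  · simp
  · intro σ _ hσ
    obtain ⟨k, hk⟩ : ∃ k, b k < b (σ k) := by
      by_contra! hle
      have hsum : ∑ k, b (σ k) = ∑ k, b k := Equiv.sum_comp σ b
      have := (Finset.sum_eq_sum_iff_of_le fun k _ => hle k).mp hsum
      exact hσ (Equiv.ext fun k => hb (this k (Finset.mem_univ k)))
    have h0 : ∏ k, N (σ k) k = 0 := Finset.prod_eq_zero (Finset.mem_univ k) (h _ _ hk)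
    rw [h0, smul_zero]
  · simp

lemma prod_range_ite_lt {R : Type} [CommRing R] (x y : R) (j : ℕ) :
    ∀ r, j ≤ r → ∏ i ∈ Finset.range r, (if i < j then x else y) = x ^ j * y ^ (r - j) := by
  intro r hr
  induction r, hr using Nat.le_induction with
  | base =>
    rw [Finset.prod_congr rfl fun i hi => if_pos (Finset.mem_range.mp hi)]
    simp
  | succ r hr ih =>
    rw [Finset.prod_range_succ, ih, if_neg (by omega), Nat.succ_sub hr, pow_succ, mul_assoc]

/-- The coefficients of the bidiagonal matrix with entries `X 2` and `X 3`. -/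
def bidiagonal (n : ℕ) : Fin n × Fin (n + 1) × Fin 4 → ℂ := fun x =>
  if (x.2.1 = x.1.castSucc ∧ x.2.2 = 2) ∨ (x.2.1 = x.1.succ ∧ x.2.2 = 3) then 1 else 0

lemma formMatrix_bidiagonal (i : Fin n) (j : Fin (n + 1)) :
    formMatrix (bidiagonal n) i j = if j = i.castSucc then MvPolynomial.X 2 else
      if j = i.succ then MvPolynomial.X 3 else 0 := by
  simp only [formMatrix, bidiagonal, Matrix.of_apply, Fin.sum_univ_four]
  by_cases h1 : j = i.castSucc
  · have h2 : j ≠ i.succ := by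
      rw [h1]
      exact (Fin.castSucc_lt_succ).ne
    simp [h1, Fin.castSucc_lt_succ.ne]
  · by_cases h2 : j = i.succ <;> simp [h1, h2]
    simp [Fin.castSucc_lt_succ.ne']

lemma maximalMinor_bidiagonal (j : Fin (n + 1)) :
    maximalMinor (bidiagonal n) j = MvPolynomial.monomial (lastExp n j) 1 := by
  -- Without column `j` the matrix is upper bidiagonal before `j` and lower bidiagonal from `j` on,
  -- so the weights increase on the first block and decrease on the second. Subtracting from `2 * n`
  -- keeps the two ranges disjoint.
  let b : Fin n → ℕ := fun i => if (i : ℕ) < j then i else 2 * n - i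
  rw [maximalMinor, det_eq_prod_of_triangular _ b]
  · have hdiag : ∀ k : Fin n, (formMatrix (bidiagonal n)).submatrix id j.succAbove k k =
        if (k : ℕ) < j then MvPolynomial.X 2 else MvPolynomial.X 3 := by
      intro k
      rw [Matrix.submatrix_apply, formMatrix_bidiagonal, id]
      by_cases hk : (k : ℕ) < j
      · rw [Fin.succAbove_of_castSucc_lt _ _ (by simpa [Fin.lt_def] using hk)]
        simp [hk]
      · rw [Fin.succAbove_of_le_castSucc _ _ (by simpa [Fin.le_def] using hk)]
        simp [hk, Fin.castSucc_lt_succ.ne']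
    rw [Finset.prod_congr rfl fun k _ => hdiag k,
      Fin.prod_univ_eq_prod_range (fun i => if i < (j : ℕ) then (MvPolynomial.X 2 : CoordRing)
        else MvPolynomial.X 3) n, prod_range_ite_lt _ _ _ _ (Nat.lt_succ_iff.mp j.2),
      MvPolynomial.X_pow_eq_monomial, MvPolynomial.X_pow_eq_monomial, MvPolynomial.monomial_mul,
      one_mul, lastExp]
  · intro x y hxy
    have := x.2
    have := y.2
    simp only [b] at hxy
    ext
    split_ifs at hxy <;> omega
  · intro i k hik
    have := i.2
    have := k.2
    simp only [b] at hik
    rw [Matrix.submatrix_apply, formMatrix_bidiagonal, id]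
    by_cases hk : (k : ℕ) < j
    · rw [Fin.succAbove_of_castSucc_lt _ _ (by simpa [Fin.lt_def] using hk)]
      rw [if_neg, if_neg]
      · intro h
        have h' : (k : ℕ) = i + 1 := by simpa using congrArg Fin.val h
        split_ifs at hik <;> omega
      · intro h
        have h' : (k : ℕ) = i := by simpa using congrArg Fin.val h
        split_ifs at hik <;> omega
    · rw [Fin.succAbove_of_le_castSucc _ _ (by simpa [Fin.le_def] using hk)]
      rw [if_neg, if_neg]
      · intro h
        have h' : (k : ℕ) = i := by simpa using congrArg Fin.val h
        split_ifs at hik <;> omega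
      · intro h
        have h' : (k : ℕ) + 1 = i := by simpa using congrArg Fin.val h
        split_ifs at hik <;> omega

lemma lastExp_injective (n : ℕ) : Function.Injective (lastExp n) := fun x y h => by
  simpa [lastExp] using DFunLike.congr_fun h 2

lemma lastCoeffs_bidiagonal : lastCoeffs (bidiagonal n) = 1 := by
  ext j k
  rw [lastCoeffs, Matrix.of_apply, maximalMinor_bidiagonal, MvPolynomial.coeff_monomial,
    Matrix.one_apply]
  simp [(lastExp_injective n).eq_iff, Fin.ext_iff]

/-- For a general matrix, the restrictions of the maximal minors to a fixed line are linearly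
independent. -/
lemma holdsForGeneral_det_lastCoeffs :
    HoldsForGeneral fun a : Fin n × Fin (n + 1) × Fin 4 → ℂ => (lastCoeffs a).det ≠ 0 := by
  obtain ⟨F, hF⟩ := exists_eval_eq_det_lastCoeffs (n := n)
  refine ⟨F, ?_, fun a ha => by rwa [hF] at ha⟩
  rintro rfl
  have := hF (bidiagonal n)
  rw [lastCoeffs_bidiagonal] at this
  simp at this

/-- Row `k` of the inverse of `lastCoeffs a` combines the minors into a form whose part in the last
two variables alone is the given monomial. Every other monomial of degree `n` involves one of the
first two variables. -/
lemma exists_sub_mem_restrictSupport {a : Fin n × Fin (n + 1) × Fin 4 → ℂ}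
    (ha : (lastCoeffs a).det ≠ 0) (k : Fin (n + 1)) :
    ∃ P ∈ minorIdeal a, MvPolynomial.monomial (lastExp n k) 1 - P ∈
      MvPolynomial.restrictSupport ℂ (stdExps n n) := by
  let c : Fin (n + 1) → ℂ := (lastCoeffs a)⁻¹ k
  have hc : ∀ k', ∑ j, c j * lastCoeffs a j k' = if k = k' then 1 else 0 := by
    intro k'
    have := congrFun (congrFun
      (Matrix.nonsing_inv_mul (lastCoeffs a) (isUnit_iff_ne_zero.mpr ha)) k) k'
    rw [Matrix.mul_apply, Matrix.one_apply] at this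
    exact this
  refine ⟨∑ j, MvPolynomial.C (c j) * maximalMinor a j,
    sum_mem fun j _ => Ideal.mul_mem_left _ _ (maximalMinor_mem a j), ?_⟩
  rw [MvPolynomial.mem_restrictSupport_iff]
  intro e he
  have hhom : (MvPolynomial.monomial (lastExp n k) (1 : ℂ) -
      ∑ j, MvPolynomial.C (c j) * maximalMinor a j).IsHomogeneous n := by
    refine (MvPolynomial.isHomogeneous_monomial _ ?_).sub
      (MvPolynomial.IsHomogeneous.sum _ _ _ fun j _ =>
        (maximalMinor_isHomogeneous a j).C_mul (c j))
    exact degree_lastExp (Nat.lt_succ_iff.mp k.2)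
  have hdeg : e.degree = n := isHomogeneous_iff_restrictSupport.mp hhom he
  refine ⟨hdeg, ?_⟩
  by_contra hlt
  have he' : e = lastExp n (⟨e 2, by rw [degree_eq_sum] at hdeg; omega⟩ : Fin (n + 1)) := by
    rw [degree_eq_sum] at hdeg
    ext i
    fin_cases i <;> simp [lastExp] <;> omega
  rw [Finset.mem_coe, MvPolynomial.mem_support_iff] at he
  apply he
  rw [he', MvPolynomial.coeff_sub, MvPolynomial.coeff_sum, MvPolynomial.coeff_monomial]
  simp only [MvPolynomial.coeff_C_mul]
  have := hc ⟨e 2, by rw [degree_eq_sum] at hdeg; omega⟩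
  simp only [lastCoeffs, Matrix.of_apply] at this
  rw [this]
  simp [(lastExp_injective n).eq_iff, Fin.ext_iff]

/-- Induction on the degree in the last two variables: as long as it is at least `n`, a factor of
degree `n` in these variables can be replaced, modulo the minors, by terms of smaller degree in
them. -/
lemma monomial_mem_minorIdeal_sup {a : Fin n × Fin (n + 1) × Fin 4 → ℂ}
    (ha : (lastCoeffs a).det ≠ 0) (r : ℕ) : ∀ e : Fin 4 →₀ ℕ, e 2 + e 3 = r →
    MvPolynomial.monomial e (1 : ℂ) ∈ (minorIdeal a).restrictScalars ℂ ⊔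
      MvPolynomial.restrictSupport ℂ (stdExps n e.degree) := by
  induction r using Nat.strong_induction_on with
  | _ r ih =>
    intro e he
    by_cases hr : r < n
    · refine Submodule.mem_sup_right ?_
      rw [MvPolynomial.monomial_mem_restrictSupport]
      exact Or.inl ⟨rfl, by omega⟩
    -- Take as many factors of the variable 2 as possible, up to `n`; the variable 3 then has enough
    -- to complete degree `n`.
    · let k : Fin (n + 1) := ⟨min (e 2) n, by omega⟩
      have hk : lastExp n k ≤ e := by
        intro i
        fin_cases i <;> simp [lastExp, k]
        omega
      obtain ⟨P, hP, hQ⟩ := exists_sub_mem_restrictSupport ha k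
      set Q := MvPolynomial.monomial (lastExp n k) 1 - P with hQdef
      set d := e - lastExp n k with hd
      have hde : d + lastExp n k = e := tsub_add_cancel_of_le hk
      have hdecomp : MvPolynomial.monomial e (1 : ℂ) =
          MvPolynomial.monomial d 1 * P + MvPolynomial.monomial d 1 * Q := by
        rw [hQdef, ← mul_add, add_sub_cancel, MvPolynomial.monomial_mul, hde, one_mul]
      rw [hdecomp]
      refine add_mem (Submodule.mem_sup_left (Ideal.mul_mem_left (minorIdeal a) _ hP)) ?_
      rw [Q.as_sum, Finset.mul_sum]
      refine sum_mem fun e' he' => ?_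
      obtain ⟨h1, h2⟩ := hQ he'
      have h3 : ((d + e') 2 + (d + e') 3) < r := by
        have := lastExp_two_add_three (Nat.lt_succ_iff.mp k.2)
        rw [← he, ← hde]
        simp only [Finsupp.add_apply]
        omega
      have h4 : (d + e').degree = e.degree := by
        rw [← hde, map_add, map_add, h1, degree_lastExp (Nat.lt_succ_iff.mp k.2)]
      have h5 := ih _ h3 (d + e') rfl
      rw [h4] at h5
      rw [MvPolynomial.monomial_mul, one_mul,
        ← mul_one (MvPolynomial.coeff e' Q), ← smul_eq_mul, ← MvPolynomial.smul_monomial]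
      exact Submodule.smul_mem _ _ h5

/-- Every form is congruent modulo the maximal minors to a form of degree less than `n` in the
last two variables. -/
lemma exists_sub_mem_minorIdeal {a : Fin n × Fin (n + 1) × Fin 4 → ℂ}
    (ha : (lastCoeffs a).det ≠ 0) {f : CoordRing} {t : ℕ} (hf : f.IsHomogeneous t) :
    ∃ g ∈ MvPolynomial.restrictSupport ℂ (stdExps n t), f - g ∈ minorIdeal a := by
  have : f ∈ (minorIdeal a).restrictScalars ℂ ⊔ MvPolynomial.restrictSupport ℂ (stdExps n t) := by
    rw [f.as_sum]
    refine sum_mem fun e he => ?_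
    have hdeg : e.degree = t := isHomogeneous_iff_restrictSupport.mp hf he
    have := monomial_mem_minorIdeal_sup ha _ e rfl
    rw [hdeg] at this
    rw [← mul_one (MvPolynomial.coeff e f), ← smul_eq_mul, ← MvPolynomial.smul_monomial]
    exact Submodule.smul_mem _ _ this
  obtain ⟨x, hx, g, hg, rfl⟩ := Submodule.mem_sup.mp this
  exact ⟨g, hg, by rwa [add_sub_cancel_right]⟩

end Spanning


/-! ### Counting standard monomials. -/

section Counting

/-- An exponent of four variables. -/
def expOf (i j k l : ℕ) : Fin 4 →₀ ℕ := Finsupp.equivFunOnFinite.symm ![i, j, k, l]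

lemma expOf_eta (e : Fin 4 →₀ ℕ) : expOf (e 0) (e 1) (e 2) (e 3) = e := by
  ext i
  fin_cases i <;> rfl

/-- Exponents counted by their total degree in the last two variables. -/
lemma exists_finset_exponents (n : ℕ) (A : ℕ → Finset (ℕ × ℕ)) :
    ∃ S : Finset (Fin 4 →₀ ℕ), (∀ e, e ∈ S ↔ e 2 + e 3 < n ∧ (e 0, e 1) ∈ A (e 2 + e 3)) ∧
      S.card = ∑ d ∈ Finset.range n, (d + 1) * (A d).card := by
  classical
  let T : Finset (Σ _ : ℕ, (ℕ × ℕ) × (ℕ × ℕ)) :=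
    (Finset.range n).sigma fun d => Finset.HasAntidiagonal.antidiagonal d ×ˢ A d
  let φ : (Σ _ : ℕ, (ℕ × ℕ) × (ℕ × ℕ)) → (Fin 4 →₀ ℕ) := fun x =>
    expOf x.2.2.1 x.2.2.2 x.2.1.1 x.2.1.2
  refine ⟨T.image φ, fun e => ?_, ?_⟩
  · simp only [Finset.mem_image, T, Finset.mem_sigma, Finset.mem_range, Finset.mem_product,
      Finset.HasAntidiagonal.mem_antidiagonal]
    constructor
    · rintro ⟨⟨d, ⟨k, l⟩, ⟨i, j⟩⟩, ⟨h1, h2, h3⟩, rfl⟩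
      have h2' : k + l = d := h2
      subst h2'
      exact ⟨h1, h3⟩
    · rintro ⟨h1, h2⟩
      exact ⟨⟨e 2 + e 3, (e 2, e 3), (e 0, e 1)⟩, ⟨h1, rfl, h2⟩, expOf_eta e⟩
  · rw [Finset.card_image_of_injOn]
    · simp [T]
    · rintro ⟨d, ⟨k, l⟩, ⟨i, j⟩⟩ h ⟨d', ⟨k', l'⟩, ⟨i', j'⟩⟩ h' heq
      have e0 : i = i' := DFunLike.congr_fun heq 0
      have e1 : j = j' := DFunLike.congr_fun heq 1
      have e2 : k = k' := DFunLike.congr_fun heq 2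
      have e3 : l = l' := DFunLike.congr_fun heq 3
      simp only [T, Finset.coe_sigma, Set.mem_sigma_iff, Finset.mem_coe, Finset.mem_product,
        Finset.HasAntidiagonal.mem_antidiagonal] at h h'
      obtain ⟨-, hd, -⟩ := h
      obtain ⟨-, hd', -⟩ := h'
      subst e0 e1 e2 e3 hd hd'
      rfl

lemma finite_and_finrank_restrictSupport (S : Finset (Fin 4 →₀ ℕ)) {s : Set (Fin 4 →₀ ℕ)}
    (h : ∀ e, e ∈ S ↔ e ∈ s) :
    Module.Finite ℂ (MvPolynomial.restrictSupport ℂ s) ∧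
      Module.finrank ℂ (MvPolynomial.restrictSupport ℂ s) = S.card := by
  have hs : s = ↑S := by ext e; simp [h]
  subst hs
  refine ⟨Module.Finite.of_basis (MvPolynomial.basisRestrictSupport ℂ _), ?_⟩
  rw [Module.finrank_eq_card_basis (MvPolynomial.basisRestrictSupport ℂ _)]
  simp

/-- The number of exponents of degree `t` with degree less than `n` in the last two variables. -/
def stdCount (n t : ℕ) : ℕ := ∑ d ∈ Finset.range n, (d + 1) * (t - d + 1)

/-- Degree `d` in the last two variables leaves `d + 1` choices there and `t - d + 1` in the first
two. The bound on `n` keeps the truncated subtraction exact. -/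
lemma exists_finset_stdExps {n t : ℕ} (h : n ≤ t + 1) :
    ∃ S : Finset (Fin 4 →₀ ℕ), (∀ e, e ∈ S ↔ e ∈ stdExps n t) ∧ S.card = stdCount n t := by
  obtain ⟨S, hS, hcard⟩ := exists_finset_exponents n fun d => Finset.HasAntidiagonal.antidiagonal (t - d)
  refine ⟨S, fun e => ?_, ?_⟩
  · rw [hS, stdExps, Set.mem_ofPred_eq, degree_eq_sum, Finset.HasAntidiagonal.mem_antidiagonal]
    omega
  · rw [hcard, stdCount]
    simp

lemma finite_stdExps (n t : ℕ) : Module.Finite ℂ (MvPolynomial.restrictSupport ℂ (stdExps n t)) := by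
  obtain ⟨S, hS, -⟩ := exists_finset_exponents n fun d => Finset.range (t + 1) ×ˢ Finset.range (t + 1)
  have hfin : (stdExps n t).Finite := by
    refine S.finite_toSet.subset fun e he => ?_
    obtain ⟨h1, h2⟩ := he
    rw [degree_eq_sum] at h1
    rw [Finset.mem_coe, hS]
    simp
    omega
  exact (finite_and_finrank_restrictSupport hfin.toFinset (fun e => by simp)).1

lemma finrank_stdExps {n t : ℕ} (h : n ≤ t + 1) :
    Module.finrank ℂ (MvPolynomial.restrictSupport ℂ (stdExps n t)) = stdCount n t := by
  obtain ⟨S, hS, hcard⟩ := exists_finset_stdExps h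
  rw [(finite_and_finrank_restrictSupport S hS).2, hcard]

/-- The bound `t + 1` is vacuous in degree `t`, so the same count gives the dimension of the space
of all forms. -/
lemma homogeneousSubmodule_eq_stdExps (t : ℕ) : MvPolynomial.homogeneousSubmodule (Fin 4) ℂ t =
    MvPolynomial.restrictSupport ℂ (stdExps (t + 1) t) := by
  have : {e : Fin 4 →₀ ℕ | e.degree = t} = stdExps (t + 1) t := by
    ext e
    simp only [stdExps, Set.mem_ofPred_eq, degree_eq_sum]
    omega
  rw [← this]
  ext f
  exact isHomogeneous_iff_restrictSupport

instance finite_homogeneousSubmodule (t : ℕ) :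
    Module.Finite ℂ (MvPolynomial.homogeneousSubmodule (Fin 4) ℂ t) := by
  rw [homogeneousSubmodule_eq_stdExps]
  exact finite_stdExps _ _

lemma finrank_homogeneousSubmodule (t : ℕ) :
    Module.finrank ℂ (MvPolynomial.homogeneousSubmodule (Fin 4) ℂ t) = stdCount (t + 1) t := by
  rw [homogeneousSubmodule_eq_stdExps, finrank_stdExps le_rfl]

lemma six_mul_stdCount (t : ℕ) : ∀ n ≤ t + 1, (6 * stdCount n t : ℤ) =
    6 * n * (t + 1) + 3 * t * n * (n - 1) - (n - 1) * n * (2 * n - 1) := by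
  intro n hn
  induction n with
  | zero => simp [stdCount]
  | succ n ih =>
    have h1 : stdCount (n + 1) t = stdCount n t + (n + 1) * (t - n + 1) :=
      Finset.sum_range_succ _ _
    rw [h1]
    push_cast [Nat.cast_sub (show n ≤ t by omega)]
    rw [mul_add, ih (by omega)]
    ring

/-- The relation between Hilbert functions given by the expected resolution. -/
lemma stdCount_add (n s : ℕ) :
    stdCount n (n + 1 + s) + (n + 1) * stdCount (s + 1 + 1) (s + 1) =
      stdCount (n + 1 + s + 1) (n + 1 + s) + n * stdCount (s + 1) s := by
  have h1 := six_mul_stdCount (n + 1 + s) n (by omega)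
  have h2 := six_mul_stdCount (s + 1) (s + 1 + 1) le_rfl
  have h3 := six_mul_stdCount (n + 1 + s) (n + 1 + s + 1) le_rfl
  have h4 := six_mul_stdCount s (s + 1) le_rfl
  push_cast at h1 h2 h3 h4
  zify
  have h : (6 : ℤ) * (stdCount n (n + 1 + s) + (n + 1) * stdCount (s + 1 + 1) (s + 1)) =
      6 * (stdCount (n + 1 + s + 1) (n + 1 + s) + n * stdCount (s + 1) s) := by
    linear_combination h1 + (n + 1) * h2 - h3 - n * h4
  linarith

end Counting


/-! ### Standard monomials are independent: comparison of Hilbert functions. -/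

section Independence

variable {n : ℕ}

/-- Expand the determinant of the matrix with row `i` repeated. These are the Hilbert–Burch
syzygies. -/
lemma sum_formMatrix_mul_maximalMinor (a : Fin n × Fin (n + 1) × Fin 4 → ℂ) (i : Fin n) :
    ∑ j : Fin (n + 1), ((-1) ^ (j : ℕ) * formMatrix a i j) * maximalMinor a j = 0 := by
  have h := sum_cofactor_mul_eq_zero (formMatrix a).transpose id i
  rw [← h]
  refine Finset.sum_congr rfl fun j _ => ?_
  have h1 : ((formMatrix a).transpose.submatrix j.succAbove id).det = maximalMinor a j := by
    rw [maximalMinor, ← Matrix.det_transpose]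
    rfl
  rw [cofactor, h1, Matrix.transpose_apply, id]
  ring

lemma formMatrix_isHomogeneous (a : Fin n × Fin (n + 1) × Fin 4 → ℂ) (i : Fin n)
    (j : Fin (n + 1)) : (formMatrix a i j).IsHomogeneous 1 := by
  rw [formMatrix, Matrix.of_apply]
  exact MvPolynomial.IsHomogeneous.sum _ _ _ fun l _ =>
    MvPolynomial.isHomogeneous_C_mul_X (a (i, j, l)) l

lemma exists_maximalMinor_ne_zero {a : Fin n × Fin (n + 1) × Fin 4 → ℂ}
    (ha : (lastCoeffs a).det ≠ 0) : ∃ j, maximalMinor a j ≠ 0 := by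
  by_contra! h
  refine ha (Matrix.det_eq_zero_of_row_eq_zero 0 fun k => ?_)
  rw [lastCoeffs, Matrix.of_apply, h, MvPolynomial.coeff_zero]

lemma homogeneousComponent_mul_of_isHomogeneous {f g : CoordRing} {s t : ℕ}
    (hg : g.IsHomogeneous t) : MvPolynomial.homogeneousComponent (s + t) (f * g) =
      MvPolynomial.homogeneousComponent s f * g := by
  have hf := MvPolynomial.sum_homogeneousComponent f
  conv_lhs => rw [← hf, Finset.sum_mul, map_sum]
  by_cases hs : s ∈ Finset.range (f.totalDegree + 1)
  · rw [Finset.sum_eq_single s]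
    · exact MvPolynomial.homogeneousComponent_eq_self
        ((MvPolynomial.homogeneousComponent_isHomogeneous s f).mul hg)
    · intro d _ hd
      rw [MvPolynomial.homogeneousComponent_of_mem
        ((MvPolynomial.homogeneousComponent_isHomogeneous d f).mul hg), if_neg (by omega)]
    · exact fun h => absurd hs h
  · rw [Finset.sum_eq_zero, MvPolynomial.homogeneousComponent_eq_zero, zero_mul]
    · simpa using hs
    · intro d hd
      rw [MvPolynomial.homogeneousComponent_of_mem
        ((MvPolynomial.homogeneousComponent_isHomogeneous d f).mul hg), if_neg]
      rintro h
      have : s = d := by omega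
      exact hs (this ▸ hd)

/-- Combinations of the maximal minors with coefficients of degree `s`. -/
def minorComb (a : Fin n × Fin (n + 1) × Fin 4 → ℂ) (s : ℕ) :
    (Fin (n + 1) → MvPolynomial.homogeneousSubmodule (Fin 4) ℂ s) →ₗ[ℂ] CoordRing :=
  ∑ j, LinearMap.mulRight ℂ (maximalMinor a j) ∘ₗ
    (MvPolynomial.homogeneousSubmodule (Fin 4) ℂ s).subtype ∘ₗ LinearMap.proj j

lemma minorComb_apply (a : Fin n × Fin (n + 1) × Fin 4 → ℂ) (s : ℕ)
    (g : Fin (n + 1) → MvPolynomial.homogeneousSubmodule (Fin 4) ℂ s) :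
    minorComb a s g = ∑ j, (g j : CoordRing) * maximalMinor a j := by
  simp [minorComb]

lemma inf_homogeneousSubmodule_le_range_minorComb (a : Fin n × Fin (n + 1) × Fin 4 → ℂ) (s : ℕ) :
    (minorIdeal a).restrictScalars ℂ ⊓ MvPolynomial.homogeneousSubmodule (Fin 4) ℂ (s + n) ≤
      LinearMap.range (minorComb a s) := by
  rintro f ⟨hI, hf⟩
  obtain ⟨c, hc⟩ := (Ideal.mem_span_range_iff_exists_fun).mp hI
  refine ⟨fun j => ⟨MvPolynomial.homogeneousComponent s (c j),
    MvPolynomial.homogeneousComponent_isHomogeneous s (c j)⟩, ?_⟩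
  rw [minorComb_apply, ← MvPolynomial.homogeneousComponent_eq_self hf, ← hc, map_sum]
  exact Finset.sum_congr rfl fun j _ =>
    (homogeneousComponent_mul_of_isHomogeneous (maximalMinor_isHomogeneous a j)).symm

/-- Combinations of the rows of the matrix, with alternating signs on the columns, with
coefficients of degree `s`. -/
def rowComb (a : Fin n × Fin (n + 1) × Fin 4 → ℂ) (s : ℕ) :
    (Fin n → MvPolynomial.homogeneousSubmodule (Fin 4) ℂ s) →ₗ[ℂ]
      (Fin (n + 1) → MvPolynomial.homogeneousSubmodule (Fin 4) ℂ (s + 1)) :=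
  LinearMap.pi fun j => LinearMap.codRestrict _
    (∑ i, LinearMap.mulRight ℂ ((-1) ^ (j : ℕ) * formMatrix a i j) ∘ₗ
      (MvPolynomial.homogeneousSubmodule (Fin 4) ℂ s).subtype ∘ₗ LinearMap.proj i) fun h => by
    rw [LinearMap.sum_apply]
    refine sum_mem fun i _ => ?_
    refine MvPolynomial.IsHomogeneous.mul (h i).2 ?_
    have h0 : ((-1 : CoordRing) ^ (j : ℕ)).IsHomogeneous (0 * j) :=
      ((MvPolynomial.isHomogeneous_one (Fin 4) ℂ).neg).pow _
    simpa using h0.mul (formMatrix_isHomogeneous a i j)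

lemma coe_rowComb (a : Fin n × Fin (n + 1) × Fin 4 → ℂ) (s : ℕ)
    (h : Fin n → MvPolynomial.homogeneousSubmodule (Fin 4) ℂ s) (j : Fin (n + 1)) :
    (rowComb a s h j : CoordRing) =
      ∑ i, (h i : CoordRing) * ((-1) ^ (j : ℕ) * formMatrix a i j) := by
  simp [rowComb, mul_assoc]

lemma range_rowComb_le_ker (a : Fin n × Fin (n + 1) × Fin 4 → ℂ) (s : ℕ) :
    LinearMap.range (rowComb a s) ≤ LinearMap.ker (minorComb a (s + 1)) := by
  rintro _ ⟨h, rfl⟩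
  rw [LinearMap.mem_ker, minorComb_apply]
  simp only [coe_rowComb, Finset.sum_mul]
  rw [Finset.sum_comm]
  refine Finset.sum_eq_zero fun i _ => ?_
  simp only [mul_assoc ((h i : CoordRing))]
  rw [← Finset.mul_sum, sum_formMatrix_mul_maximalMinor, mul_zero]

/-- Relations among the rows are killed by any maximal minor, and some minor is a nonzero element of
a domain. -/
lemma rowComb_injective {a : Fin n × Fin (n + 1) × Fin 4 → ℂ}
    (ha : (lastCoeffs a).det ≠ 0) (s : ℕ) : Function.Injective (rowComb a s) := by
  rw [← LinearMap.ker_eq_bot, LinearMap.ker_eq_bot']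
  intro h hh
  obtain ⟨j, hj⟩ := exists_maximalMinor_ne_zero ha
  funext i
  have h0 := mul_det_eq_zero_of_vecMul_eq_zero ((formMatrix a).submatrix id j.succAbove)
    (fun i => (h i : CoordRing)) (fun k => by
      have h1 := congrArg Subtype.val (congrFun hh (j.succAbove k))
      rw [coe_rowComb] at h1
      simp only [mul_left_comm _ ((-1 : CoordRing) ^ _)] at h1
      rw [← Finset.mul_sum] at h1
      exact (mul_eq_zero.mp h1).resolve_left (pow_ne_zero _ (by simp))) i
  exact Subtype.ext ((mul_eq_zero.mp h0).resolve_right hj)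

/-- The ideal in this degree lies in the image of `minorComb`, whose kernel contains an injective
image of `rowComb`. Only this inequality is needed, not exactness of the resolution. -/
lemma finrank_inf_homogeneousSubmodule_add_le {a : Fin n × Fin (n + 1) × Fin 4 → ℂ}
    (ha : (lastCoeffs a).det ≠ 0) (s : ℕ) :
    Module.finrank ℂ ((minorIdeal a).restrictScalars ℂ ⊓
        MvPolynomial.homogeneousSubmodule (Fin 4) ℂ (n + 1 + s) : Submodule ℂ CoordRing) +
      n * stdCount (s + 1) s ≤ (n + 1) * stdCount (s + 1 + 1) (s + 1) := by
  have h1 := (minorComb a (s + 1)).finrank_range_add_finrank_ker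
  have h2 := Submodule.finrank_mono (range_rowComb_le_ker a s)
  rw [LinearMap.finrank_range_of_inj (rowComb_injective ha s)] at h2
  have h3 := Submodule.finrank_mono (inf_homogeneousSubmodule_le_range_minorComb a (s + 1))
  rw [show s + 1 + n = n + 1 + s by ring] at h3
  simp only [Module.finrank_pi_fintype, finrank_homogeneousSubmodule, Finset.sum_const,
    Finset.card_univ, Fintype.card_fin, smul_eq_mul] at h1 h2
  omega

lemma restrictSupport_stdExps_le (n t : ℕ) : MvPolynomial.restrictSupport ℂ (stdExps n t) ≤
    MvPolynomial.homogeneousSubmodule (Fin 4) ℂ t := fun _ hf =>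
  isHomogeneous_iff_restrictSupport.mpr fun _ he => (hf he).1

/-- Standard forms and the ideal together span all forms, while by `stdCount_add` their dimensions
add up to no more than that of all forms. The intersection is therefore zero. -/
lemma restrictSupport_stdExps_inf_of_lt {a : Fin n × Fin (n + 1) × Fin 4 → ℂ}
    (ha : (lastCoeffs a).det ≠ 0) (s : ℕ) :
    MvPolynomial.restrictSupport ℂ (stdExps n (n + 1 + s)) ⊓
      (minorIdeal a).restrictScalars ℂ = ⊥ := by
  set W := MvPolynomial.restrictSupport ℂ (stdExps n (n + 1 + s))
  set H := MvPolynomial.homogeneousSubmodule (Fin 4) ℂ (n + 1 + s)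
  set J := (minorIdeal a).restrictScalars ℂ
  have : Module.Finite ℂ W := finite_stdExps _ _
  have : Module.Finite ℂ (J ⊓ H : Submodule ℂ CoordRing) :=
    Submodule.finiteDimensional_of_le inf_le_right
  have h1 : _ + Module.finrank ℂ ↥(W ⊓ (J ⊓ H)) = Module.finrank ℂ W + Module.finrank ℂ ↥(J ⊓ H) :=
    Submodule.finrank_sup_add_finrank_inf_eq W (J ⊓ H)
  have h2 : H ≤ W ⊔ (J ⊓ H) := by
    intro f hf
    obtain ⟨g, hg, hfg⟩ := exists_sub_mem_minorIdeal ha hf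
    rw [← add_sub_cancel g f]
    exact Submodule.add_mem_sup hg ⟨hfg, sub_mem hf (restrictSupport_stdExps_le _ _ hg)⟩
  have h3 := Submodule.finrank_mono h2
  have h4 : Module.finrank ℂ ↥(J ⊓ H) + _ ≤ _ := finrank_inf_homogeneousSubmodule_add_le ha s
  have h5 := stdCount_add n s
  rw [finrank_homogeneousSubmodule] at h3
  have h6 : Module.finrank ℂ W = _ := finrank_stdExps (show n ≤ n + 1 + s + 1 by omega)
  have h7 : Module.finrank ℂ ↥(W ⊓ (J ⊓ H)) = 0 := by
    omega
  have h8 := Submodule.finrank_eq_zero.mp h7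
  rw [eq_bot_iff, ← h8]
  exact le_inf inf_le_left (le_inf inf_le_right (inf_le_left.trans (restrictSupport_stdExps_le _ _)))

/-- Multiplying by a power of the first variable preserves both spaces and moves any degree into the
range of `restrictSupport_stdExps_inf_of_lt`. -/
lemma restrictSupport_stdExps_inf {a : Fin n × Fin (n + 1) × Fin 4 → ℂ}
    (ha : (lastCoeffs a).det ≠ 0) (t : ℕ) :
    MvPolynomial.restrictSupport ℂ (stdExps n t) ⊓ (minorIdeal a).restrictScalars ℂ = ⊥ := by
  rw [eq_bot_iff]
  rintro f ⟨hf, hI⟩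
  have h : MvPolynomial.X 0 ^ (n + 1) * f ∈
      MvPolynomial.restrictSupport ℂ (stdExps n (n + 1 + t)) ⊓
        (minorIdeal a).restrictScalars ℂ := by
    refine ⟨?_, Ideal.mul_mem_left (minorIdeal a) _ hI⟩
    rw [f.as_sum, Finset.mul_sum]
    refine sum_mem fun e he => ?_
    obtain ⟨h1, h2⟩ := hf he
    rw [MvPolynomial.X_pow_eq_monomial, MvPolynomial.monomial_mul,
      MvPolynomial.monomial_mem_restrictSupport]
    left
    refine ⟨by simp [h1], by simpa using h2⟩
  rw [restrictSupport_stdExps_inf_of_lt ha] at h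
  exact (mul_eq_zero.mp h).resolve_left (pow_ne_zero _ (MvPolynomial.X_ne_zero 0))

/-- The exponents with degree less than `n` in the last two variables. -/
def freeExps (n : ℕ) : Set (Fin 4 →₀ ℕ) := {e | e 2 + e 3 < n}

lemma stdExps_subset (n t : ℕ) : stdExps n t ⊆ freeExps n := fun _ h => h.2

lemma homogeneousComponent_mem_stdExps {f : CoordRing} (t : ℕ)
    (hf : f ∈ MvPolynomial.restrictSupport ℂ (freeExps n)) :
    MvPolynomial.homogeneousComponent t f ∈ MvPolynomial.restrictSupport ℂ (stdExps n t) := by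
  classical
  rw [MvPolynomial.mem_restrictSupport_iff]
  intro e he
  rw [Finset.mem_coe, MvPolynomial.mem_support_iff,
    MvPolynomial.coeff_homogeneousComponent] at he
  split_ifs at he with h
  · exact ⟨h, hf (MvPolynomial.mem_support_iff.mpr he)⟩
  · exact absurd rfl he

/-- The monomials with degree less than `n` in the last two variables form a basis of the
coordinate ring modulo the maximal minors. -/
lemma isCompl_freeExps {a : Fin n × Fin (n + 1) × Fin 4 → ℂ} (ha : (lastCoeffs a).det ≠ 0) :
    IsCompl (MvPolynomial.restrictSupport ℂ (freeExps n)) ((minorIdeal a).restrictScalars ℂ) := by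
  constructor
  · rw [disjoint_iff, eq_bot_iff]
    rintro f ⟨hf, hI⟩
    rw [Submodule.mem_bot, ← MvPolynomial.sum_homogeneousComponent f]
    refine Finset.sum_eq_zero fun t _ => ?_
    have h : MvPolynomial.homogeneousComponent t f ∈
        MvPolynomial.restrictSupport ℂ (stdExps n t) ⊓ (minorIdeal a).restrictScalars ℂ :=
      ⟨homogeneousComponent_mem_stdExps t hf,
        MvPolynomial.homogeneousComponent_mem_of_mem (minorIdeal_isHomogeneous a) hI t⟩
    rwa [restrictSupport_stdExps_inf ha] at h
  · rw [codisjoint_iff, eq_top_iff]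
    intro f _
    rw [← MvPolynomial.sum_homogeneousComponent f]
    refine sum_mem fun t _ => ?_
    obtain ⟨g, hg, hfg⟩ := exists_sub_mem_minorIdeal ha
      (MvPolynomial.homogeneousComponent_isHomogeneous t f)
    rw [← add_sub_cancel g (MvPolynomial.homogeneousComponent t f)]
    exact Submodule.add_mem_sup
      (MvPolynomial.restrictSupport_mono ℂ (stdExps_subset n t) hg) hfg

end Independence


/-! ### Normal forms, the Hilbert polynomial, and splitting by powers of two coordinates. -/

section NormalForm

variable {n : ℕ} {a : Fin n × Fin (n + 1) × Fin 4 → ℂ} (ha : (lastCoeffs a).det ≠ 0)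

/-- The space spanned by the monomials with degree less than `n` in the last two variables maps
isomorphically to the coordinate ring of the degeneracy locus. -/
def freeEquiv : MvPolynomial.restrictSupport ℂ (freeExps n) ≃ₗ[ℂ] DegeneracyRing a :=
  LinearEquiv.ofBijective
    ((Ideal.Quotient.mkₐ ℂ (minorIdeal a)).toLinearMap ∘ₗ Submodule.subtype _) (by
      constructor
      · rw [← LinearMap.ker_eq_bot, LinearMap.ker_eq_bot']
        rintro ⟨f, hf⟩ h
        exact Subtype.ext ((isCompl_freeExps ha).disjoint.le_bot
          ⟨hf, Ideal.Quotient.eq_zero_iff_mem.mp h⟩)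
      · intro b
        obtain ⟨f, rfl⟩ := Ideal.Quotient.mk_surjective b
        have hf : f ∈ MvPolynomial.restrictSupport ℂ (freeExps n) ⊔
            (minorIdeal a).restrictScalars ℂ := by
          rw [(isCompl_freeExps ha).sup_eq_top]
          trivial
        obtain ⟨g, hg, h, hh, rfl⟩ := Submodule.mem_sup.mp hf
        refine ⟨⟨g, hg⟩, ?_⟩
        exact (Ideal.Quotient.mk_eq_mk_iff_sub_mem _ _).mpr (by
          simpa using (minorIdeal a).neg_mem hh))

/-- The representative with degree less than `n` in the last two variables. -/
def normalForm : DegeneracyRing a →ₗ[ℂ] CoordRing :=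
  Submodule.subtype _ ∘ₗ (freeEquiv ha).symm.toLinearMap

lemma normalForm_mem (b : DegeneracyRing a) :
    normalForm ha b ∈ MvPolynomial.restrictSupport ℂ (freeExps n) :=
  ((freeEquiv ha).symm b).2

lemma mk_normalForm (b : DegeneracyRing a) :
    Ideal.Quotient.mk (minorIdeal a) (normalForm ha b) = b :=
  (freeEquiv ha).apply_symm_apply b

lemma normalForm_injective : Function.Injective (normalForm ha) :=
  Function.LeftInverse.injective (mk_normalForm ha)

lemma normalForm_mk {f : CoordRing} (hf : f ∈ MvPolynomial.restrictSupport ℂ (freeExps n)) :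
    normalForm ha (Ideal.Quotient.mk (minorIdeal a) f) = f :=
  congrArg Subtype.val ((freeEquiv ha).symm_apply_apply ⟨f, hf⟩)

/-- The monomial of the first two variables with the given exponents. -/
def firstExp (i j : ℕ) : Fin 4 →₀ ℕ := Finsupp.single 0 i + Finsupp.single 1 j

lemma coord_pow_mul_coord_pow (a : Fin n × Fin (n + 1) × Fin 4 → ℂ) (i j : ℕ) :
    coord a 0 ^ i * coord a 1 ^ j =
      Ideal.Quotient.mk (minorIdeal a) (MvPolynomial.monomial (firstExp i j) 1) := by
  have h : MvPolynomial.monomial (firstExp i j) (1 : ℂ) =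
      MvPolynomial.X 0 ^ i * MvPolynomial.X 1 ^ j := by
    rw [MvPolynomial.X_pow_eq_monomial, MvPolynomial.X_pow_eq_monomial, MvPolynomial.monomial_mul,
      one_mul, firstExp]
  rw [h, map_mul, map_pow, map_pow]
  rfl

/-- Being standard does not restrict the first two exponents, so taking normal forms commutes with
multiplication by monomials in these variables. This is freeness over ℂ[x₀, x₁], on which the
cohomology computations rest. -/
lemma normalForm_mul (i j : ℕ) (b : DegeneracyRing a) :
    normalForm ha (coord a 0 ^ i * coord a 1 ^ j * b) =
      MvPolynomial.monomial (firstExp i j) 1 * normalForm ha b := by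
  conv_lhs => rw [coord_pow_mul_coord_pow, ← mk_normalForm ha b, ← map_mul]
  refine normalForm_mk ha ?_
  rw [(normalForm ha b).as_sum, Finset.mul_sum]
  refine sum_mem fun e he => ?_
  have h := normalForm_mem ha b he
  rw [MvPolynomial.monomial_mul, MvPolynomial.monomial_mem_restrictSupport]
  left
  simpa [freeExps, firstExp] using h

lemma normalForm_mem_stdExps {t : ℕ} {b : DegeneracyRing a} (hb : b ∈ degeneracyGrading a t) :
    normalForm ha b ∈ MvPolynomial.restrictSupport ℂ (stdExps n t) := by
  obtain ⟨f, hf, rfl⟩ := (mem_degeneracyGrading_iff a).mp hb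
  obtain ⟨g, hg, hfg⟩ := exists_sub_mem_minorIdeal ha hf
  rw [(Ideal.Quotient.mk_eq_mk_iff_sub_mem f g).mpr hfg,
    normalForm_mk ha (MvPolynomial.restrictSupport_mono ℂ (stdExps_subset n t) hg)]
  exact hg

lemma degeneracyGrading_le {t : ℕ} {V : Submodule ℂ (DegeneracyRing a)}
    (ha : (lastCoeffs a).det ≠ 0)
    (hV : ∀ e ∈ stdExps n t, Ideal.Quotient.mk (minorIdeal a) (MvPolynomial.monomial e 1) ∈ V) :
    degeneracyGrading a t ≤ V := by
  intro b hb
  rw [← mk_normalForm ha b, (normalForm ha b).as_sum, map_sum]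
  refine sum_mem fun e he => ?_
  rw [← mul_one (MvPolynomial.coeff e _), ← smul_eq_mul, ← MvPolynomial.smul_monomial]
  exact V.smul_mem _ (hV e (normalForm_mem_stdExps ha hb he))

lemma coord_pow_mul_coord_pow_mul_injective (ha : (lastCoeffs a).det ≠ 0) (i j : ℕ) :
    Function.Injective fun b : DegeneracyRing a => coord a 0 ^ i * coord a 1 ^ j * b := by
  intro b c h
  refine normalForm_injective ha (mul_left_cancel₀ (b := normalForm ha b)
    (a := MvPolynomial.monomial (firstExp i j) (1 : ℂ)) ?_ ?_)
  · simp
  · rw [← normalForm_mul, ← normalForm_mul]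
    exact congrArg _ h

lemma map_normalForm (t : ℕ) : (degeneracyGrading a t).map (normalForm ha) =
    MvPolynomial.restrictSupport ℂ (stdExps n t) := by
  refine le_antisymm ?_ fun f hf => ?_
  · rintro _ ⟨b, hb, rfl⟩
    exact normalForm_mem_stdExps ha hb
  · refine ⟨Ideal.Quotient.mk _ f, mk_mem_degeneracyGrading a (restrictSupport_stdExps_le n t hf), ?_⟩
    exact normalForm_mk ha (MvPolynomial.restrictSupport_mono ℂ (stdExps_subset n t) hf)

lemma finrank_degeneracyGrading (ha : (lastCoeffs a).det ≠ 0) {t : ℕ} (ht : n ≤ t + 1) :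
    Module.finrank ℂ (degeneracyGrading a t) = stdCount n t := by
  rw [← finrank_stdExps ht, ← map_normalForm ha]
  exact (Submodule.equivMapOfInjective _ (normalForm_injective ha) _).finrank_eq

lemma sum_range_succ_eq_choose (n : ℕ) : ∑ d ∈ Finset.range n, (d + 1) = (n + 1).choose 2 := by
  induction n with
  | zero => rfl
  | succ n ih =>
    rw [Finset.sum_range_succ, ih, Nat.choose_succ_succ' (n + 1) 1, Nat.choose_one_right, add_comm]

/-- The degree of the degeneracy locus. -/
lemma hasDegree (hn : 0 < n) (ha : (lastCoeffs a).det ≠ 0) : HasDegree a ((n + 1).choose 2) := by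
  have hc : ((n + 1).choose 2 : ℚ) ≠ 0 :=
    Nat.cast_ne_zero.mpr (Nat.choose_pos (by omega)).ne'
  -- For `t ≥ n` the Hilbert function ∑ (d + 1)(t - d + 1) is linear in `t` with slope ∑ (d + 1).
  refine ⟨Polynomial.C ((n + 1).choose 2 : ℚ) * Polynomial.X +
    Polynomial.C (∑ d ∈ Finset.range n, ((d : ℚ) + 1) * (1 - d)), ?_, ?_⟩
  · refine Filter.eventually_atTop.mpr ⟨n, fun t ht => ?_⟩
    rw [finrank_degeneracyGrading ha (by omega), stdCount, ← sum_range_succ_eq_choose]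
    simp only [Polynomial.eval_add, Polynomial.eval_mul, Polynomial.eval_C, Polynomial.eval_X]
    push_cast
    rw [Finset.sum_mul, ← Finset.sum_add_distrib]
    refine Finset.sum_congr rfl fun d hd => ?_
    rw [Nat.cast_sub (by have := Finset.mem_range.mp hd; omega)]
    ring
  · rw [Polynomial.natDegree_linear hc, Polynomial.leadingCoeff_linear hc]
    simp

lemma exists_mk_monomial_eq (a : Fin n × Fin (n + 1) × Fin 4 → ℂ) {e : Fin 4 →₀ ℕ} {i j : ℕ}
    (hi : i ≤ e 0) (hj : j ≤ e 1) : ∃ c ∈ degeneracyGrading a (e.degree - i - j),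
      Ideal.Quotient.mk (minorIdeal a) (MvPolynomial.monomial e 1) =
        coord a 0 ^ i * coord a 1 ^ j * c := by
  have he : firstExp i j + (e - firstExp i j) = e := by
    refine add_tsub_cancel_of_le fun l => ?_
    fin_cases l <;> simp [firstExp, hi, hj]
  have hdeg : (firstExp i j).degree = i + j := by simp [firstExp]
  refine ⟨Ideal.Quotient.mk _ (MvPolynomial.monomial (e - firstExp i j) 1),
    mk_mem_degeneracyGrading a (MvPolynomial.isHomogeneous_monomial _ ?_), ?_⟩
  · have := congrArg Finsupp.degree he
    rw [map_add] at this
    omega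
  · rw [coord_pow_mul_coord_pow, ← map_mul, MvPolynomial.monomial_mul, he, one_mul]

/-- The combinations of the `N`-th powers of the first two coordinates with coefficients of
degree `d`. -/
def splitSubmodule (a : Fin n × Fin (n + 1) × Fin 4 → ℂ) (d N : ℕ) :
    Submodule ℂ (DegeneracyRing a) :=
  (degeneracyGrading a d).map (LinearMap.mulLeft ℂ (coord a 0 ^ N)) ⊔
    (degeneracyGrading a d).map (LinearMap.mulLeft ℂ (coord a 1 ^ N))

lemma mem_splitSubmodule {d N : ℕ} {b : DegeneracyRing a} : b ∈ splitSubmodule a d N ↔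
    ∃ b₀ ∈ degeneracyGrading a d, ∃ b₁ ∈ degeneracyGrading a d,
      b = coord a 0 ^ N * b₀ + coord a 1 ^ N * b₁ := by
  rw [splitSubmodule, Submodule.mem_sup]
  constructor
  · rintro ⟨_, ⟨b₀, h₀, rfl⟩, _, ⟨b₁, h₁, rfl⟩, rfl⟩
    exact ⟨b₀, h₀, b₁, h₁, rfl⟩
  · rintro ⟨b₀, h₀, b₁, h₁, rfl⟩
    exact ⟨_, ⟨b₀, h₀, rfl⟩, _, ⟨b₁, h₁, rfl⟩, rfl⟩

lemma mk_monomial_mem_splitSubmodule (a : Fin n × Fin (n + 1) × Fin 4 → ℂ) {e : Fin 4 →₀ ℕ}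
    {N d : ℕ} (hd : e.degree - N = d) (h : N ≤ e 0 ∨ N ≤ e 1) :
    Ideal.Quotient.mk (minorIdeal a) (MvPolynomial.monomial e 1) ∈ splitSubmodule a d N := by
  subst hd
  rcases h with h | h
  · obtain ⟨c, hc, heq⟩ := exists_mk_monomial_eq a h (Nat.zero_le _)
    rw [heq, pow_zero, mul_one]
    exact Submodule.mem_sup_left ⟨c, hc, rfl⟩
  · obtain ⟨c, hc, heq⟩ := exists_mk_monomial_eq a (Nat.zero_le _) h
    rw [heq, pow_zero, one_mul]
    exact Submodule.mem_sup_right ⟨c, hc, rfl⟩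

/-- In large degree, the coordinate ring lies in the ideal generated by powers of the first two
coordinates. -/
lemma degeneracyGrading_le_splitSubmodule (ha : (lastCoeffs a).det ≠ 0) {t N : ℕ}
    (ht : 2 * N + n ≤ t) : degeneracyGrading a t ≤ splitSubmodule a (t - N) N :=
  degeneracyGrading_le ha fun e he => mk_monomial_mem_splitSubmodule a (by rw [he.1]) (by
    -- The first two exponents add up to more than `t - n ≥ 2 * N`, so one of them is at least `N`.
    obtain ⟨h1, h2⟩ := he
    rw [degree_eq_sum] at h1
    omega)

/-- A standard monomial of degree `2 * N` has its first two exponents adding up to more than `2 * N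
- n`; if both are below `N`, both exceed `N - n`. Hence every class in H¹ has a representative with
denominator (x₀ x₁)^n. -/
lemma degeneracyGrading_le_splitSubmodule_sup (ha : (lastCoeffs a).det ≠ 0) {N : ℕ} (hN : n ≤ N) :
    degeneracyGrading a (N * 2) ≤ splitSubmodule a N N ⊔
      (degeneracyGrading a (n * 2)).map
        (LinearMap.mulLeft ℂ (coord a 0 ^ (N - n) * coord a 1 ^ (N - n))) := by
  refine degeneracyGrading_le ha fun e he => ?_
  obtain ⟨h1, h2⟩ := he
  by_cases h : N ≤ e 0 ∨ N ≤ e 1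
  · exact Submodule.mem_sup_left (mk_monomial_mem_splitSubmodule a (by omega) h)
  · have h3 := degree_eq_sum e
    obtain ⟨c, hc, heq⟩ := exists_mk_monomial_eq a (e := e) (i := N - n) (j := N - n)
      (by omega) (by omega)
    rw [show e.degree - (N - n) - (N - n) = n * 2 by omega] at hc
    rw [heq]
    exact Submodule.mem_sup_right ⟨c, hc, rfl⟩

lemma mem_splitSubmodule_of_coeff_eq_zero {N : ℕ} {b : DegeneracyRing a}
    (hb : b ∈ degeneracyGrading a (N * 2))
    (h : ∀ e : Fin 4 →₀ ℕ, e 0 < N → e 1 < N → MvPolynomial.coeff e (normalForm ha b) = 0) :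
    b ∈ splitSubmodule a N N := by
  rw [← mk_normalForm ha b, (normalForm ha b).as_sum, map_sum]
  refine sum_mem fun e he => ?_
  rw [← mul_one (MvPolynomial.coeff e _), ← smul_eq_mul, ← MvPolynomial.smul_monomial]
  refine Submodule.smul_mem _ _ (mk_monomial_mem_splitSubmodule a ?_ ?_)
  · have := (normalForm_mem_stdExps ha hb he).1
    omega
  · by_contra! hlt
    exact (MvPolynomial.mem_support_iff.mp he) (h e hlt.1 hlt.2)

/-- Compare coefficients at `firstExp K K + e`: both of its first two exponents are below `N + K`,
so the right-hand side contributes nothing. -/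
lemma coeff_normalForm_eq_zero {b b₀ b₁ : DegeneracyRing a} {N K : ℕ}
    (h : coord a 0 ^ K * coord a 1 ^ K * b =
      coord a 0 ^ (N + K) * b₀ + coord a 1 ^ (N + K) * b₁)
    (e : Fin 4 →₀ ℕ) (h0 : e 0 < N) (h1 : e 1 < N) :
    MvPolynomial.coeff e (normalForm ha b) = 0 := by
  have h2 := congrArg (normalForm ha) h
  have h3 := normalForm_mul ha (N + K) 0 b₀
  have h4 := normalForm_mul ha 0 (N + K) b₁
  rw [pow_zero, mul_one] at h3
  rw [pow_zero, one_mul] at h4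
  rw [map_add, normalForm_mul, h3, h4] at h2
  have h5 := congrArg (MvPolynomial.coeff (firstExp K K + e)) h2
  rw [MvPolynomial.coeff_monomial_mul, one_mul, MvPolynomial.coeff_add,
    MvPolynomial.coeff_monomial_mul', MvPolynomial.coeff_monomial_mul', if_neg, if_neg,
    add_zero] at h5
  · exact h5
  · intro hle
    have := hle 1
    simp [firstExp] at this
    omega
  · intro hle
    have := hle 0
    simp [firstExp] at this
    omega

/-- Every monomial of the normal form of `b₀` is divisible by x₀^K and has degree `K`. Applied to a
global section written as b₀ / x₀^K = b₁ / x₁^K, this shows that it is constant. -/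
lemma exists_eq_algebraMap_mul (ha : (lastCoeffs a).det ≠ 0) {b₀ b₁ : DegeneracyRing a} {K : ℕ}
    (hb : b₀ ∈ degeneracyGrading a K) (h : coord a 1 ^ K * b₀ = coord a 0 ^ K * b₁) :
    ∃ c : ℂ, b₀ = algebraMap ℂ (DegeneracyRing a) c * coord a 0 ^ K := by
  have h2 := congrArg (normalForm ha) h
  have h3 := normalForm_mul ha K 0 b₁
  have h4 := normalForm_mul ha 0 K b₀
  rw [pow_zero, mul_one] at h3
  rw [pow_zero, one_mul] at h4
  rw [h3, h4] at h2
  have hsupp : ∀ e ∈ (normalForm ha b₀).support, e = firstExp K 0 := by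
    intro e he
    have h5 := congrArg (MvPolynomial.coeff (firstExp 0 K + e)) h2
    have h6 := (normalForm_mem_stdExps ha hb he).1
    rw [degree_eq_sum] at h6
    rw [MvPolynomial.coeff_monomial_mul, one_mul, MvPolynomial.coeff_monomial_mul'] at h5
    split_ifs at h5 with h7
    · have h8 := h7 0
      simp [firstExp] at h8
      ext i
      fin_cases i <;> simp [firstExp] <;> omega
    · exact absurd h5 (MvPolynomial.mem_support_iff.mp he)
  refine ⟨MvPolynomial.coeff (firstExp K 0) (normalForm ha b₀), ?_⟩
  have h7 := coord_pow_mul_coord_pow a K 0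
  rw [pow_zero, mul_one] at h7
  have h8 : normalForm ha b₀ = MvPolynomial.monomial (firstExp K 0)
      (MvPolynomial.coeff (firstExp K 0) (normalForm ha b₀)) := by
    ext e
    rw [MvPolynomial.coeff_monomial]
    split_ifs with h9
    · rw [h9]
    · by_contra h10
      exact h9 (hsupp e (MvPolynomial.mem_support_iff.mpr h10)).symm
  conv_lhs => rw [← mk_normalForm ha b₀, h8]
  rw [h7, ← Algebra.smul_def, ← mul_one (MvPolynomial.coeff _ _), ← smul_eq_mul,
    ← MvPolynomial.smul_monomial, smul_eq_mul, mul_one]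
  rfl

end NormalForm


/-! ### Counting the monomials that represent H¹. -/

section GenusCount

lemma two_mul_choose_two (n : ℕ) : (2 * n.choose 2 : ℤ) = n * (n - 1) := by
  induction n with
  | zero => simp
  | succ n ih =>
    rw [Nat.choose_succ_succ' n 1, Nat.choose_one_right]
    push_cast
    rw [mul_add, ih]
    ring

lemma six_mul_choose_three (n : ℕ) : (6 * n.choose 3 : ℤ) = n * (n - 1) * (n - 2) := by
  induction n with
  | zero => simp
  | succ n ih =>
    rw [Nat.choose_succ_succ' n 2]
    push_cast
    linear_combination ih + 3 * two_mul_choose_two n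

/-- Truncated subtraction makes the term `d = 0` equal to 0 and not -1, as it must be since 𝒪 has no
H¹ on the projective line. -/
lemma six_mul_sum_range (k : ℕ) :
    (6 * (∑ d ∈ Finset.range (k + 1), (d + 1) * (d - 1) : ℕ) : ℤ) = k * (k - 1) * (2 * k + 5) := by
  induction k with
  | zero => simp
  | succ k ih =>
    rw [Finset.sum_range_succ]
    push_cast at ih ⊢
    rw [mul_add, ih]
    simp
    ring

lemma sum_range_eq_choose {n : ℕ} (hn : 0 < n) :
    ((∑ d ∈ Finset.range n, (d + 1) * (d - 1) : ℕ) : ℤ) =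
      (n : ℤ) * (n.choose 3 : ℤ) - ((n : ℤ) + 1) * ((n - 1).choose 3 : ℤ) := by
  obtain ⟨k, rfl⟩ := Nat.exists_eq_succ_of_ne_zero hn.ne'
  have h1 := six_mul_sum_range k
  have h2 := six_mul_choose_three (k + 1)
  have h3 := six_mul_choose_three k
  rw [Nat.succ_eq_add_one, Nat.add_sub_cancel]
  generalize ((∑ d ∈ Finset.range (k + 1), (d + 1) * (d - 1) : ℕ) : ℤ) = x at *
  push_cast at *
  have h4 : 6 * x = 6 * (((k : ℤ) + 1) * ((k + 1).choose 3 : ℤ) - (k + 1 + 1) * (k.choose 3 : ℤ)) := by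
    linear_combination h1 - (k + 1) * h2 + (k + 2) * h3
  linarith

/-- After division by (x₀ x₁)^n these are the Laurent monomials with both exponents negative. In
degree `d` of the last two variables, `e 1 < n` means `e 0 > n - d`, which leaves `d - 1` values of
`e 0`. -/
lemma exists_finset_genus (n : ℕ) : ∃ S : Finset (Fin 4 →₀ ℕ),
    (∀ e, e ∈ S ↔ e ∈ stdExps n (n * 2) ∧ e 0 < n ∧ e 1 < n) ∧
      S.card = ∑ d ∈ Finset.range n, (d + 1) * (d - 1) := by
  classical
  obtain ⟨S, hS, hcard⟩ := exists_finset_exponents n fun d =>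
    (Finset.Ioo (n - d) n).image fun i => (i, n * 2 - d - i)
  refine ⟨S, fun e => ?_, ?_⟩
  · rw [hS, stdExps, Set.mem_ofPred_eq, degree_eq_sum]
    simp only [Finset.mem_image, Finset.mem_Ioo, Prod.mk.injEq]
    constructor
    · rintro ⟨h1, i, h2, h3, h4⟩
      omega
    · rintro ⟨⟨h1, h2⟩, h3, h4⟩
      exact ⟨h2, e 0, by omega, rfl, by omega⟩
  · rw [hcard]
    refine Finset.sum_congr rfl fun d hd => ?_
    have := Finset.mem_range.mp hd
    rw [Finset.card_image_of_injective _ fun i j h => congrArg Prod.fst h, Nat.card_Ioo]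
    congr 1
    omega

variable {n : ℕ} {a : Fin n × Fin (n + 1) × Fin 4 → ℂ} (ha : (lastCoeffs a).det ≠ 0)

/-- Coefficients of the normal form. -/
def coeffMap (S : Finset (Fin 4 →₀ ℕ)) (t : ℕ) : degeneracyGrading a t →ₗ[ℂ] (S → ℂ) :=
  LinearMap.pi fun e => MvPolynomial.lcoeff ℂ e.1 ∘ₗ normalForm ha ∘ₗ Submodule.subtype _

lemma coeffMap_surjective {S : Finset (Fin 4 →₀ ℕ)} {t : ℕ} (hS : ∀ e ∈ S, e ∈ stdExps n t) :
    Function.Surjective (coeffMap ha S t) := by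
  classical
  intro c
  have hf : ∑ e : S, MvPolynomial.monomial e.1 (c e) ∈
      MvPolynomial.restrictSupport ℂ (stdExps n t) :=
    sum_mem fun e _ => (MvPolynomial.monomial_mem_restrictSupport ℂ).mpr (Or.inl (hS e.1 e.2))
  refine ⟨⟨Ideal.Quotient.mk _ _, mk_mem_degeneracyGrading a (restrictSupport_stdExps_le n t hf)⟩,
    funext fun e => ?_⟩
  change MvPolynomial.coeff e.1 (normalForm ha (Ideal.Quotient.mk _ _)) = _
  rw [normalForm_mk ha (MvPolynomial.restrictSupport_mono ℂ (stdExps_subset n t) hf),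
    MvPolynomial.coeff_sum]
  simp only [MvPolynomial.coeff_monomial]
  rw [Finset.sum_eq_single e]
  · simp
  · intro b _ hb
    rw [if_neg fun h => hb (Subtype.ext h)]
  · simp

/-- The dimension of a quotient of the part of degree `2 * n` in which exactly the monomials
divisible by the `n`-th power of one of the first two variables vanish. -/
lemma finite_and_finrank_of_surjective {Q : Type} [AddCommGroup Q] [Module ℂ Q]
    (π : degeneracyGrading a (n * 2) →ₗ[ℂ] Q) (hπ : Function.Surjective π)
    (hker : ∀ b, π b = 0 ↔ ∀ e : Fin 4 →₀ ℕ, e 0 < n → e 1 < n →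
      MvPolynomial.coeff e (normalForm ha b) = 0) :
    Module.Finite ℂ Q ∧
      Module.finrank ℂ Q = ∑ d ∈ Finset.range n, (d + 1) * (d - 1) := by
  obtain ⟨S, hS, hcard⟩ := exists_finset_genus n
  have hsurj := coeffMap_surjective ha (S := S) (t := n * 2) fun e he => ((hS e).mp he).1
  have hk : LinearMap.ker π = LinearMap.ker (coeffMap ha S (n * 2)) := by
    ext b
    rw [LinearMap.mem_ker, LinearMap.mem_ker, hker]
    constructor
    · intro h
      exact funext fun e => h e.1 ((hS _).mp e.2).2.1 ((hS _).mp e.2).2.2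
    · intro h e h0 h1
      by_contra hne
      have he : e ∈ stdExps n (n * 2) :=
        normalForm_mem_stdExps ha b.2 (MvPolynomial.mem_support_iff.mpr hne)
      exact hne (congrFun h ⟨e, (hS e).mpr ⟨he, h0, h1⟩⟩)
  let E : Q ≃ₗ[ℂ] (S → ℂ) := (π.quotKerEquivOfSurjective hπ).symm ≪≫ₗ
    Submodule.quotEquivOfEq _ _ hk ≪≫ₗ (coeffMap ha S (n * 2)).quotKerEquivOfSurjective hsurj
  refine ⟨Module.Finite.equiv E.symm, ?_⟩
  rw [E.finrank_eq, Module.finrank_fintype_fun_eq_card, Fintype.card_coe, hcard]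

end GenusCount


/-! ### Reduction of the Čech complex to two members of the cover. -/

section CechTwo

variable {k : Type} [Field k] {X : Scheme.{0}} (f : X ⟶ Spec (CommRingCat.of k))

lemma res_res {V W Z : X.Opens} (h : V ≤ W) (h' : W ≤ Z) (s : Sections f Z) :
    res f h (res f h' s) = res f (h.trans h') s := by
  change ((X.presheaf.map (homOfLE h').op) ≫ (X.presheaf.map (homOfLE h).op)).hom s = _
  rw [← Functor.map_comp]
  rfl

lemma res_refl {V : X.Opens} (s : Sections f V) : res f le_rfl s = s := by
  change (X.presheaf.map (𝟙 _)).hom s = s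
  rw [CategoryTheory.Functor.map_id]
  rfl

lemma sections_ext {A B V : X.Opens} (hA : A ≤ V) (hB : B ≤ V) (hV : V ≤ A ⊔ B)
    {s t : Sections f V} (h : res f hA s = res f hA t) (h' : res f hB s = res f hB t) : s = t :=
  X.sheaf.eq_of_locally_eq₂ (homOfLE hA) (homOfLE hB) hV s t h h'

lemma sections_glue {A B V : X.Opens} (hA : A ≤ V) (hB : B ≤ V) (hV : V ≤ A ⊔ B)
    (s : Sections f A) (t : Sections f B)
    (h : res f (inf_le_left : A ⊓ B ≤ A) s = res f (inf_le_right : A ⊓ B ≤ B) t) :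
    ∃ u : Sections f V, res f hA u = s ∧ res f hB u = t := by
  let W : Bool → X.Opens := fun b => Bool.rec A B b
  let sf : ∀ b, Γ(X, W b) := fun b => Bool.rec s t b
  obtain ⟨u, hu, -⟩ := X.sheaf.existsUnique_gluing' W V
    (fun b => homOfLE (by cases b <;> assumption))
    (hV.trans (sup_le (le_iSup W false) (le_iSup W true))) sf (by
      rintro (_ | _) (_ | _)
      · rfl
      · exact h
      · change res f (inf_le_left : B ⊓ A ≤ B) t = res f (inf_le_right : B ⊓ A ≤ A) s
        have h' := congrArg (res f (inf_comm B A).le) h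
        rw [res_res, res_res] at h'
        exact h'.symm
      · rfl)
  exact ⟨u, hu false, hu true⟩

variable {ι : Type} {U : ι → X.Opens} {i₀ i₁ : ι}

lemma mem_ker_cechD1 {s : ∀ p : ι × ι, Sections f (U p.1 ⊓ U p.2)} :
    s ∈ LinearMap.ker (cechD1 f U) ↔ ∀ i j l,
      res f (le_inf (inf_le_left.trans inf_le_right) inf_le_right : U i ⊓ U j ⊓ U l ≤ U j ⊓ U l)
          (s (j, l)) -
        res f (le_inf (inf_le_left.trans inf_le_left) inf_le_right : U i ⊓ U j ⊓ U l ≤ U i ⊓ U l)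
          (s (i, l)) +
        res f (inf_le_left : U i ⊓ U j ⊓ U l ≤ U i ⊓ U j) (s (i, j)) = 0 := by
  rw [LinearMap.mem_ker]
  exact ⟨fun h i j l => congrFun h (i, j, l), fun h => funext fun q => h q.1 q.2.1 q.2.2⟩

lemma cocycle_res {s : ∀ p : ι × ι, Sections f (U p.1 ⊓ U p.2)}
    (hs : s ∈ LinearMap.ker (cechD1 f U)) {W : X.Opens} {i j l : ι} (hi : W ≤ U i) (hj : W ≤ U j)
    (hl : W ≤ U l) : res f (le_inf hi hl) (s (i, l)) =
      res f (le_inf hi hj) (s (i, j)) + res f (le_inf hj hl) (s (j, l)) := by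
  have h := congrArg (res f (le_inf (le_inf hi hj) hl)) ((mem_ker_cechD1 f).mp hs i j l)
  rw [map_add, map_sub, res_res, res_res, res_res, map_zero] at h
  rw [sub_add_eq_add_sub, sub_eq_zero] at h
  rw [add_comm]
  exact h.symm

/-- The differences of sections over two open sets. -/
def cechB1 (A B : X.Opens) : Submodule k (Sections f (A ⊓ B)) :=
  LinearMap.range (res f (inf_le_left : A ⊓ B ≤ A)) ⊔
    LinearMap.range (res f (inf_le_right : A ⊓ B ≤ B))

lemma mem_cechB1 {A B : X.Opens} {s : Sections f (A ⊓ B)} : s ∈ cechB1 f A B ↔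
    ∃ (x : Sections f A) (y : Sections f B), s = res f inf_le_right y - res f inf_le_left x := by
  rw [cechB1, Submodule.mem_sup]
  constructor
  · rintro ⟨_, ⟨x, rfl⟩, _, ⟨y, rfl⟩, rfl⟩
    exact ⟨-x, y, by rw [map_neg, sub_neg_eq_add, add_comm]⟩
  · rintro ⟨x, y, rfl⟩
    exact ⟨_, ⟨-x, rfl⟩, _, ⟨y, rfl⟩, by rw [map_neg, neg_add_eq_sub]⟩

/-- Writing `s (i₀, i₁) = y - x`, the sections `x - s (i, i₀)` and `y - s (i, i₁)` agree on overlaps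
by the cocycle relation. They glue to a cochain with coboundary `s`. -/
lemma mem_range_cechD0_of_mem_cechB1 (hU : U i₀ ⊔ U i₁ = ⊤)
    {s : ∀ p : ι × ι, Sections f (U p.1 ⊓ U p.2)} (hs : s ∈ LinearMap.ker (cechD1 f U))
    (h : s (i₀, i₁) ∈ cechB1 f (U i₀) (U i₁)) : s ∈ LinearMap.range (cechD0 f U) := by
  obtain ⟨x, y, hxy⟩ := (mem_cechB1 f).mp h
  have hcov : ∀ V : X.Opens, V ≤ (V ⊓ U i₀) ⊔ (V ⊓ U i₁) := fun V => by
    rw [← inf_sup_left, hU, inf_top_eq]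
  have hglue : ∀ i, ∃ t : Sections f (U i),
      res f (inf_le_left : U i ⊓ U i₀ ≤ U i) t = res f inf_le_right x - s (i, i₀) ∧
      res f (inf_le_left : U i ⊓ U i₁ ≤ U i) t = res f inf_le_right y - s (i, i₁) := by
    intro i
    refine sections_glue f _ _ (hcov (U i)) _ _ ?_
    rw [map_sub, map_sub, res_res, res_res]
    have hi : U i ⊓ U i₀ ⊓ (U i ⊓ U i₁) ≤ U i := inf_le_left.trans inf_le_left
    have h0 : U i ⊓ U i₀ ⊓ (U i ⊓ U i₁) ≤ U i₀ := inf_le_left.trans inf_le_right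
    have h1 : U i ⊓ U i₀ ⊓ (U i ⊓ U i₁) ≤ U i₁ := inf_le_right.trans inf_le_right
    have h2 := cocycle_res f hs hi h0 h1
    rw [hxy, map_sub, res_res, res_res] at h2
    rw [h2]
    abel
  choose t ht0 ht1 using hglue
  refine ⟨t, funext fun p => ?_⟩
  obtain ⟨i, j⟩ := p
  change res f (inf_le_right : U i ⊓ U j ≤ U j) (t j) -
    res f (inf_le_left : U i ⊓ U j ≤ U i) (t i) = s (i, j)
  refine sections_ext f inf_le_left inf_le_left (hcov (U i ⊓ U j)) ?_ ?_
  · have hi : U i ⊓ U j ⊓ U i₀ ≤ U i := inf_le_left.trans inf_le_left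
    have hj : U i ⊓ U j ⊓ U i₀ ≤ U j := inf_le_left.trans inf_le_right
    have h0 : U i ⊓ U j ⊓ U i₀ ≤ U i₀ := inf_le_right
    have e1 := congrArg (res f (le_inf hi h0)) (ht0 i)
    have e2 := congrArg (res f (le_inf hj h0)) (ht0 j)
    rw [map_sub, res_res, res_res] at e1 e2
    rw [map_sub, res_res, res_res, e1, e2, cocycle_res f hs hi hj h0]
    abel
  · have hi : U i ⊓ U j ⊓ U i₁ ≤ U i := inf_le_left.trans inf_le_left
    have hj : U i ⊓ U j ⊓ U i₁ ≤ U j := inf_le_left.trans inf_le_right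
    have h0 : U i ⊓ U j ⊓ U i₁ ≤ U i₁ := inf_le_right
    have e1 := congrArg (res f (le_inf hi h0)) (ht1 i)
    have e2 := congrArg (res f (le_inf hj h0)) (ht1 j)
    rw [map_sub, res_res, res_res] at e1 e2
    rw [map_sub, res_res, res_res, e1, e2, cocycle_res f hs hi hj h0]
    abel

/-- Split `z` over each member as `y i - x i`. The differences `x i - x j` and `y i - y j` then
agree where both are defined and glue to the value of the cocycle at (i, j). -/
lemma exists_cocycle (hU : U i₀ ⊔ U i₁ = ⊤)
    (hsplit : ∀ i (s : Sections f (U i ⊓ (U i₀ ⊓ U i₁))),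
      ∃ (x : Sections f (U i ⊓ U i₀)) (y : Sections f (U i ⊓ U i₁)),
        s = res f (inf_le_inf_left _ inf_le_right) y - res f (inf_le_inf_left _ inf_le_left) x)
    (z : Sections f (U i₀ ⊓ U i₁)) : ∃ s ∈ LinearMap.ker (cechD1 f U),
      s (i₀, i₁) - z ∈ cechB1 f (U i₀) (U i₁) := by
  have hcov : ∀ V : X.Opens, V ≤ (V ⊓ U i₀) ⊔ (V ⊓ U i₁) := fun V => by
    rw [← inf_sup_left, hU, inf_top_eq]
  choose x y hxy using fun i => hsplit i (res f inf_le_right z)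
  have hz : ∀ i (W : X.Opens) (hi : W ≤ U i) (h0 : W ≤ U i₀) (h1 : W ≤ U i₁),
      res f (le_inf h0 h1) z = res f (le_inf hi h1) (y i) - res f (le_inf hi h0) (x i) := by
    intro i W hi h0 h1
    have h := congrArg (res f (le_inf hi (le_inf h0 h1))) (hxy i)
    rw [map_sub, res_res, res_res, res_res] at h
    exact h
  have hglue : ∀ p : ι × ι, ∃ t : Sections f (U p.1 ⊓ U p.2),
      res f (inf_le_left : U p.1 ⊓ U p.2 ⊓ U i₀ ≤ _) t =
        res f (inf_le_inf_right _ inf_le_left) (x p.1) -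
          res f (inf_le_inf_right _ inf_le_right) (x p.2) ∧
      res f (inf_le_left : U p.1 ⊓ U p.2 ⊓ U i₁ ≤ _) t =
        res f (inf_le_inf_right _ inf_le_left) (y p.1) -
          res f (inf_le_inf_right _ inf_le_right) (y p.2) := by
    rintro ⟨i, j⟩
    refine sections_glue f _ _ (hcov (U i ⊓ U j)) _ _ ?_
    rw [map_sub, map_sub, res_res, res_res, res_res, res_res]
    set W := U i ⊓ U j ⊓ U i₀ ⊓ (U i ⊓ U j ⊓ U i₁)
    have hi : W ≤ U i := (inf_le_left.trans inf_le_left).trans inf_le_left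
    have hj : W ≤ U j := (inf_le_left.trans inf_le_left).trans inf_le_right
    have h0 : W ≤ U i₀ := inf_le_left.trans inf_le_right
    have h1 : W ≤ U i₁ := inf_le_right.trans inf_le_right
    have e1 := hz i W hi h0 h1
    rw [hz j W hj h0 h1] at e1
    rw [sub_eq_sub_iff_add_eq_add] at e1 ⊢
    rw [add_comm, ← e1, add_comm]
  choose s hs0 hs1 using hglue
  have hs0' : ∀ i j (W : X.Opens) (hi : W ≤ U i) (hj : W ≤ U j) (h0 : W ≤ U i₀),
      res f (le_inf hi hj) (s (i, j)) = res f (le_inf hi h0) (x i) - res f (le_inf hj h0) (x j) := by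
    intro i j W hi hj h0
    have h := congrArg (res f (le_inf (le_inf hi hj) h0)) (hs0 (i, j))
    rw [map_sub, res_res, res_res, res_res] at h
    exact h
  have hs1' : ∀ i j (W : X.Opens) (hi : W ≤ U i) (hj : W ≤ U j) (h0 : W ≤ U i₁),
      res f (le_inf hi hj) (s (i, j)) = res f (le_inf hi h0) (y i) - res f (le_inf hj h0) (y j) := by
    intro i j W hi hj h0
    have h := congrArg (res f (le_inf (le_inf hi hj) h0)) (hs1 (i, j))
    rw [map_sub, res_res, res_res, res_res] at h
    exact h
  refine ⟨s, (mem_ker_cechD1 f).mpr fun i j l => ?_, (mem_cechB1 f).mpr ?_⟩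
  · set W := U i ⊓ U j ⊓ U l
    have hi : W ≤ U i := inf_le_left.trans inf_le_left
    have hj : W ≤ U j := inf_le_left.trans inf_le_right
    have hl : W ≤ U l := inf_le_right
    refine sections_ext f inf_le_left inf_le_left (hcov W) ?_ ?_
    · have g : W ⊓ U i₀ ≤ W := inf_le_left
      have e1 := hs0' i j _ (g.trans hi) (g.trans hj) inf_le_right
      have e2 := hs0' j l _ (g.trans hj) (g.trans hl) inf_le_right
      have e3 := hs0' i l _ (g.trans hi) (g.trans hl) inf_le_right
      rw [map_add, map_sub, res_res, res_res, res_res, map_zero, e1, e2, e3]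
      abel
    · have g : W ⊓ U i₁ ≤ W := inf_le_left
      have e1 := hs1' i j _ (g.trans hi) (g.trans hj) inf_le_right
      have e2 := hs1' j l _ (g.trans hj) (g.trans hl) inf_le_right
      have e3 := hs1' i l _ (g.trans hi) (g.trans hl) inf_le_right
      rw [map_add, map_sub, res_res, res_res, res_res, map_zero, e1, e2, e3]
      abel
  · have h0 : U i₀ ⊓ U i₁ ≤ U i₀ := inf_le_left
    have h1 : U i₀ ⊓ U i₁ ≤ U i₁ := inf_le_right
    have e1 := hs0' i₀ i₁ _ h0 h1 h0
    have e2 := hz i₁ _ h1 h0 h1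
    rw [res_refl] at e1 e2
    -- Here `s (i₀, i₁) = x i₀ - x i₁` and `z = y i₁ - x i₁`, so their difference is `x i₀ - y i₁`,
    -- whose terms extend to `U i₀` and `U i₁`.
    refine ⟨-res f (le_inf le_rfl le_rfl) (x i₀), -res f (le_inf le_rfl le_rfl) (y i₁), ?_⟩
    rw [map_neg, map_neg, res_res, res_res, e1, e2]
    abel

/-- The first Čech cohomology for a cover with two members that already cover the scheme, when the
cohomology of the two-member covers induced on all members vanishes. -/
lemma nonempty_cechH1_equiv (hU : U i₀ ⊔ U i₁ = ⊤)
    (hsplit : ∀ i (s : Sections f (U i ⊓ (U i₀ ⊓ U i₁))),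
      ∃ (x : Sections f (U i ⊓ U i₀)) (y : Sections f (U i ⊓ U i₁)),
        s = res f (inf_le_inf_left _ inf_le_right) y - res f (inf_le_inf_left _ inf_le_left) x) :
    Nonempty (CechH1 f U ≃ₗ[k] Sections f (U i₀ ⊓ U i₁) ⧸ cechB1 f (U i₀) (U i₁)) := by
  let φ : LinearMap.ker (cechD1 f U) →ₗ[k] Sections f (U i₀ ⊓ U i₁) ⧸ cechB1 f (U i₀) (U i₁) :=
    (cechB1 f (U i₀) (U i₁)).mkQ ∘ₗ LinearMap.proj (i₀, i₁) ∘ₗ Submodule.subtype _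
  have hφ : Function.Surjective φ := by
    intro q
    obtain ⟨z, rfl⟩ := Submodule.mkQ_surjective _ q
    obtain ⟨s, hs, hsz⟩ := exists_cocycle f hU hsplit z
    exact ⟨⟨s, hs⟩, (Submodule.Quotient.eq _).mpr hsz⟩
  have hker : (LinearMap.range (cechD0 f U)).submoduleOf (LinearMap.ker (cechD1 f U)) =
      LinearMap.ker φ := by
    ext ⟨s, hs⟩
    have h1 : (⟨s, hs⟩ : LinearMap.ker (cechD1 f U)) ∈ LinearMap.ker φ ↔
        s (i₀, i₁) ∈ cechB1 f (U i₀) (U i₁) :=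
      Submodule.Quotient.mk_eq_zero _
    rw [h1, Submodule.submoduleOf, Submodule.mem_comap]
    refine ⟨?_, mem_range_cechD0_of_mem_cechB1 f hU hs⟩
    rintro ⟨t, rfl⟩
    exact (mem_cechB1 f).mpr ⟨t i₀, t i₁, rfl⟩
  exact ⟨Submodule.quotEquivOfEq _ _ hker ≪≫ₗ φ.quotKerEquivOfSurjective hφ⟩

end CechTwo


/-! ### Sections over basic open sets as homogeneous fractions. -/

section BasicOpenSections

variable {n : ℕ} {a : Fin n × Fin (n + 1) × Fin 4 → ℂ}

/-- The basic open set of a homogeneous element. -/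
def locusOpen (g : DegeneracyRing a) : (degeneracyLocus a).Opens :=
  Proj.basicOpen (degeneracyGrading a) g

/-- A homogeneous fraction as a section over a basic open set. -/
def awaySection (g : DegeneracyRing a) : HomogeneousLocalization.Away (degeneracyGrading a) g →+*
    Sections (degeneracyStructureMap a) (locusOpen g) :=
  (Proj.awayToSection (degeneracyGrading a) g).hom

/-- Scalars act on sections through the structure morphism; this identifies them with constant
fractions and makes `frac` linear. -/
lemma awaySection_awayConst {g : DegeneracyRing a} {d : ℕ} (hg : g ∈ degeneracyGrading a d)
    (hd : 0 < d) (c : ℂ) : awaySection g (awayConst a g c) = algebraMap ℂ _ c := by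
  let V : (degeneracyLocus a).Opens := locusOpen g
  let e : V.toScheme ≅ Spec (CommRingCat.of (HomogeneousLocalization.Away (degeneracyGrading a) g)) :=
    Proj.basicOpenIsoSpec (degeneracyGrading a) g hg hd
  let τ : CommRingCat.of (HomogeneousLocalization.Away (degeneracyGrading a) g) ⟶
    Γ(degeneracyLocus a, V) := Proj.awayToSection (degeneracyGrading a) g
  have h1 : V.ι ≫ degeneracyStructureMap a =
      e.hom ≫ Spec.map (CommRingCat.ofHom (awayConst a g)) :=
    (Iso.inv_comp_eq e).mp ((Category.assoc _ _ _).symm.trans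
      (awayι_comp_degeneracyStructureMap a hg hd))
  have h2 : e.hom.appTop = (Scheme.ΓSpecIso _).hom ≫ τ ≫ V.topIso.inv :=
    Proj.basicOpenToSpec_app_top (degeneracyGrading a) g
  have h3 := congrArg (fun φ => (Scheme.ΓSpecIso _).inv ≫ φ.appTop ≫ V.topIso.hom) h1
  simp only [Scheme.Hom.comp_appTop, h2, Category.assoc, Iso.inv_hom_id, Category.comp_id,
    Scheme.ΓSpecIso_naturality_assoc, Iso.inv_hom_id_assoc] at h3
  have h4 : V.ι.appTop ≫ V.topIso.hom =
      (degeneracyLocus a).presheaf.map (homOfLE (le_top : V ≤ ⊤)).op := by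
    rw [Scheme.Opens.ι_appTop, Scheme.Opens.topIso_hom]
    exact (Functor.map_comp _ _ _).symm
  rw [h4] at h3
  exact (DFunLike.congr_fun (congrArg CommRingCat.Hom.hom h3) c).symm

lemma awaySection_bijective {g : DegeneracyRing a} {d : ℕ} (hg : g ∈ degeneracyGrading a d)
    (hd : 0 < d) : Function.Bijective (awaySection g) := by
  have h2 := ConcreteCategory.bijective_of_isIso
    (Proj.basicOpenIsoAway (degeneracyGrading a) g hg hd).hom
  exact h2

/-- The section `b / g ^ N` over the basic open set of `g`. -/
def frac {g : DegeneracyRing a} {d : ℕ} (hg : g ∈ degeneracyGrading a d)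
    {W : (degeneracyLocus a).Opens} (hW : W = locusOpen g) (hd : 0 < d)
    (N : ℕ) : degeneracyGrading a (N * d) →ₗ[ℂ] Sections (degeneracyStructureMap a) W where
  toFun b := res _ hW.le (awaySection g (.mk _ hg N b.1 b.2))
  map_add' b c := by
    rw [← map_add, ← map_add]
    congr 2
    apply HomogeneousLocalization.val_injective
    rw [HomogeneousLocalization.val_add, HomogeneousLocalization.Away.val_mk,
      HomogeneousLocalization.Away.val_mk, HomogeneousLocalization.Away.val_mk,
      Localization.add_mk_self]
    rfl
  map_smul' c b := by
    rw [RingHom.id_apply, ← map_smul]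
    congr 1
    rw [Algebra.smul_def, ← awaySection_awayConst hg hd, ← map_mul]
    congr 1
    apply HomogeneousLocalization.val_injective
    rw [HomogeneousLocalization.val_mul, HomogeneousLocalization.Away.val_mk,
      HomogeneousLocalization.Away.val_mk, val_awayConst,
      show (↑(c • b) : DegeneracyRing a) = Ideal.Quotient.mk _ (MvPolynomial.C c) * b.1 from
        Algebra.smul_def c b.1, ← Localization.mk_one_eq_algebraMap, Localization.mk_mul, one_mul]

variable {g : DegeneracyRing a} {d : ℕ} (hg : g ∈ degeneracyGrading a d)
  {W : (degeneracyLocus a).Opens} (hW : W = locusOpen g) (hd : 0 < d)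

lemma frac_apply (N : ℕ) (b : degeneracyGrading a (N * d)) :
    frac hg hW hd N b = res _ hW.le (awaySection g (.mk _ hg N b.1 b.2)) := rfl

lemma exists_frac_eq (s : Sections (degeneracyStructureMap a) W) :
    ∃ N b, frac hg hW hd N b = s := by
  subst hW
  obtain ⟨z, rfl⟩ := (awaySection_bijective hg hd).2 s
  obtain ⟨N, b, hb, rfl⟩ := HomogeneousLocalization.Away.mk_surjective _ hg z
  exact ⟨N, ⟨b, hb⟩, (frac_apply hg rfl hd N _).trans (res_refl _ _)⟩

lemma frac_eq_iff {N N' : ℕ} {b : degeneracyGrading a (N * d)}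
    {b' : degeneracyGrading a (N' * d)} : frac hg hW hd N b = frac hg hW hd N' b' ↔
      ∃ M, g ^ M * (g ^ N' * b) = g ^ M * (g ^ N * b') := by
  subst hW
  rw [frac_apply, frac_apply, res_refl, res_refl, (awaySection_bijective hg hd).1.eq_iff,
    ← (HomogeneousLocalization.val_injective _).eq_iff, HomogeneousLocalization.Away.val_mk,
    HomogeneousLocalization.Away.val_mk, Localization.mk_eq_mk_iff, Localization.r_iff_exists]
  constructor
  · rintro ⟨⟨_, M, rfl⟩, h⟩
    exact ⟨M, h⟩
  · rintro ⟨M, h⟩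
    exact ⟨⟨_, M, rfl⟩, h⟩

lemma res_frac {g' h : DegeneracyRing a} {d' : ℕ} (hh : h ∈ degeneracyGrading a d')
    (hg' : g' ∈ degeneracyGrading a (d + d')) (hgh : g' = g * h)
    {W' : (degeneracyLocus a).Opens} (hW' : W' = locusOpen g')
    (hle : W' ≤ W) {N : ℕ} (b : degeneracyGrading a (N * d))
    (b' : degeneracyGrading a (N * (d + d'))) (hb : (b' : DegeneracyRing a) = h ^ N * b) :
    res _ hle (frac hg hW hd N b) = frac hg' hW' (by omega) N b' := by
  subst hW hW'
  rw [frac_apply, frac_apply, res_refl, res_refl]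
  have h1 := DFunLike.congr_fun (congrArg CommRingCat.Hom.hom
    (Proj.awayMap_awayToSection (degeneracyGrading a) hh hgh)) (.mk _ hg N b.1 b.2)
  refine h1.symm.trans ?_
  change awaySection g' _ = _
  congr 1
  apply HomogeneousLocalization.val_injective
  change (HomogeneousLocalization.awayMap _ hh hgh (.mk _ hg N b.1 b.2)).val = _
  rw [HomogeneousLocalization.awayMap_mk,
    HomogeneousLocalization.Away.val_mk, HomogeneousLocalization.Away.val_mk, hb, mul_comm]

end BasicOpenSections


/-! ### Computation of H¹ on the first two charts. -/

section CoordSections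

variable {n : ℕ} {a : Fin n × Fin (n + 1) × Fin 4 → ℂ}

lemma coord_pow_mem (a : Fin n × Fin (n + 1) × Fin 4 → ℂ) (i : Fin 4) (K : ℕ) :
    coord a i ^ K ∈ degeneracyGrading a K := by
  simpa using SetLike.pow_mem_graded K (coord_mem a i)

lemma coord_mul_coord_mem (a : Fin n × Fin (n + 1) × Fin 4 → ℂ) (i j : Fin 4) :
    coord a i * coord a j ∈ degeneracyGrading a 2 :=
  SetLike.mul_mem_graded (coord_mem a i) (coord_mem a j)

lemma standardCover_inf (a : Fin n × Fin (n + 1) × Fin 4 → ℂ) (i j : Fin 4) :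
    standardCover a i ⊓ standardCover a j = locusOpen (coord a i * coord a j) :=
  (Proj.basicOpen_mul (degeneracyGrading a) _ _).symm

lemma standardCover_inf_inf (a : Fin n × Fin (n + 1) × Fin 4 → ℂ) (i j l : Fin 4) :
    standardCover a i ⊓ (standardCover a j ⊓ standardCover a l) =
      locusOpen (coord a i * (coord a j * coord a l)) := by
  rw [standardCover_inf a j l]
  exact (Proj.basicOpen_mul (degeneracyGrading a) _ _).symm

/-- The section `b / x ^ N` over the basic open set of a coordinate `x`. -/
def fracOne (a : Fin n × Fin (n + 1) × Fin 4 → ℂ) (i : Fin 4) (N : ℕ) :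
    degeneracyGrading a (N * 1) →ₗ[ℂ] Sections (degeneracyStructureMap a) (standardCover a i) :=
  frac (coord_mem a i) rfl one_pos N

/-- The section `b / (x * y) ^ N` over the basic open set of a product of two coordinates. -/
def fracTwo (a : Fin n × Fin (n + 1) × Fin 4 → ℂ) (i j : Fin 4) (N : ℕ) :
    degeneracyGrading a (N * 2) →ₗ[ℂ]
      Sections (degeneracyStructureMap a) (standardCover a i ⊓ standardCover a j) :=
  frac (coord_mul_coord_mem a i j) (standardCover_inf a i j) two_pos N

lemma res_fracOne_left {i j : Fin 4} {N : ℕ} {b : degeneracyGrading a (N * 1)}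
    {b' : degeneracyGrading a (N * 2)} (h : (b' : DegeneracyRing a) = coord a j ^ N * b) :
    res _ inf_le_left (fracOne a i N b) = fracTwo a i j N b' :=
  res_frac _ _ _ (coord_mem a j) (coord_mul_coord_mem a i j) rfl (standardCover_inf a i j) _ b b' h

lemma res_fracOne_right {i j : Fin 4} {N : ℕ} {b : degeneracyGrading a (N * 1)}
    {b' : degeneracyGrading a (N * 2)} (h : (b' : DegeneracyRing a) = coord a i ^ N * b) :
    res _ inf_le_right (fracOne a j N b) = fracTwo a i j N b' :=
  res_frac _ _ _ (coord_mem a i) (coord_mul_coord_mem a i j) (mul_comm _ _)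
    (standardCover_inf a i j) _ b b' h

lemma exists_fracOne_eq (i : Fin 4) (s : Sections (degeneracyStructureMap a) (standardCover a i)) :
    ∃ N, ∀ M, N ≤ M → ∃ b, fracOne a i M b = s := by
  obtain ⟨N, b, rfl⟩ := exists_frac_eq (coord_mem a i) rfl one_pos s
  refine ⟨N, fun M hM => ⟨⟨coord a i ^ (M - N) * b, ?_⟩, ?_⟩⟩
  · have h := SetLike.mul_mem_graded (coord_pow_mem a i (M - N)) b.2
    rwa [show M - N + N * 1 = M * 1 by omega] at h
  · refine (frac_eq_iff _ _ _).mpr ⟨0, ?_⟩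
    change _ * (coord a i ^ N * (coord a i ^ (M - N) * b)) = _
    rw [← mul_assoc (coord a i ^ N), ← pow_add, Nat.add_sub_cancel' (by omega)]

lemma fracTwo_add {i j : Fin 4} {N K : ℕ} {b : degeneracyGrading a (N * 2)}
    {b' : degeneracyGrading a ((N + K) * 2)}
    (h : (b' : DegeneracyRing a) = coord a i ^ K * coord a j ^ K * b) :
    fracTwo a i j (N + K) b' = fracTwo a i j N b := by
  refine (frac_eq_iff _ _ _).mpr ⟨0, ?_⟩
  rw [h]
  ring

lemma exists_fracTwo_eq {i j : Fin 4}
    (s : Sections (degeneracyStructureMap a) (standardCover a i ⊓ standardCover a j)) (K : ℕ) :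
    ∃ N, ∃ b, fracTwo a i j (N + K) b = s := by
  obtain ⟨N, b, rfl⟩ := exists_frac_eq (coord_mul_coord_mem a i j) (standardCover_inf a i j)
    two_pos s
  have h : coord a i ^ K * coord a j ^ K * b ∈ degeneracyGrading a ((N + K) * 2) := by
    have h := SetLike.mul_mem_graded (SetLike.mul_mem_graded (coord_pow_mem a i K)
      (coord_pow_mem a j K)) b.2
    rwa [show K + K + N * 2 = (N + K) * 2 by ring] at h
  exact ⟨N, ⟨_, h⟩, fracTwo_add rfl⟩

/-- The first two coordinates are nonzerodivisors by freeness, so equality of fractions needs no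
extra power. -/
lemma fracTwo_eq_iff (ha : (lastCoeffs a).det ≠ 0) {N N' : ℕ} {b : degeneracyGrading a (N * 2)}
    {b' : degeneracyGrading a (N' * 2)} : fracTwo a 0 1 N b = fracTwo a 0 1 N' b' ↔
      coord a 0 ^ N' * coord a 1 ^ N' * (b : DegeneracyRing a) =
        coord a 0 ^ N * coord a 1 ^ N * b' := by
  refine (frac_eq_iff _ _ _).trans ⟨?_, fun h => ⟨0, ?_⟩⟩
  · rintro ⟨M, h⟩
    refine coord_pow_mul_coord_pow_mul_injective ha M M ?_
    simpa only [mul_pow] using h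
  · simpa only [mul_pow, pow_zero, one_mul] using h

/-- The locus misses the line x₀ = x₁ = 0, because every form of degree `n + 2` lies in the ideal
(x₀, x₁) modulo the minors. -/
lemma standardCover_zero_sup_one (ha : (lastCoeffs a).det ≠ 0) :
    standardCover a 0 ⊔ standardCover a 1 = ⊤ := by
  refine top_le_iff.mp fun x _ => ?_
  by_contra hx
  have h0 : coord a 0 ∈ x.asHomogeneousIdeal := by
    by_contra h
    exact hx (Or.inl h)
  have h1 : coord a 1 ∈ x.asHomogeneousIdeal := by
    by_contra h
    exact hx (Or.inr h)
  have hall : ∀ l, coord a l ∈ x.asHomogeneousIdeal := by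
    intro l
    obtain ⟨b₀, -, b₁, -, h⟩ := mem_splitSubmodule.mp
      (degeneracyGrading_le_splitSubmodule ha (N := 1) (by omega) (coord_pow_mem a l (n + 2)))
    rw [pow_one, pow_one] at h
    refine x.isPrime.mem_of_pow_mem (n + 2) ?_
    rw [h]
    exact add_mem (Ideal.mul_mem_right _ _ h0) (Ideal.mul_mem_right _ _ h1)
  have hx' : x ∈ ⨆ l, standardCover a l := by
    rw [iSup_standardCover]
    trivial
  obtain ⟨l, hl⟩ := TopologicalSpace.Opens.mem_iSup.mp hx'
  exact hl (hall l)

/-- Where x_i is invertible, multiplying the numerator by x_i^n makes its degree large enough to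
split as x₀^N b₀ + x₁^N b₁. Each term then cancels one of the two coordinates from the denominator.
-/
lemma exists_split (ha : (lastCoeffs a).det ≠ 0) (i : Fin 4)
    (s : Sections (degeneracyStructureMap a)
      (standardCover a i ⊓ (standardCover a 0 ⊓ standardCover a 1))) :
    ∃ (x : Sections (degeneracyStructureMap a) (standardCover a i ⊓ standardCover a 0))
      (y : Sections (degeneracyStructureMap a) (standardCover a i ⊓ standardCover a 1)),
      s = res _ (inf_le_inf_left _ inf_le_right) y - res _ (inf_le_inf_left _ inf_le_left) x := by
  have hg : coord a i * (coord a 0 * coord a 1) ∈ degeneracyGrading a 3 :=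
    SetLike.mul_mem_graded (coord_mem a i) (coord_mul_coord_mem a 0 1)
  obtain ⟨N, b, rfl⟩ := exists_frac_eq hg (standardCover_inf_inf a i 0 1) three_pos s
  obtain ⟨b₀, h₀, b₁, h₁, h⟩ := mem_splitSubmodule.mp (degeneracyGrading_le_splitSubmodule ha
    (N := N) (by omega) (SetLike.mul_mem_graded (coord_pow_mem a i n) b.2))
  rw [show n + N * 3 - N = N * 2 + n by omega] at h₀ h₁
  -- The factor `coord a l ^ n` brings all denominators to the common exponent `N + n`.
  have hmem : ∀ (l l' : Fin 4) {c}, c ∈ degeneracyGrading a (N * 2 + n) →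
      coord a l ^ n * c ∈ degeneracyGrading a ((N + n) * 2) ∧
      coord a l' ^ (N + n) * (coord a l ^ n * c) ∈ degeneracyGrading a ((N + n) * 3) := by
    intro l l' c hc
    have e1 := SetLike.mul_mem_graded (coord_pow_mem a l n) hc
    have e2 := SetLike.mul_mem_graded (coord_pow_mem a l' (N + n)) e1
    rw [show N + n + (n + (N * 2 + n)) = (N + n) * 3 by ring] at e2
    rw [show n + (N * 2 + n) = (N + n) * 2 by ring] at e1
    exact ⟨e1, e2⟩
  have e0 := res_frac (coord_mul_coord_mem a i 0) (standardCover_inf a i 0) two_pos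
    (coord_mem a 1) hg (mul_assoc _ _ _).symm (standardCover_inf_inf a i 0 1)
    (inf_le_inf_left _ inf_le_left) ⟨_, (hmem 0 1 h₁).1⟩ ⟨_, (hmem 0 1 h₁).2⟩ rfl
  have e1 := res_frac (coord_mul_coord_mem a i 1) (standardCover_inf a i 1) two_pos
    (coord_mem a 0) hg (by ring) (standardCover_inf_inf a i 0 1)
    (inf_le_inf_left _ inf_le_right) ⟨_, (hmem 1 0 h₀).1⟩ ⟨_, (hmem 1 0 h₀).2⟩ rfl
  refine ⟨-frac (coord_mul_coord_mem a i 0) (standardCover_inf a i 0) two_pos (N + n)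
      ⟨_, (hmem 0 1 h₁).1⟩,
    frac (coord_mul_coord_mem a i 1) (standardCover_inf a i 1) two_pos (N + n)
      ⟨_, (hmem 1 0 h₀).1⟩, ?_⟩
  rw [map_neg, sub_neg_eq_add, e0, e1, ← map_add]
  refine (frac_eq_iff _ _ _).mpr ⟨0, ?_⟩
  simp only [Submodule.coe_add]
  have h' : (coord a i * (coord a 0 * coord a 1)) ^ (N + n) * (b : DegeneracyRing a) =
      (coord a i * (coord a 0 * coord a 1)) ^ N * (coord a 0 * coord a 1) ^ n *
        (coord a i ^ n * b) := by ring
  rw [h', h]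
  ring

lemma fracTwo_mem_cechB1_iff (ha : (lastCoeffs a).det ≠ 0) {N : ℕ}
    {b : degeneracyGrading a (N * 2)} :
    fracTwo a 0 1 N b ∈ cechB1 (degeneracyStructureMap a) (standardCover a 0) (standardCover a 1) ↔
      ∃ K, ∃ b₀ ∈ degeneracyGrading a (N + K), ∃ b₁ ∈ degeneracyGrading a (N + K),
        coord a 0 ^ K * coord a 1 ^ K * (b : DegeneracyRing a) =
          coord a 0 ^ (N + K) * b₀ + coord a 1 ^ (N + K) * b₁ := by
  have hmem : ∀ (l : Fin 4) {K c}, c ∈ degeneracyGrading a K →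
      coord a l ^ K * c ∈ degeneracyGrading a (K * 2) := by
    intro l K c hc
    rw [mul_two]
    exact SetLike.mul_mem_graded (coord_pow_mem a l K) hc
  rw [mem_cechB1]
  constructor
  · rintro ⟨x, y, h⟩
    obtain ⟨K₀, hx⟩ := exists_fracOne_eq 0 x
    obtain ⟨K₁, hy⟩ := exists_fracOne_eq 1 y
    obtain ⟨⟨b₁, h₁⟩, rfl⟩ := hx (N + (K₀ + K₁)) (by omega)
    obtain ⟨⟨b₀, h₀⟩, rfl⟩ := hy (N + (K₀ + K₁)) (by omega)
    rw [mul_one] at h₀ h₁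
    rw [res_fracOne_left (b' := ⟨_, hmem 1 h₁⟩) rfl, res_fracOne_right (b' := ⟨_, hmem 0 h₀⟩) rfl,
      ← map_sub, fracTwo_eq_iff ha] at h
    refine ⟨K₀ + K₁, b₀, h₀, -b₁, neg_mem h₁,
      coord_pow_mul_coord_pow_mul_injective ha N N ?_⟩
    simp only [Submodule.coe_sub] at h
    dsimp only
    linear_combination h
  · rintro ⟨K, b₀, h₀, b₁, h₁, h⟩
    refine ⟨-fracOne a 0 (N + K) ⟨b₁, by rwa [mul_one]⟩,
      fracOne a 1 (N + K) ⟨b₀, by rwa [mul_one]⟩, ?_⟩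
    rw [map_neg, sub_neg_eq_add, res_fracOne_left (b' := ⟨_, hmem 1 h₁⟩) rfl,
      res_fracOne_right (b' := ⟨_, hmem 0 h₀⟩) rfl, ← map_add, fracTwo_eq_iff ha]
    simp only [Submodule.coe_add]
    rw [← h]
    ring

/-- The first cohomology of the structure sheaf of the degeneracy locus. -/
lemma finite_and_finrank_H1 (ha : (lastCoeffs a).det ≠ 0) : Module.Finite ℂ (H1 a) ∧
    Module.finrank ℂ (H1 a) = ∑ d ∈ Finset.range n, (d + 1) * (d - 1) := by
  obtain ⟨E⟩ := nonempty_cechH1_equiv (degeneracyStructureMap a) (U := standardCover a)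
    (standardCover_zero_sup_one ha) (exists_split ha)
  let B := cechB1 (degeneracyStructureMap a) (standardCover a 0) (standardCover a 1)
  have hmk : ∀ {N} {b : degeneracyGrading a (N * 2)}, B.mkQ (fracTwo a 0 1 N b) = 0 ↔
      ∃ K, ∃ b₀ ∈ degeneracyGrading a (N + K), ∃ b₁ ∈ degeneracyGrading a (N + K),
        coord a 0 ^ K * coord a 1 ^ K * (b : DegeneracyRing a) =
          coord a 0 ^ (N + K) * b₀ + coord a 1 ^ (N + K) * b₁ := by
    intro N b
    rw [Submodule.mkQ_apply, Submodule.Quotient.mk_eq_zero]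
    exact fracTwo_mem_cechB1_iff ha
  -- For surjectivity, a numerator over (x₀ x₁)^(N+n) is a coboundary part plus (x₀ x₁)^N c, and the
  -- latter reduces to c / (x₀ x₁)^n.
  have key := finite_and_finrank_of_surjective ha (B.mkQ ∘ₗ fracTwo a 0 1 n) (by
    intro q
    obtain ⟨s, rfl⟩ := B.mkQ_surjective q
    obtain ⟨N, ⟨b, hb⟩, rfl⟩ := exists_fracTwo_eq s n
    obtain ⟨x, hx, _, ⟨c, hc, rfl⟩, rfl⟩ := Submodule.mem_sup.mp
      (degeneracyGrading_le_splitSubmodule_sup ha (Nat.le_add_left n N) hb)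
    refine ⟨⟨c, hc⟩, ?_⟩
    have hc' : coord a 0 ^ N * coord a 1 ^ N * c ∈ degeneracyGrading a ((N + n) * 2) := by
      have h := SetLike.mul_mem_graded (SetLike.mul_mem_graded (coord_pow_mem a 0 N)
        (coord_pow_mem a 1 N)) hc
      rwa [show N + N + n * 2 = (N + n) * 2 by ring] at h
    simp only [LinearMap.mulLeft_apply, Nat.add_sub_cancel] at hb ⊢
    have hx' : x ∈ degeneracyGrading a ((N + n) * 2) := by
      have h := sub_mem hb hc'
      rwa [add_sub_cancel_right] at h
    have h1 : B.mkQ (fracTwo a 0 1 (N + n) ⟨x, hx'⟩) = 0 := by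
      obtain ⟨b₀, h₀, b₁, h₁, rfl⟩ := mem_splitSubmodule.mp hx
      exact hmk.mpr ⟨0, b₀, h₀, b₁, h₁, by rw [pow_zero, pow_zero, one_mul, one_mul, add_zero]⟩
    have h2 : fracTwo a 0 1 (N + n) ⟨_, hc'⟩ = fracTwo a 0 1 n ⟨c, hc⟩ := by
      refine (fracTwo_eq_iff ha).mpr ?_
      ring
    rw [LinearMap.comp_apply, ← h2, ← zero_add (B.mkQ _), ← h1, ← map_add, ← map_add]
    rfl) (by
    intro b
    rw [LinearMap.comp_apply, hmk]
    constructor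
    · rintro ⟨K, b₀, -, b₁, -, h⟩
      exact coeff_normalForm_eq_zero ha h
    · intro h
      obtain ⟨b₀, h₀, b₁, h₁, heq⟩ := mem_splitSubmodule.mp
        (mem_splitSubmodule_of_coeff_eq_zero ha b.2 h)
      exact ⟨0, b₀, h₀, b₁, h₁, by rw [pow_zero, pow_zero, one_mul, one_mul, heq, add_zero]⟩)
  have := key.1
  exact ⟨Module.Finite.equiv E.symm, E.finrank_eq.trans key.2⟩

end CoordSections


/-! ### Global sections and connectedness. -/

section Connected

variable {n : ℕ} {a : Fin n × Fin (n + 1) × Fin 4 → ℂ}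

lemma res_one {k : Type} [Field k] {X : Scheme.{0}} (f : X ⟶ Spec (CommRingCat.of k))
    {V W : X.Opens} (h : V ≤ W) : res f h 1 = 1 :=
  map_one (X.presheaf.map (homOfLE h).op).hom

lemma frac_pow {g : DegeneracyRing a} {d : ℕ} (hg : g ∈ degeneracyGrading a d)
    {W : (degeneracyLocus a).Opens} (hW : W = locusOpen g) (hd : 0 < d) {K : ℕ}
    (h : g ^ K ∈ degeneracyGrading a (K * d)) : frac hg hW hd K ⟨g ^ K, h⟩ = 1 := by
  rw [frac_apply]
  refine Eq.trans (congrArg _ ?_) (res_one _ _)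
  rw [← map_one (awaySection g)]
  congr 1
  apply HomogeneousLocalization.val_injective
  rw [HomogeneousLocalization.Away.val_mk, HomogeneousLocalization.val_one]
  exact Localization.mk_self (⟨g ^ K, K, rfl⟩ : Submonoid.powers g)

lemma fracOne_pow (i : Fin 4) {K : ℕ} (h : coord a i ^ K ∈ degeneracyGrading a (K * 1)) :
    fracOne a i K ⟨coord a i ^ K, h⟩ = 1 :=
  frac_pow _ _ _ h

/-- The global sections of the structure sheaf are constant. -/
lemma exists_eq_smul_one (ha : (lastCoeffs a).det ≠ 0)
    (s : Sections (degeneracyStructureMap a) ⊤) : ∃ c : ℂ, s = c • 1 := by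
  obtain ⟨K₀, hx⟩ := exists_fracOne_eq 0 (res _ le_top s)
  obtain ⟨K₁, hy⟩ := exists_fracOne_eq 1 (res _ le_top s)
  obtain ⟨⟨b₀, h₀⟩, e₀⟩ := hx (K₀ + K₁) (by omega)
  obtain ⟨⟨b₁, h₁⟩, e₁⟩ := hy (K₀ + K₁) (by omega)
  generalize K₀ + K₁ = K at *
  have hmem : ∀ (l : Fin 4) {c}, c ∈ degeneracyGrading a (K * 1) →
      coord a l ^ K * c ∈ degeneracyGrading a (K * 2) := by
    intro l c hc
    rw [mul_two]
    rw [mul_one] at hc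
    exact SetLike.mul_mem_graded (coord_pow_mem a l K) hc
  have h : fracTwo a 0 1 K ⟨_, hmem 1 h₀⟩ = fracTwo a 0 1 K ⟨_, hmem 0 h₁⟩ := by
    rw [← res_fracOne_left (i := 0) (b := ⟨b₀, h₀⟩) rfl,
      ← res_fracOne_right (j := 1) (b := ⟨b₁, h₁⟩) rfl, e₀, e₁, res_res, res_res]
  have h' := coord_pow_mul_coord_pow_mul_injective ha K K ((fracTwo_eq_iff ha).mp h)
  obtain ⟨c, hc⟩ := exists_eq_algebraMap_mul ha (by rwa [mul_one] at h₀) h'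
  have hc' : b₁ = algebraMap ℂ (DegeneracyRing a) c * coord a 1 ^ K := by
    refine coord_pow_mul_coord_pow_mul_injective ha K 0 ?_
    simp only [pow_zero, mul_one]
    change coord a 1 ^ K * b₀ = _ at h'
    rw [hc] at h'
    linear_combination -h'
  rw [← Algebra.smul_def] at hc hc'
  have hpow : ∀ l, coord a l ^ K ∈ degeneracyGrading a (K * 1) := fun l => by
    rw [mul_one]
    exact coord_pow_mem a l K
  refine ⟨c, sections_ext _ le_top le_top (standardCover_zero_sup_one ha).ge ?_ ?_⟩
  · rw [map_smul, res_one, ← e₀, ← fracOne_pow 0 (hpow 0), ← map_smul]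
    exact congrArg _ (Subtype.ext hc)
  · rw [map_smul, res_one, ← e₁, ← fracOne_pow 1 (hpow 1), ← map_smul]
    exact congrArg _ (Subtype.ext hc')

/-- On an empty scheme 1 = 0 as sections, hence 1 = 0 in the coordinate ring; but 1 is its own
normal form when `n > 0`. -/
lemma nonempty_degeneracyLocus (hn : 0 < n) (ha : (lastCoeffs a).det ≠ 0) :
    Nonempty (degeneracyLocus a) := by
  by_contra h
  rw [not_nonempty_iff] at h
  have h0 : Subsingleton (Sections (degeneracyStructureMap a)
      (standardCover a 0 ⊓ standardCover a 1)) :=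
    inferInstanceAs (Subsingleton Γ(degeneracyLocus a, standardCover a 0 ⊓ standardCover a 1))
  have h1 : (1 : DegeneracyRing a) ∈ degeneracyGrading a (0 * 2) := by
    rw [zero_mul]
    exact SetLike.GradedOne.one_mem
  have h2 := (fracTwo_eq_iff ha).mp (Subsingleton.elim (fracTwo a 0 1 0 ⟨1, h1⟩)
    (fracTwo a 0 1 0 0))
  simp only [pow_zero, one_mul, ZeroMemClass.coe_zero] at h2
  have h3 : (1 : CoordRing) ∈ MvPolynomial.restrictSupport ℂ (freeExps n) := by
    have h4 := (MvPolynomial.monomial_mem_restrictSupport (s := freeExps n) (m := 0) (r := 1) ℂ).mpr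
      (Or.inl (by simpa [freeExps] using hn))
    exact h4
  have h5 := normalForm_mk ha h3
  rw [map_one, h2, map_zero] at h5
  exact zero_ne_one h5

/-- A clopen set gives a global section equal to 1 on it and 0 off it. Since global sections are
constant, one of the two pieces is empty. -/
lemma connectedSpace_degeneracyLocus (hn : 0 < n) (ha : (lastCoeffs a).det ≠ 0) :
    ConnectedSpace (degeneracyLocus a) := by
  have hpre : PreconnectedSpace (degeneracyLocus a) := by
    rw [preconnectedSpace_iff_clopen]
    intro Z hZ
    let V : (degeneracyLocus a).Opens := ⟨Z, hZ.isOpen⟩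
    let V' : (degeneracyLocus a).Opens := ⟨Zᶜ, hZ.compl.isOpen⟩
    have hsup : (⊤ : (degeneracyLocus a).Opens) ≤ V ⊔ V' := fun x _ => by
      by_cases hx : x ∈ Z
      · exact Or.inl hx
      · exact Or.inr hx
    have hinf : V ⊓ V' = ⊥ := by
      ext x
      simp [V, V']
    have hsub : Subsingleton (Sections (degeneracyStructureMap a) (V ⊓ V')) := by
      rw [hinf]
      exact inferInstanceAs (Subsingleton Γ(degeneracyLocus a, ⊥))
    obtain ⟨s, hs, hs'⟩ := sections_glue (degeneracyStructureMap a) (le_top : V ≤ ⊤)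
      (le_top : V' ≤ ⊤) hsup 1 0 (Subsingleton.elim _ _)
    obtain ⟨c, rfl⟩ := exists_eq_smul_one ha s
    rw [map_smul, res_one] at hs hs'
    have hnontriv : ∀ U : (degeneracyLocus a).Opens, (U : Set (degeneracyLocus a)).Nonempty →
        (1 : Sections (degeneracyStructureMap a) U) ≠ 0 := by
      intro U hU
      have : Nonempty U := hU.to_subtype
      have : Nontrivial Γ(degeneracyLocus a, U) := inferInstance
      exact one_ne_zero (α := Γ(degeneracyLocus a, U))
    by_contra! hne
    have h1 := hnontriv V hne.1
    have h2 := hnontriv V' (Set.nonempty_compl.mpr hne.2)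
    rcases smul_eq_zero.mp hs' with hc | hc
    · rw [hc, zero_smul] at hs
      exact h1 hs.symm
    · exact h2 hc
  exact { hpre with toNonempty := nonempty_degeneracyLocus hn ha }

end Connected

end DegeneracyCurve
end

theorem mainTheorem6 (n : ℕ) (hn : 1 < n) :
    DegeneracyCurve.HoldsForGeneral fun a : Fin n × Fin (n + 1) × Fin 4 → ℂ =>
      SmoothOfRelativeDimension 1 (DegeneracyCurve.degeneracyStructureMap a) ∧
      ConnectedSpace (DegeneracyCurve.degeneracyLocus a) ∧
      Module.Finite ℂ (DegeneracyCurve.H1 a) ∧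
      (DegeneracyCurve.genus a : ℤ) =
        (n : ℤ) * (n.choose 3 : ℤ) - ((n : ℤ) + 1) * ((n - 1).choose 3 : ℤ) ∧
      DegeneracyCurve.HasDegree a ((n + 1).choose 2) := by
  obtain ⟨m, rfl⟩ : ∃ m, n = m + 1 := ⟨n - 1, by omega⟩
  obtain ⟨F₁, hF₁, h₁⟩ := DegeneracyCurve.holdsForGeneral_not_isSingularPoint
    (I := Fin (m + 1)) (J := Fin (m + 2)) (L := Fin 4)
  obtain ⟨F₂, hF₂, h₂⟩ := DegeneracyCurve.holdsForGeneral_det_lastCoeffs (n := m + 1)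
  -- The product of the two polynomials cuts out the intersection of the two open conditions.
  refine ⟨F₁ * F₂, mul_ne_zero hF₁ hF₂, fun a ha => ?_⟩
  rw [map_mul] at ha
  have ha₁ := h₁ a (left_ne_zero_of_mul ha)
  have ha₂ := h₂ a (right_ne_zero_of_mul ha)
  obtain ⟨hfin, hrank⟩ := DegeneracyCurve.finite_and_finrank_H1 ha₂
  refine ⟨DegeneracyCurve.smoothOfRelativeDimension_degeneracyStructureMap ha₁,
    DegeneracyCurve.connectedSpace_degeneracyLocus m.succ_pos ha₂, hfin, ?_,
    DegeneracyCurve.hasDegree m.succ_pos ha₂⟩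
  rw [DegeneracyCurve.genus, hrank]
  exact DegeneracyCurve.sum_range_eq_choose m.succ_pos
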